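/- **Algebra.** Let $A$ be an associative unital algebra over a field $k$. An oriented quantum algebra $(A,\rho,t_d,t_u)$ consists of an invertible $\rho\in A\otimes A$ and commuting algebra automorphisms $t_d,t_u$ of $A$ such that $(1\otimes t_u)(\rho)$ and $(t_d\otimes 1)(\rho^{-1})$ are inverses in $A\otimes A^{op}$, $\rho=(t_d\otimes t_d)(\rho)=(t_u\otimes t_u)(\rho)$, and $\rho_{12}\rho_{13}\rho_{23}=\rho_{23}\rho_{13}\rho_{12}$. Then $A^{op}=(A^{op},\rho,t_d,t_u)$ and $A_s=(A,\rho,1_A,t_d\circ t_u)$ (the associated standard algebra) are oriented quantum algebras. **Diagrams.** Oriented diagrams are taken in the plane with respect to a fixed vertical; they consist of crossings of a line $/$ and a line $\backslash$, local maxima and minima, and vertical lines, compatibly oriented. A knot diagram is closed and has exactly one component; a $1$–$1$ tangle diagram is a single arc with one end at the bottom and one at the top of the diagram. Regular isotopy of oriented knot diagrams is the equivalence relation generated by: changing the relative height of crossings and extrema that lie side by side; cancelling an adjacent maximum and minimum of a line; the second and third Reidemeister moves, and sliding a line over or under a maximum or a minimum (all orientations, and both choices of over and under lines). A local extremum has type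 $(u_-)$, $(u_+)$, $(d_+)$, $(d_-)$ if it is respectively a clockwise maximum, a counterclockwise minimum, a counterclockwise maximum, a clockwise minimum. The Whitney degree $d$ of a knot diagram is half the number of clockwise extrema minus half the number of counterclockwise ones. The diagram $\mathbf K^{op}$ is $\mathbf K$ with its orientation reversed. The closure $\mathbf K(\mathbf T)$ of a $1$–$1$ tangle diagram $\mathbf T$ joins the two ends of $\mathbf T$ by a maximum, a line on the left of $\mathbf T$, and a minimum. **The elements $w$.** Decorate the two lines of each crossing by the element (over line)$\,\otimes\,$(under line) of $A\otimes A$ given as follows. If $/$ is the over line: $\rho$ if both lines go up or both go down, $(t_u\otimes1)(\rho^{-1})$ if both go to the right, $(t_d\otimes 1)(\rho^{-1})$ if both go to the left. If $\backslash$ is the over line: $\rho^{-1}$ if both go up or both go down, $(1\otimes t_u)(\rho)$ if both go to the right, $(1\otimes t_d)(\rho)$ if both go to the left. Traverse a $1$–$1$ tangle diagram $\mathbf T$ from its beginning to its end, or a knot diagram $\mathbf K$ from a starting point $P$ on a vertical line back to $P$, in the direction of the orientation. For the $\ell$-th crossing line met, let $x_\ell$ be its decoration, let $u_d(\ell)$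 be the number of extrema of type $(d_+)$ minus the number of type $(d_-)$ met from this line to the end of the traversal, and define $u_u(\ell)$ likewise with $(u_+)$ and $(u_-)$. Then $\mathbf w_A(\mathbf T)\in A$, respectively $w(\mathbf K)\in A$, is obtained from the formal product $\prod_{\ell} t_d^{u_d(\ell)}t_u^{u_u(\ell)}(x_\ell)$, taken in the order of the traversal, by substituting the decorating tensors and extending linearly; it is $1$ if there are no crossings. **Theorem.** Let $(A,\rho,t_d,t_u)$ be an oriented quantum algebra over $k$, let $G\in A$ be invertible with $t_d\circ t_u(a)=GaG^{-1}$ for all $a\in A$, and let $\mathrm{tr}\in A^*$ satisfy $\mathrm{tr}(ab)=\mathrm{tr}(ba)$ for all $a,b\in A$. For every oriented knot diagram $\mathbf K$, with Whitney degree $d$, the scalar $$\mathbf{Inv}_{A,\mathrm{tr}}(\mathbf K)=\mathrm{tr}(G^d\,w(\mathbf K))$$ does not depend on the starting point $P$, and: a) If the oriented knot diagrams $\mathbf K,\mathbf K'$ are regularly isotopic, then $\mathbf{Inv}_{A,\mathrm{tr}}(\mathbf K)=\mathbf{Inv}_{A,\mathrm{tr}}(\mathbf K')$. b) If $\mathbf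 K$ is regularly isotopic to $\mathbf K(\mathbf T)$ for an oriented $1$–$1$ tangle diagram $\mathbf T$, then $\mathbf{Inv}_{A,\mathrm{tr}}(\mathbf K)=\mathrm{tr}(G^d\,\mathbf w_A(\mathbf T))$, where $d$ is the Whitney degree of $\mathbf K$. c) $\mathbf{Inv}_{A,\mathrm{tr}}(\mathbf K^{op})=\mathbf{Inv}_{A^{op},\mathrm{tr}}(\mathbf K)$ for every oriented knot diagram $\mathbf K$, where $\mathbf{Inv}_{A^{op},\mathrm{tr}}$ is formed with $G^{-1}$ in place of $G$. d) $\mathbf{Inv}_{A_s,\mathrm{tr}}(\mathbf K)=\mathbf{Inv}_{A,\mathrm{tr}}(\mathbf K)$ for every oriented knot diagram $\mathbf K$, where $\mathbf{Inv}_{A_s,\mathrm{tr}}$ is formed with the same $G$. -/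

import Mathlib

open scoped TensorProduct

namespace OQ

/-! ### Oriented quantum algebras -/

section Algebra

universe u v w

/-- `ρ₁₂`, that is `a ⊗ b ↦ a ⊗ b ⊗ 1`. -/
noncomputable def leg12 (k : Type u) (A : Type v) [Field k] [Ring A] [Algebra k A] :
    A ⊗[k] A →ₐ[k] (A ⊗[k] A) ⊗[k] A :=
  Algebra.TensorProduct.includeLeft

/-- `ρ₁₃`, that is `a ⊗ b ↦ a ⊗ 1 ⊗ b`. -/
noncomputable def leg13 (k : Type u) (A : Type v) [Field k] [Ring A] [Algebra k A] :
    A ⊗[k] A →ₐ[k] (A ⊗[k] A) ⊗[k] A :=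
  Algebra.TensorProduct.map Algebra.TensorProduct.includeLeft (AlgHom.id k A)

/-- `ρ₂₃`, that is `a ⊗ b ↦ 1 ⊗ a ⊗ b`. -/
noncomputable def leg23 (k : Type u) (A : Type v) [Field k] [Ring A] [Algebra k A] :
    A ⊗[k] A →ₐ[k] (A ⊗[k] A) ⊗[k] A :=
  Algebra.TensorProduct.map Algebra.TensorProduct.includeRight (AlgHom.id k A)

/-- The identity map of vector spaces `A ⊗ A → A ⊗ Aᵒᵖ`. -/
noncomputable def secondOp (k : Type u) (A : Type v) [Field k] [Ring A] [Algebra k A] :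
    A ⊗[k] A →ₗ[k] A ⊗[k] Aᵐᵒᵖ :=
  TensorProduct.map LinearMap.id (MulOpposite.opLinearEquiv k).toLinearMap

/-- An oriented quantum algebra structure `(A, ρ, t_d, t_u)` on the `k`-algebra `A`. -/
structure OrientedQuantumAlgebra (k : Type u) (A : Type v) [Field k] [Ring A] [Algebra k A] where
  /-- the invertible element `ρ ∈ A ⊗ A` -/
  rho : (A ⊗[k] A)ˣ
  /-- the automorphism `t_d` -/
  td : A ≃ₐ[k] A
  /-- the automorphism `t_u` -/
  tu : A ≃ₐ[k] A
  td_tu : ∀ x, td (tu x) = tu (td x)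
  /-- `(1 ⊗ t_u)(ρ)` and `(t_d ⊗ 1)(ρ⁻¹)` are inverses in `A ⊗ Aᵒᵖ`. -/
  qa1 : secondOp k A (TensorProduct.map LinearMap.id tu.toLinearMap (rho : A ⊗[k] A)) *
      secondOp k A (TensorProduct.map td.toLinearMap LinearMap.id (↑rho⁻¹ : A ⊗[k] A)) = 1 ∧
    secondOp k A (TensorProduct.map td.toLinearMap LinearMap.id (↑rho⁻¹ : A ⊗[k] A)) *
      secondOp k A (TensorProduct.map LinearMap.id tu.toLinearMap (rho : A ⊗[k] A)) = 1
  qa2_td : TensorProduct.map td.toLinearMap td.toLinearMap (rho : A ⊗[k] A) = rho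
  qa2_tu : TensorProduct.map tu.toLinearMap tu.toLinearMap (rho : A ⊗[k] A) = rho
  /-- the quantum Yang–Baxter equation -/
  qa3 : leg12 k A rho * leg13 k A rho * leg23 k A rho =
    leg23 k A rho * leg13 k A rho * leg12 k A rho

/-- The identity map of vector spaces `A ⊗ B → Aᵒᵖ ⊗ Bᵒᵖ`. -/
noncomputable def opOp (k : Type u) (A : Type v) (B : Type w) [Field k] [Ring A] [Algebra k A]
    [Ring B] [Algebra k B] : A ⊗[k] B →ₗ[k] Aᵐᵒᵖ ⊗[k] Bᵐᵒᵖ :=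
  TensorProduct.map (MulOpposite.opLinearEquiv k).toLinearMap
    (MulOpposite.opLinearEquiv k).toLinearMap

theorem map_antimul {k : Type u} {B C D E : Type*} [Field k] [Ring B] [Algebra k B] [Ring C]
    [Algebra k C] [Ring D] [Algebra k D] [Ring E] [Algebra k E] (f : B →ₗ[k] C) (g : D →ₗ[k] E)
    (hf : ∀ x y, f (x * y) = f y * f x) (hg : ∀ x y, g (x * y) = g y * g x) (x y : B ⊗[k] D) :
    TensorProduct.map f g (x * y) = TensorProduct.map f g y * TensorProduct.map f g x := by
  induction x using TensorProduct.induction_on with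
  | zero => simp
  | add x₁ x₂ h₁ h₂ => simp [add_mul, mul_add, h₁, h₂]
  | tmul a b =>
    induction y using TensorProduct.induction_on with
    | zero => simp
    | add y₁ y₂ h₁ h₂ => simp [add_mul, mul_add, h₁, h₂]
    | tmul c d => simp [hf, hg]

theorem opOp_mul {k : Type u} {A : Type v} {B : Type w} [Field k] [Ring A] [Algebra k A]
    [Ring B] [Algebra k B] (x y : A ⊗[k] B) :
    opOp k A B (x * y) = opOp k A B y * opOp k A B x :=
  map_antimul _ _ (fun _ _ => rfl) (fun _ _ => rfl) x y

theorem opOp_one {k : Type u} {A : Type v} {B : Type w} [Field k] [Ring A] [Algebra k A]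
    [Ring B] [Algebra k B] : opOp k A B 1 = 1 := by
  simp [opOp, Algebra.TensorProduct.one_def]

theorem map_opOp {k : Type u} {A : Type v} [Field k] [Ring A] [Algebra k A]
    (f g : A ≃ₐ[k] A) (x : A ⊗[k] A) :
    TensorProduct.map (AlgEquiv.op f).toLinearMap (AlgEquiv.op g).toLinearMap (opOp k A A x) =
      opOp k A A (TensorProduct.map f.toLinearMap g.toLinearMap x) := by
  induction x using TensorProduct.induction_on with
  | zero => simp
  | add x₁ x₂ h₁ h₂ => simp only [map_add, h₁, h₂]
  | tmul a b => simp [opOp]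

theorem secondOp_opOp {k : Type u} {A : Type v} [Field k] [Ring A] [Algebra k A]
    (x : A ⊗[k] A) : secondOp k Aᵐᵒᵖ (opOp k A A x) = opOp k A Aᵐᵒᵖ (secondOp k A x) := by
  induction x using TensorProduct.induction_on with
  | zero => simp
  | add x₁ x₂ h₁ h₂ => simp only [map_add, h₁, h₂]
  | tmul a b => simp [opOp, secondOp]

/-- The identity map of vector spaces `A ⊗ A ⊗ A → Aᵒᵖ ⊗ Aᵒᵖ ⊗ Aᵒᵖ`. -/
noncomputable def opOpOp (k : Type u) (A : Type v) [Field k] [Ring A] [Algebra k A] :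
    (A ⊗[k] A) ⊗[k] A →ₗ[k] (Aᵐᵒᵖ ⊗[k] Aᵐᵒᵖ) ⊗[k] Aᵐᵒᵖ :=
  TensorProduct.map (opOp k A A) (MulOpposite.opLinearEquiv k).toLinearMap

theorem opOpOp_mul {k : Type u} {A : Type v} [Field k] [Ring A] [Algebra k A]
    (x y : (A ⊗[k] A) ⊗[k] A) :
    opOpOp k A (x * y) = opOpOp k A y * opOpOp k A x :=
  map_antimul _ _ opOp_mul (fun _ _ => rfl) x y

theorem leg_opOp {k : Type u} {A : Type v} [Field k] [Ring A] [Algebra k A] (x : A ⊗[k] A) :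
    leg12 k Aᵐᵒᵖ (opOp k A A x) = opOpOp k A (leg12 k A x) ∧
    leg13 k Aᵐᵒᵖ (opOp k A A x) = opOpOp k A (leg13 k A x) ∧
    leg23 k Aᵐᵒᵖ (opOp k A A x) = opOpOp k A (leg23 k A x) := by
  induction x using TensorProduct.induction_on with
  | zero => simp
  | add x₁ x₂ h₁ h₂ => simp only [map_add, h₁, h₂, and_self]
  | tmul a b => simp [leg12, leg13, leg23, opOp, opOpOp]

namespace OrientedQuantumAlgebra

variable {k : Type u} {A : Type v} [Field k] [Ring A] [Algebra k A]

/-- The oriented quantum algebra `(Aᵒᵖ, ρ, t_d, t_u)`. -/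
noncomputable def op (Q : OrientedQuantumAlgebra k A) : OrientedQuantumAlgebra k Aᵐᵒᵖ where
  rho := ⟨opOp k A A Q.rho, opOp k A A (↑Q.rho⁻¹ : A ⊗[k] A),
    by rw [← opOp_mul, Units.inv_mul, opOp_one], by rw [← opOp_mul, Units.mul_inv, opOp_one]⟩
  td := AlgEquiv.op Q.td
  tu := AlgEquiv.op Q.tu
  td_tu x := by simp [Q.td_tu]
  qa1 := by
    have h₁ := fun x => map_opOp (k := k) (AlgEquiv.refl : A ≃ₐ[k] A) Q.tu x
    have h₂ := fun x => map_opOp (k := k) Q.td (AlgEquiv.refl : A ≃ₐ[k] A) x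
    have e₁ : (AlgEquiv.op (AlgEquiv.refl : A ≃ₐ[k] A)).toLinearMap = LinearMap.id := by
      ext; simp
    have e₂ : (AlgEquiv.refl : A ≃ₐ[k] A).toLinearMap = LinearMap.id := by
      ext; simp
    rw [e₁, e₂] at h₁ h₂
    simp only [Units.inv_mk, h₁, h₂, secondOp_opOp, ← opOp_mul, Q.qa1.1, Q.qa1.2, opOp_one,
      and_self]
  qa2_td := by simp only [map_opOp, Q.qa2_td]
  qa2_tu := by simp only [map_opOp, Q.qa2_tu]
  qa3 := by
    simp only [(leg_opOp _).1, (leg_opOp _).2.1, (leg_opOp _).2.2, ← opOpOp_mul,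
      ← mul_assoc, Q.qa3]

/-- The standard oriented quantum algebra `(A, ρ, 1, t_d ∘ t_u)` associated with
`(A, ρ, t_d, t_u)`. -/
noncomputable def standard (Q : OrientedQuantumAlgebra k A) : OrientedQuantumAlgebra k A where
  rho := Q.rho
  td := AlgEquiv.refl
  tu := Q.tu.trans Q.td
  td_tu x := rfl
  qa1 := by
    let F : A ⊗[k] Aᵐᵒᵖ →ₐ[k] A ⊗[k] Aᵐᵒᵖ :=
      Algebra.TensorProduct.map (AlgHom.id k A) (AlgEquiv.op Q.td).toAlgHom
    have hF : ∀ x, F (secondOp k A x) =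
        secondOp k A (TensorProduct.map LinearMap.id Q.td.toLinearMap x) := by
      intro x
      induction x using TensorProduct.induction_on with
      | zero => simp
      | add x₁ x₂ h₁ h₂ => simp only [map_add, h₁, h₂]
      | tmul a b => simp [F, secondOp]
    have hinv : TensorProduct.map Q.td.toLinearMap Q.td.toLinearMap (↑Q.rho⁻¹ : A ⊗[k] A) =
        (↑Q.rho⁻¹ : A ⊗[k] A) := by
      let T : A ⊗[k] A →ₐ[k] A ⊗[k] A := Algebra.TensorProduct.map Q.td.toAlgHom Q.td.toAlgHom
      have hT : T (Q.rho : A ⊗[k] A) = Q.rho := Q.qa2_td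
      have h1 : (Q.rho : A ⊗[k] A) * T (↑Q.rho⁻¹ : A ⊗[k] A) = 1 := by
        calc (Q.rho : A ⊗[k] A) * T (↑Q.rho⁻¹ : A ⊗[k] A)
            = T (Q.rho : A ⊗[k] A) * T (↑Q.rho⁻¹ : A ⊗[k] A) := by rw [hT]
          _ = 1 := by rw [← map_mul, Units.mul_inv, map_one]
      exact Units.eq_inv_of_mul_eq_one_left h1
    have h₁ : ∀ x : A ⊗[k] A, TensorProduct.map LinearMap.id Q.td.toLinearMap
        (TensorProduct.map LinearMap.id Q.tu.toLinearMap x) =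
        TensorProduct.map LinearMap.id (Q.tu.trans Q.td).toLinearMap x := by
      intro x
      induction x using TensorProduct.induction_on with
      | zero => simp
      | add x₁ x₂ h₁ h₂ => simp only [map_add, h₁, h₂]
      | tmul a b => simp
    have h₂ : ∀ x : A ⊗[k] A, TensorProduct.map LinearMap.id Q.td.toLinearMap
        (TensorProduct.map Q.td.toLinearMap LinearMap.id x) =
        TensorProduct.map Q.td.toLinearMap Q.td.toLinearMap x := by
      intro x
      induction x using TensorProduct.induction_on with
      | zero => simp
      | add x₁ x₂ h₁ h₂ => simp only [map_add, h₁, h₂]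
      | tmul a b => simp
    have h₃ : ∀ x : A ⊗[k] A, TensorProduct.map (AlgEquiv.refl : A ≃ₐ[k] A).toLinearMap
        LinearMap.id x = x := by
      intro x
      induction x using TensorProduct.induction_on with
      | zero => simp
      | add x₁ x₂ h₁ h₂ => simp only [map_add, h₁, h₂]
      | tmul a b => simp
    have a := congrArg F Q.qa1.1
    have b := congrArg F Q.qa1.2
    rw [map_mul, map_one, hF, hF, h₁, h₂, hinv] at a b
    rw [h₃]
    exact ⟨a, b⟩
  qa2_td := by
    have h₃ : ∀ x : A ⊗[k] A, TensorProduct.map (AlgEquiv.refl : A ≃ₐ[k] A).toLinearMap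
        (AlgEquiv.refl : A ≃ₐ[k] A).toLinearMap x = x := by
      intro x
      induction x using TensorProduct.induction_on with
      | zero => simp
      | add x₁ x₂ h₁ h₂ => simp only [map_add, h₁, h₂]
      | tmul a b => simp
    exact h₃ _
  qa2_tu := by
    have h : ∀ x : A ⊗[k] A, TensorProduct.map (Q.tu.trans Q.td).toLinearMap
        (Q.tu.trans Q.td).toLinearMap x = TensorProduct.map Q.td.toLinearMap Q.td.toLinearMap
          (TensorProduct.map Q.tu.toLinearMap Q.tu.toLinearMap x) := by
      intro x
      induction x using TensorProduct.induction_on with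
      | zero => simp
      | add x₁ x₂ h₁ h₂ => simp only [map_add, h₁, h₂]
      | tmul a b => simp
    rw [h, Q.qa2_tu, Q.qa2_td]
  qa3 := Q.qa3

end OrientedQuantumAlgebra

/-- `tr ∈ A*` is tracelike. -/
def Tracelike {k : Type u} {A : Type v} [Field k] [Ring A] [Algebra k A] (tr : A →ₗ[k] k) : Prop :=
  ∀ a b : A, tr (a * b) = tr (b * a)

end Algebra

/-! ### Oriented diagrams with respect to a vertical

A diagram, all of whose crossings and local extrema lie at different heights, is recorded as the
sequence, from bottom to top, of its slices. Each slice contains one crossing or one local extremum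
and otherwise vertical lines. -/

/-- The direction of an oriented line with respect to the vertical. -/
inductive Dir
  | up
  | down
  deriving DecidableEq

/-- The opposite direction. -/
def Dir.flip : Dir → Dir
  | up => down
  | down => up

/-- The components of oriented diagrams other than vertical lines. -/
inductive Piece
  /-- A crossing. The line `/` (from bottom left to top right) has direction `a`, the line `\` (from
  bottom right to top left) has direction `b`. The line `/` lies over `\` if `slashOver` is `true`
  and under `\` otherwise. -/
  | cross (slashOver : Bool) (a b : Dir)
  /-- A local maximum, whose left leg has direction `a`. -/
  | cap (a : Dir)
  /-- A local minimum, whose left leg has direction `a`. -/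
  | cup (a : Dir)
  deriving DecidableEq

namespace Piece

/-- The directions of the lines at the lower side of a component, from left to right. -/
def dom : Piece → List Dir
  | cross _ a b => [a, b]
  | cap a => [a, a.flip]
  | cup _ => []

/-- The directions of the lines at the upper side of a component, from left to right. -/
def cod : Piece → List Dir
  | cross _ a b => [b, a]
  | cap _ => []
  | cup a => [a, a.flip]

/-- Orientation reversal. -/
def reverse : Piece → Piece
  | cross o a b => cross o a.flip b.flip
  | cap a => cap a.flip
  | cup a => cup a.flip

/-- `1` for an extremum with clockwise orientation, `-1` for one with counterclockwise
orientation. -/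
def turn : Piece → ℤ
  | cross _ _ _ => 0
  | cap .up => 1
  | cap .down => -1
  | cup .up => 1
  | cup .down => -1

end Piece

/-- A slice: a component with vertical lines to its left and to its right. -/
structure Slice where
  left : List Dir
  piece : Piece
  right : List Dir
  deriving DecidableEq

namespace Slice

/-- The directions of the lines at the lower side of a slice. -/
def dom (s : Slice) : List Dir := s.left ++ s.piece.dom ++ s.right

/-- The directions of the lines at the upper side of a slice. -/
def cod (s : Slice) : List Dir := s.left ++ s.piece.cod ++ s.right

/-- Orientation reversal. -/
def reverse (s : Slice) : Slice :=
  ⟨s.left.map Dir.flip, s.piece.reverse, s.right.map Dir.flip⟩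

/-- Add vertical lines `l` on the left and `r` on the right. -/
def whisker (l r : List Dir) (s : Slice) : Slice := ⟨l ++ s.left, s.piece, s.right ++ r⟩

end Slice

/-- The slices fit together, from the lines `a` at the bottom to the lines `b` at the top. -/
def Composes : List Dir → List Slice → List Dir → Prop
  | a, [], b => a = b
  | a, s :: D, b => a = s.dom ∧ Composes s.cod D b

/-- The four types of oriented local extrema: `uMinus` is a maximum traversed clockwise, `uPlus` a
minimum traversed counterclockwise, `dPlus` a maximum traversed counterclockwise and `dMinus` a
minimum traversed clockwise. -/
inductive Extremum
  | uMinus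
  | uPlus
  | dPlus
  | dMinus
  deriving DecidableEq

/-- What is met in a traversal of a diagram with `n` slices: the over line or the under line of the
crossing in slice `c`, or a local extremum. -/
inductive Encounter (n : ℕ)
  | over (c : Fin n)
  | under (c : Fin n)
  | extremum (x : Extremum)
  deriving DecidableEq

namespace Encounter

variable {n : ℕ}

/-- The over line (`true`) or the under line (`false`) of a crossing. -/
def line (c : Fin n) (o : Bool) : Encounter n := if o then .over c else .under c

/-- The number of local extrema of type `(d₊)` minus the number of those of type `(d₋)`. -/
def ud : List (Encounter n) → ℤ
  | [] => 0
  | extremum .dPlus :: es => ud es + 1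
  | extremum .dMinus :: es => ud es - 1
  | _ :: es => ud es

/-- The number of local extrema of type `(u₊)` minus the number of those of type `(u₋)`. -/
def uu : List (Encounter n) → ℤ
  | [] => 0
  | extremum .uPlus :: es => uu es + 1
  | extremum .uMinus :: es => uu es - 1
  | _ :: es => uu es

end Encounter

/-- The passage through a slice, the `c`-th one of a diagram with `n` slices: whoever enters it
heading in direction `d` (from below if `d` is up, from above if `d` is down) at position `j` leaves
it in the given direction (through the upper side if this is up, through the lower side otherwise)
at the given position, having met the given line or extremum, if any. -/
def Slice.pass {n : ℕ} (c : Fin n) (s : Slice) (d : Dir) (j : ℕ) :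
    Dir × ℕ × Option (Encounter n) :=
  let l := s.left.length
  match s.piece, d with
  | .cross o _ _, .up =>
      if j = l then (.up, l + 1, some (.line c o))
      else if j = l + 1 then (.up, l, some (.line c !o))
      else (.up, j, none)
  | .cross o _ _, .down =>
      if j = l then (.down, l + 1, some (.line c !o))
      else if j = l + 1 then (.down, l, some (.line c o))
      else (.down, j, none)
  | .cap a, .up =>
      let x : Encounter n := .extremum (match a with | .up => .uMinus | .down => .dPlus)
      if j < l then (.up, j, none)
      else if j = l then (.down, l + 1, some x)
      else if j = l + 1 then (.down, l, some x)
      else (.up, j - 2, none)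
  | .cap _, .down => if j < l then (.down, j, none) else (.down, j + 2, none)
  | .cup a, .down =>
      let x : Encounter n := .extremum (match a with | .up => .dMinus | .down => .uPlus)
      if j < l then (.down, j, none)
      else if j = l then (.up, l + 1, some x)
      else if j = l + 1 then (.up, l, some x)
      else (.down, j - 2, none)
  | .cup _, .up => if j < l then (.up, j, none) else (.up, j + 2, none)

/-- The data of an oriented diagram: the directions of the lines entering at the bottom, and the
slices from bottom to top. -/
structure Diagram where
  bottom : List Dir
  slices : List Slice
  deriving DecidableEq

namespace Diagram

/-- The directions of the lines below, between and above the slices. -/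
def levels (D : Diagram) : List (List Dir) := D.bottom :: D.slices.map Slice.cod

/-- The direction of the diagram at the point `p = (i, j)`, which lies on the `j`-th line from the
left at level `i`, below the `i`-th slice; `none` if there is no such point. -/
def dirAt (D : Diagram) (p : ℕ × ℕ) : Option Dir := (D.levels.getD p.1 [])[p.2]?

/-- `p` is a point of the diagram (on a vertical line between two slices). -/
def HasPoint (D : Diagram) (p : ℕ × ℕ) : Prop := (D.dirAt p).isSome

/-- The number of points of the diagram. -/
def numPoints (D : Diagram) : ℕ := (D.levels.map List.length).sum

/-- Follow the orientation from `p` through the adjacent slice: what is met there, if anything, and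
the next point; `none` at the end of the diagram. -/
def visit (D : Diagram) (p : ℕ × ℕ) :
    Option (Option (Encounter D.slices.length) × (ℕ × ℕ)) :=
  match D.dirAt p, p with
  | some .up, (i, j) =>
      if h : i < D.slices.length then
        let r := (D.slices[i]).pass ⟨i, h⟩ .up j
        some (r.2.2, (if r.1 = .up then i + 1 else i, r.2.1))
      else none
  | some .down, (i + 1, j) =>
      if h : i < D.slices.length then
        let r := (D.slices[i]).pass ⟨i, h⟩ .down j
        some (r.2.2, (if r.1 = .up then i + 1 else i, r.2.1))
      else none
  | _, _ => none

/-- The first `m` points (fewer if the end is reached before) on the traversal of the diagram from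
`p` in the direction of the orientation, each with what is met just after it. -/
def walk (D : Diagram) : ℕ → ℕ × ℕ → List ((ℕ × ℕ) × Option (Encounter D.slices.length))
  | 0, _ => []
  | m + 1, p =>
    match D.visit p with
    | none => [(p, none)]
    | some (e, q) => (p, e) :: walk D m q

/-- The traversal from `p` meets all points of the diagram. -/
def Covers (D : Diagram) (p : ℕ × ℕ) : Prop :=
  ∀ q, D.HasPoint q → q ∈ (D.walk D.numPoints p).map Prod.fst

/-- The crossing lines and local extrema met, in this order, on the traversal of the diagram from
`p`. For a knot diagram this is the full traversal from `p` back to `p`, and for a `1`–`1` tangle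
diagram with beginning `p` it is the full traversal from the beginning to the end. -/
def encounters (D : Diagram) (p : ℕ × ℕ) : List (Encounter D.slices.length) :=
  (D.walk D.numPoints p).filterMap Prod.snd

/-- `D` is an oriented knot diagram: a closed diagram with exactly one component. -/
def IsKnot (D : Diagram) : Prop :=
  D.bottom = [] ∧ Composes [] D.slices [] ∧ D.slices ≠ [] ∧ ∀ p, D.HasPoint p → D.Covers p

/-- The beginning, in terms of orientation, of a `1`–`1` tangle diagram of direction `a`. -/
def start (D : Diagram) : Dir → ℕ × ℕ
  | .up => (0, 0)
  | .down => (D.slices.length, 0)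

/-- `D` is an oriented `1`–`1` tangle diagram, traversed from the bottom to the top if `a` is up and
from the top to the bottom if `a` is down. It consists of a single arc. -/
def IsTangle (D : Diagram) (a : Dir) : Prop :=
  D.bottom = [a] ∧ Composes [a] D.slices [a] ∧ D.Covers (D.start a)

/-- The diagram with its orientation reversed. -/
def reverse (D : Diagram) : Diagram := ⟨D.bottom.map Dir.flip, D.slices.map Slice.reverse⟩

/-- The Whitney degree of a knot diagram: half of the difference of the number of local extrema with
clockwise orientation and the number of those with counterclockwise orientation (this difference is
even for a closed diagram). -/
def whitney (D : Diagram) : ℤ := (D.slices.map fun s => s.piece.turn).sum / 2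

/-- The closure `K(T)` of a `1`–`1` tangle diagram `T` of direction `a`: the top of `T` is joined to
its bottom by a line of the opposite direction on the left of `T`. -/
def closure (T : Diagram) (a : Dir) : Diagram :=
  ⟨[], ⟨[], .cup a.flip, []⟩ ::
    (T.slices.map (Slice.whisker [a.flip] []) ++ [⟨[], .cap a.flip, []⟩])⟩

end Diagram

/-! ### Regular isotopy -/

/-- The local equivalences generating regular isotopy, with all orientations. For `o = false` the
crossings of `o = true` have their over and under lines exchanged. -/
inductive LocalMove : List Slice → List Slice → Prop
  /-- Crossings and extrema which lie side by side may change their order in height. -/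
  | interchange (p q : Piece) (m : List Dir) :
      LocalMove [⟨[], p, m ++ q.dom⟩, ⟨p.cod ++ m, q, []⟩]
        [⟨p.dom ++ m, q, []⟩, ⟨[], p, m ++ q.cod⟩]
  /-- Cancellation of a maximum and a minimum, the maximum on the left. -/
  | maxMin (a : Dir) : LocalMove [⟨[a], .cup a.flip, []⟩, ⟨[], .cap a, [a]⟩] []
  /-- Cancellation of a minimum and a maximum, the minimum on the left. -/
  | minMax (a : Dir) : LocalMove [⟨[], .cup a, [a]⟩, ⟨[a], .cap a.flip, []⟩] []
  /-- The second Reidemeister move. -/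
  | cancel (o : Bool) (a b : Dir) :
      LocalMove [⟨[], .cross o a b, []⟩, ⟨[], .cross (!o) b a, []⟩] []
  /-- The third Reidemeister move. -/
  | triangle (o : Bool) (a b c : Dir) :
      LocalMove
        [⟨[], .cross o a b, [c]⟩, ⟨[b], .cross o a c, []⟩, ⟨[], .cross o b c, [a]⟩]
        [⟨[a], .cross o b c, []⟩, ⟨[], .cross o a c, [b]⟩, ⟨[c], .cross o a b, []⟩]
  /-- A line of direction `c` slides under or over a maximum. -/
  | slideMax (o : Bool) (a c : Dir) :
      LocalMove [⟨[], .cross o a c, [a.flip]⟩, ⟨[c], .cap a, []⟩]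
        [⟨[a], .cross (!o) c a.flip, []⟩, ⟨[], .cap a, [c]⟩]
  /-- A line of direction `c` slides under or over a minimum. -/
  | slideMin (o : Bool) (a c : Dir) :
      LocalMove [⟨[c], .cup a, []⟩, ⟨[], .cross o c a, [a.flip]⟩]
        [⟨[], .cup a, [c]⟩, ⟨[a], .cross (!o) a.flip c, []⟩]

namespace Diagram

/-- `D'` is obtained from `D` by replacing a local portion by its equivalent. -/
inductive Move : Diagram → Diagram → Prop
  | replace (b l r : List Dir) (X Y L R : List Slice) (h : LocalMove L R) :
      Move ⟨b, X ++ L.map (Slice.whisker l r) ++ Y⟩ ⟨b, X ++ R.map (Slice.whisker l r) ++ Y⟩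

/-- Regular isotopy of oriented knot diagrams: the equivalence relation generated by the moves
between oriented knot diagrams. -/
def RegularlyIsotopic (D D' : Diagram) : Prop :=
  Relation.EqvGen (fun K K' => K.IsKnot ∧ K'.IsKnot ∧ Move K K') D D'

end Diagram

/-! ### The invariants -/

namespace OrientedQuantumAlgebra

universe u v

variable {k : Type u} {A : Type v} [Field k] [Ring A] [Algebra k A]

/-- The decorations of the two lines of a crossing, written as an element
(over line) `⊗` (under line) of `A ⊗ A`. -/
noncomputable def decoration (Q : OrientedQuantumAlgebra k A) : Bool → Dir → Dir → A ⊗[k] A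
  | true, .up, .up => Q.rho
  | true, .down, .down => Q.rho
  | true, .up, .down =>
      TensorProduct.map Q.tu.toLinearMap LinearMap.id (↑Q.rho⁻¹ : A ⊗[k] A)
  | true, .down, .up =>
      TensorProduct.map Q.td.toLinearMap LinearMap.id (↑Q.rho⁻¹ : A ⊗[k] A)
  | false, .up, .up => (↑Q.rho⁻¹ : A ⊗[k] A)
  | false, .down, .down => (↑Q.rho⁻¹ : A ⊗[k] A)
  | false, .up, .down => TensorProduct.map LinearMap.id Q.tu.toLinearMap (Q.rho : A ⊗[k] A)
  | false, .down, .up => TensorProduct.map LinearMap.id Q.td.toLinearMap (Q.rho : A ⊗[k] A)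

/-- Finitely many pairs `(x, y)` such that the given tensor is the sum of the `x ⊗ y`. -/
noncomputable def terms (x : A ⊗[k] A) : Finset (A × A) := (TensorProduct.exists_finset x).choose

theorem sum_terms (x : A ⊗[k] A) : x = ∑ i ∈ terms x, i.1 ⊗ₜ[k] i.2 :=
  (TensorProduct.exists_finset x).choose_spec

/-- The pairs of labels (over line, under line) over which the sum is taken at a component. At a
local extremum there is only a dummy pair, which is never used. -/
noncomputable def labels (Q : OrientedQuantumAlgebra k A) : Piece → Finset (A × A)
  | .cross o a b => terms (Q.decoration o a b)
  | .cap _ => {(1, 1)}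
  | .cup _ => {(1, 1)}

/-- The product, in the order in which the crossing lines are met, of the
`t_d ^ u_d (t_u ^ u_u (x))`, where `x` is the label of the crossing line and `u_d`, `u_u` count the
local extrema between the crossing line and the end of the traversal. -/
noncomputable def word (Q : OrientedQuantumAlgebra k A) {n : ℕ} (f : Fin n → A × A) :
    List (Encounter n) → A
  | [] => 1
  | .over c :: es =>
      (Q.td ^ Encounter.ud es) ((Q.tu ^ Encounter.uu es) (f c).1) * word Q f es
  | .under c :: es =>
      (Q.td ^ Encounter.ud es) ((Q.tu ^ Encounter.uu es) (f c).2) * word Q f es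
  | .extremum _ :: es => word Q f es

/-- The element of `A` obtained from the traversal of `D` from `p`, by substituting `ρ` and `ρ⁻¹`
into the formal word: the sum over all choices of labels of the products above. Each line of each
crossing of a knot or tangle diagram is met once, so that this depends only on the decorations and
not on how they are written as sums. -/
noncomputable def w (Q : OrientedQuantumAlgebra k A) (D : Diagram) (p : ℕ × ℕ) : A :=
  ∑ f ∈ Fintype.piFinset fun c : Fin D.slices.length => Q.labels D.slices[c].piece,
    Q.word f (D.encounters p)

/-- `w_A(T)` for a `1`–`1` tangle diagram `T` of direction `a`. -/
noncomputable def wTangle (Q : OrientedQuantumAlgebra k A) (T : Diagram) (a : Dir) : A :=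
  Q.w T (T.start a)

/-- The scalar `tr (G ^ d w(K))`, computed with starting point `p`, where `d` is the Whitney degree
of the knot diagram `K`. -/
noncomputable def inv (Q : OrientedQuantumAlgebra k A) (G : Aˣ) (tr : A →ₗ[k] k)
    (K : Diagram) (p : ℕ × ℕ) : k :=
  tr ((G ^ K.whitney : Aˣ) * Q.w K p)

/-- `tr`, regarded as a linear functional on `Aᵒᵖ`. -/
noncomputable def trOp (tr : A →ₗ[k] k) : Aᵐᵒᵖ →ₗ[k] k :=
  tr ∘ₗ (MulOpposite.opLinearEquiv k).symm.toLinearMap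

/-- `G⁻¹`, regarded as an invertible element of `Aᵒᵖ`. -/
def invOp (G : Aˣ) : Aᵐᵒᵖˣ := Units.opEquiv.symm (MulOpposite.op G⁻¹)

end OrientedQuantumAlgebra

end OQ

/-! ### Links: the part of a diagram below a level, as a labelled matching. -/

namespace OQ

/-! The scalar `tr (G ^ d w(K))` is rewritten as a state sum that is computed slice by slice, makes
no reference to a starting point, and can be compared locally before and after a move.

Since `t_d ∘ t_u` is conjugation by `G`, one has `t_d^m t_u^n = (t_d t_u)^n t_d^(m-n)`. Instead of
applying the powers `u_d`, `u_u` to the labels of the crossing lines, one may therefore insert `G`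
at every extremum of type `(u_-)` and `G⁻¹` at every one of type `(u_+)`. What remains to be applied
is `t_d^(u_d - u_u)`, and this exponent depends only on the directions of the line at the crossing
and at the end of the traversal. Absorbed into the decorations, these powers turn the decorations of
`A` into those of the standard algebra `A_s` (`map_transport`). The power of `G` that is left over
in front is `u_u` of the whole traversal, and this is `-d` (`whitney_eq`). Thus the invariant is the
trace of the product of the labels met around the knot, with decorations from `A_s`.

This trace is built from bottom to top. The part of a diagram below a level consists of arcs which
enter that part on a line directed down and leave it on a line directed up. A `Link` records which
positions are joined and, for every end, a factor of the product along the arc; only the product of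
the two factors, `word`, has a meaning (`Same`). A slice acts on links, and a maximum whose legs
belong to the same arc closes a loop and contributes its trace. Summing over the labels of the
crossings gives `stateSum`. In a knot diagram only the last slice closes a loop, and this loop is
the whole diagram (`exists_closed`), so the state sum is the required trace (`inv_eq_stateSum`).
Independence of the starting point and the comparison with `A_s` follow at once.

For regular isotopy, the slices above a move define a functional that is linear in each label of a
line at the given level (`stateSum_isLinearMap`). Hence every move reduces to an identity of
tensors; the identities are collected in `Relations` and hold for `A_s` (`relations_standard`). The
second Reidemeister move says that the decorations are inverse in `A ⊗ A` or in `A ⊗ Aᵐᵒᵖ`. The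
third is the Yang–Baxter equation together with what follows from it by inverting factors, also in
`A ⊗ Aᵐᵒᵖ ⊗ A`. Sliding over an extremum uses `θ(x) G = G x` and `(θ ⊗ θ)(ρ) = ρ` for `θ = t_d ∘
t_u`. The trace property enters where a move meets the closing of a loop.

Reversal of orientation is followed through the state sum: the word of a reversed arc is the old
word, read in the opposite algebra, times `G⁻¹` (`Reversed.act`). Closing a tangle adds extrema
only; they conjugate the word of the tangle by a power of `G`, which the trace does not see
(`inv_closure`). -/

/-- The transposition of the positions `l` and `l + 1`. -/
def swapAt (l j : ℕ) : ℕ := if j = l then l + 1 else if j = l + 1 then l else j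

/-- The new position of the line at position `j` when two lines are inserted at `l`. -/
def insAt (l j : ℕ) : ℕ := if j < l then j else j + 2

/-- The new position of the line at position `j` when the lines at `l` and `l + 1` are removed. -/
def delAt (l j : ℕ) : ℕ := if j < l + 2 then min j l else j - 2

/-- The position of the ascending leg of an extremum at `l` whose left leg has direction `a`. -/
def upLeg (l : ℕ) : Dir → ℕ
  | .up => l
  | .down => l + 1

/-- The position of the descending leg of an extremum at `l` whose left leg has direction `a`. -/
def downLeg (l : ℕ) : Dir → ℕ
  | .up => l + 1
  | .down => l

/-- The type of a maximum whose left leg has direction `a`. -/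
def capType : Dir → Extremum
  | .up => .uMinus
  | .down => .dPlus

/-- The type of a minimum whose left leg has direction `a`. -/
def cupType : Dir → Extremum
  | .up => .dMinus
  | .down => .uPlus

/-- The product of `x` and `y` in the order in which they are met along a line of direction `d`, if
`x` lies below `y`. -/
def mulAlong {M : Type*} [Mul M] (d : Dir) (x y : M) : M :=
  match d with
  | .up => x * y
  | .down => y * x

/-- The part of a closed diagram below a level: the lines through that level are joined in pairs by
`mate`, and the arc entering at position `j` carries `label j * label (mate j)`. -/
@[ext]
structure Link (M : Type*) where
  mate : ℕ → ℕ
  label : ℕ → M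

namespace Link

variable {M : Type*} [Monoid M]

/-- Add a crossing at position `l`, with `x` on the line `/` and `y` on the line `\`. -/
def cross (l : ℕ) (a b : Dir) (x y : M) (σ : Link M) : Link M where
  mate j := swapAt l (σ.mate (swapAt l j))
  label j := if j = l then mulAlong b (σ.label (l + 1)) y
    else if j = l + 1 then mulAlong a (σ.label l) x else σ.label j

/-- Add a minimum at position `l`, labelled by `g`. -/
def cup (l : ℕ) (a : Dir) (g : M) (σ : Link M) : Link M where
  mate j := if j = l then l + 1 else if j = l + 1 then l else insAt l (σ.mate (delAt l j))
  label j := if j = downLeg l a then g else if j = upLeg l a then 1 else σ.label (delAt l j)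

/-- Add a maximum at position `l`, labelled by `g`. -/
def cap (l : ℕ) (a : Dir) (g : M) (σ : Link M) : Link M where
  mate j := delAt l (if σ.mate (insAt l j) = l then σ.mate (l + 1)
    else if σ.mate (insAt l j) = l + 1 then σ.mate l else σ.mate (insAt l j))
  label j := if σ.mate (insAt l j) = upLeg l a
    then σ.label (insAt l j) * (σ.label (upLeg l a) * g * σ.label (downLeg l a))
    else σ.label (insAt l j)

/-- Add a component at position `l`; the labels `x` of the over line and the under line are used if
it is a crossing, and the labels `g` otherwise. -/
def act (g : Extremum → M) (p : Piece) (l : ℕ) (x : M × M) (σ : Link M) : Link M :=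
  match p with
  | .cross o a b => σ.cross l a b (if o then x.1 else x.2) (if o then x.2 else x.1)
  | .cap a => σ.cap l a (g (capType a))
  | .cup a => σ.cup l a (g (cupType a))

/-- The lines are joined in pairs of opposite directions. -/
structure Valid (σ : Link M) (lv : List Dir) : Prop where
  mate_mate : ∀ j, σ.mate (σ.mate j) = j
  mate_dir : ∀ j d, lv[j]? = some d → lv[σ.mate j]? = some d.flip

/-! ### Crossings and extrema at disjoint positions commute. -/

theorem swapAt_swapAt (l j : ℕ) : swapAt l (swapAt l j) = j := by
  unfold swapAt; split_ifs <;> omega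

theorem swapAt_comm {l l' : ℕ} (h : l + 2 ≤ l') (j : ℕ) :
    swapAt l (swapAt l' j) = swapAt l' (swapAt l j) := by
  unfold swapAt; split_ifs <;> omega

theorem swapAt_eq_iff (l j j' : ℕ) : swapAt l j = j' ↔ j = swapAt l j' := by
  unfold swapAt; split_ifs <;> omega

theorem swapAt_of_lt {l j : ℕ} (h : j < l) : swapAt l j = j := by
  unfold swapAt; split_ifs <;> omega

theorem swapAt_of_gt {l j : ℕ} (h : l + 1 < j) : swapAt l j = j := by
  unfold swapAt; split_ifs <;> omega

theorem swapAt_insAt {l l' : ℕ} (h : l + 2 ≤ l') (j : ℕ) :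
    swapAt l (insAt l' j) = insAt l' (swapAt l j) := by
  unfold swapAt insAt; split_ifs <;> omega

theorem swapAt_insAt' {l l' : ℕ} (h : l ≤ l') (j : ℕ) :
    swapAt (l' + 2) (insAt l j) = insAt l (swapAt l' j) := by
  unfold swapAt insAt; split_ifs <;> omega

theorem swapAt_delAt {l l' : ℕ} (h : l + 2 ≤ l') (j : ℕ) :
    swapAt l (delAt l' j) = delAt l' (swapAt l j) := by
  unfold swapAt delAt; split_ifs <;> omega

/-- Both removed positions are sent to `l` by `delAt l`, and for `l' = l` the transposition on the
right would move this default value; hence the exclusions. -/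
theorem delAt_swapAt {l l' j : ℕ} (h : l ≤ l') (h₁ : j ≠ l) (h₂ : j ≠ l + 1) :
    delAt l (swapAt (l' + 2) j) = swapAt l' (delAt l j) := by
  unfold swapAt delAt; split_ifs <;> omega

theorem upLeg_mem (l : ℕ) (a : Dir) : l ≤ upLeg l a ∧ upLeg l a ≤ l + 1 := by
  cases a <;> simp [upLeg]

theorem downLeg_mem (l : ℕ) (a : Dir) : l ≤ downLeg l a ∧ downLeg l a ≤ l + 1 := by
  cases a <;> simp [downLeg]

theorem upLeg_ne_downLeg (l : ℕ) (a : Dir) : upLeg l a ≠ downLeg l a := by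
  cases a <;> simp [upLeg, downLeg]

theorem insAt_of_lt {l j : ℕ} (h : j < l) : insAt l j = j := by
  unfold insAt; split_ifs; rfl

theorem insAt_of_le {l j : ℕ} (h : l ≤ j) : insAt l j = j + 2 := by
  unfold insAt; split_ifs <;> omega

theorem delAt_of_lt {l j : ℕ} (h : j < l) : delAt l j = j := by
  unfold delAt; split_ifs <;> omega

theorem delAt_of_le {l j : ℕ} (h : l + 2 ≤ j) : delAt l j = j - 2 := by
  unfold delAt; split_ifs <;> omega

theorem insAt_ne (l j : ℕ) : insAt l j ≠ l ∧ insAt l j ≠ l + 1 := by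
  unfold insAt; split_ifs <;> omega

theorem delAt_insAt (l j : ℕ) : delAt l (insAt l j) = j := by
  unfold insAt delAt; split_ifs <;> omega

theorem insAt_delAt {l j : ℕ} (h₁ : j ≠ l) (h₂ : j ≠ l + 1) : insAt l (delAt l j) = j := by
  unfold insAt delAt; split_ifs <;> omega

theorem insAt_insAt {l l' : ℕ} (h : l ≤ l') (j : ℕ) :
    insAt l (insAt l' j) = insAt (l' + 2) (insAt l j) := by
  unfold insAt; split_ifs <;> omega

theorem cross_cross_comm {l l' : ℕ} (hl : l + 2 ≤ l') (a b a' b' : Dir) (x y x' y' : M)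
    (σ : Link M) : (σ.cross l a b x y).cross l' a' b' x' y' =
      (σ.cross l' a' b' x' y').cross l a b x y := by
  ext j
  · simp only [cross, swapAt_comm hl]
  · simp only [cross]; split_ifs <;> first | rfl | omega

/-- A cap multiplies the label at the far end of the arc that arrives at its up leg, always on the
right, whereas a crossing multiplies on the right only on lines directed up. The two operations
could disagree only if that far end were itself directed up; `h₀` and `h₁` exclude this, and in a
valid link mates have opposite directions. -/
theorem cross_cap_comm {l l' : ℕ} (hl : l + 2 ≤ l') (a b a' : Dir) (x y g : M)
    (σ : Link M) (h₀ : a = .up → σ.mate l ≠ upLeg l' a')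
    (h₁ : b = .up → σ.mate (l + 1) ≠ upLeg l' a') : (σ.cross l a b x y).cap l' a' g =
      (σ.cap l' a' g).cross l a b x y := by
  have e₁ := swapAt_of_gt (l := l) (j := l') (by omega)
  have e₂ := swapAt_of_gt (l := l) (j := l' + 1) (by omega)
  ext j
  · simp only [cross, cap, swapAt_insAt hl, swapAt_eq_iff, e₁, e₂, ← apply_ite (swapAt l),
       swapAt_delAt hl]
  · obtain ⟨hu, hu'⟩ := upLeg_mem l' a'
    obtain ⟨hd, hd'⟩ := downLeg_mem l' a'
    simp only [cross, cap, swapAt_insAt hl, swapAt_eq_iff]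
    generalize upLeg l' a' = u at *
    generalize downLeg l' a' = d at *
    rw [swapAt_of_gt (l := l) (j := u) (by omega)]
    rw [if_neg (by omega : u ≠ l), if_neg (by omega : u ≠ l + 1), if_neg (by omega : d ≠ l),
      if_neg (by omega : d ≠ l + 1)]
    obtain rfl | rfl | ⟨h, h'⟩ : j = l ∨ j = l + 1 ∨ (j ≠ l ∧ j ≠ l + 1) := by omega
    · have : swapAt j j = j + 1 := by simp [swapAt]
      simp only [this, insAt_of_lt (show j < l' by omega), insAt_of_lt (show j + 1 < l' by omega)]
      cases b <;> simp_all [mulAlong, mul_assoc]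
      
    · have : swapAt l (l + 1) = l := by simp [swapAt]
      simp only [this, insAt_of_lt (show l < l' by omega), insAt_of_lt (show l + 1 < l' by omega)]
      cases a <;> simp_all [mulAlong, mul_assoc]
    · have : swapAt l j = j := by simp [swapAt, *]
      have : insAt l' j ≠ l := by unfold insAt; split_ifs <;> omega
      have : insAt l' j ≠ l + 1 := by unfold insAt; split_ifs <;> omega
      simp [*]

theorem cross_cup_comm {l l' : ℕ} (hl : l + 2 ≤ l') (a b a' : Dir) (x y g : M)
    (σ : Link M) : (σ.cross l a b x y).cup l' a' g = (σ.cup l' a' g).cross l a b x y := by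
  have e₁ := swapAt_of_gt (l := l) (j := l') (by omega)
  have e₂ := swapAt_of_gt (l := l) (j := l' + 1) (by omega)
  ext j
  · simp only [cross, cup, swapAt_eq_iff, e₁, e₂, ← swapAt_delAt hl]
    split_ifs <;> simp_all [swapAt_insAt hl]
  · obtain ⟨hu, hu'⟩ := upLeg_mem l' a'
    obtain ⟨hd, hd'⟩ := downLeg_mem l' a'
    have := upLeg_ne_downLeg l' a'
    simp only [cross, cup]
    generalize upLeg l' a' = u at *
    generalize downLeg l' a' = d at *
    rw [delAt_of_lt (show l < l' by omega), delAt_of_lt (show l + 1 < l' by omega)]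
    obtain h | h | h | h : j < l' ∨ j = d ∨ j = u ∨ l' + 2 ≤ j := by omega
    · rw [delAt_of_lt h]
      split_ifs <;> first | rfl | omega
    · split_ifs <;> first | rfl | omega
    · split_ifs <;> first | rfl | omega
    · rw [delAt_of_le h]
      split_ifs <;> first | rfl | omega

/-- The last three hypotheses keep the joined mate away from the two removed positions, at which
`delAt` has a default value that need not commute with the transposition. -/
theorem cap_cross_comm {l l' : ℕ} (hl : l ≤ l') (a b a' : Dir) (x y g : M)
    (σ : Link M) (h₀ : a = .up → σ.mate (l' + 2) ≠ upLeg l a')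
    (h₁ : b = .up → σ.mate (l' + 3) ≠ upLeg l a') 
    (hσ : ∀ j, σ.mate (σ.mate j) = j) (hl₀ : σ.mate l ≠ l) (hl₁ : σ.mate (l + 1) ≠ l + 1) :
    (σ.cap l a' g).cross l' a b x y =
      (σ.cross (l' + 2) a b x y).cap l a' g := by
  have e₁ := swapAt_of_lt (l := l' + 2) (j := l) (by omega)
  have e₂ := swapAt_of_lt (l := l' + 2) (j := l + 1) (by omega)
  ext j
  · simp only [cross, cap, swapAt_insAt' hl, swapAt_eq_iff, e₁, e₂, ← apply_ite (swapAt (l' + 2))]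
    obtain ⟨hi, hi'⟩ := insAt_ne l (swapAt l' j)
    rw [delAt_swapAt hl]
    all_goals grind [swapAt_swapAt]
  · obtain ⟨hu, hu'⟩ := upLeg_mem l a'
    obtain ⟨hd, hd'⟩ := downLeg_mem l a'
    simp only [cross, cap, swapAt_insAt' hl, swapAt_eq_iff]
    generalize upLeg l a' = u at *
    generalize downLeg l a' = d at *
    rw [swapAt_of_lt (l := l' + 2) (j := u) (by omega)]
    rw [if_neg (by omega : u ≠ l' + 2), if_neg (by omega : u ≠ l' + 2 + 1),
      if_neg (by omega : d ≠ l' + 2), if_neg (by omega : d ≠ l' + 2 + 1)]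
    obtain rfl | rfl | ⟨h, h'⟩ : j = l' ∨ j = l' + 1 ∨ (j ≠ l' ∧ j ≠ l' + 1) := by omega
    · have : swapAt j j = j + 1 := by simp [swapAt]
      simp only [this, insAt_of_le (show l ≤ j by omega), insAt_of_le (show l ≤ j + 1 by omega)]
      cases b <;> simp_all [mulAlong, mul_assoc, add_right_comm]
    · have : swapAt l' (l' + 1) = l' := by simp [swapAt]
      simp only [this, insAt_of_le (show l ≤ l' by omega), insAt_of_le (show l ≤ l' + 1 by omega)]
      cases a <;> simp_all [mulAlong, mul_assoc]
    · have : swapAt l' j = j := by simp [swapAt, *]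
      have : insAt l j ≠ l' + 2 := by unfold insAt; split_ifs <;> omega
      have : insAt l j ≠ l' + 2 + 1 := by unfold insAt; split_ifs <;> omega
      simp [*]

theorem cup_cross_comm {l l' : ℕ} (hl : l ≤ l') (a b a' : Dir) (x y g : M)
    (σ : Link M) : (σ.cup l a' g).cross (l' + 2) a b x y = (σ.cross l' a b x y).cup l a' g := by
  have e₁ := swapAt_of_lt (l := l' + 2) (j := l) (by omega)
  have e₂ := swapAt_of_lt (l := l' + 2) (j := l + 1) (by omega)
  ext j
  · simp only [cross, cup, swapAt_eq_iff, e₁, e₂]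
    split_ifs with h h'
    · simp_all
    · simp_all
    · rw [delAt_swapAt hl h h', swapAt_insAt' hl, swapAt_swapAt]
  · obtain ⟨hu, hu'⟩ := upLeg_mem l a'
    obtain ⟨hd, hd'⟩ := downLeg_mem l a'
    have := upLeg_ne_downLeg l a'
    simp only [cross, cup]
    generalize upLeg l a' = u at *
    generalize downLeg l a' = d at *
    obtain rfl | rfl | ⟨h, h'⟩ : j = l' + 2 ∨ j = l' + 3 ∨ (j ≠ l' + 2 ∧ j ≠ l' + 3) := by omega
    · simp (disch := omega) [delAt_of_le]
      simp (disch := omega) only [if_neg]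
    · simp (disch := omega) [delAt_of_le]
      simp (disch := omega) only [if_neg]
    · obtain h | h | h | h : j < l ∨ j = d ∨ j = u ∨ l + 2 ≤ j := by omega
      · rw [delAt_of_lt h]
        split_ifs <;> first | rfl | omega
      · split_ifs <;> first | rfl | omega
      · split_ifs <;> first | rfl | omega
      · rw [delAt_of_le h]
        split_ifs <;> first | rfl | omega

theorem cup_cup_comm {l l' : ℕ} (hl : l ≤ l') (a a' : Dir) (g g' : M)
    (σ : Link M) : (σ.cup l a g).cup (l' + 2) a' g' = (σ.cup l' a' g').cup l a g := by
  ext j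
  · simp only [cup]
    generalize hi : σ.mate = m
    unfold insAt delAt
    obtain h | h | h | h | h | h | h : j < l ∨ j = l ∨ j = l + 1 ∨ (l + 1 < j ∧ j < l' + 2)  ∨ j = l' + 2 ∨ j = l' + 3 ∨ l' + 3 < j := by omega
    all_goals grind
  · obtain ⟨hu, hu'⟩ := upLeg_mem l a
    obtain ⟨hd, hd'⟩ := downLeg_mem l a
    have e₁ : upLeg (l' + 2) a' = upLeg l' a' + 2 := by cases a' <;> rfl
    have e₂ : downLeg (l' + 2) a' = downLeg l' a' + 2 := by cases a' <;> rfl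
    obtain ⟨hu₁, hu₁'⟩ := upLeg_mem l' a'
    obtain ⟨hd₁, hd₁'⟩ := downLeg_mem l' a'
    have := upLeg_ne_downLeg l a
    have := upLeg_ne_downLeg l' a'
    simp only [cup, e₁, e₂]
    generalize upLeg l a = u at *
    generalize downLeg l a = d at *
    generalize upLeg l' a' = u' at *
    generalize downLeg l' a' = d' at *
    obtain h | h | h | h | h | h | h : j < l ∨ j = u ∨ j = d ∨ (l + 1 < j ∧ j < l' + 2)  ∨ j = u' + 2 ∨ j = d' + 2 ∨ l' + 3 < j := by omega
    · rw [delAt_of_lt h, delAt_of_lt (show j < l' + 2 by omega), delAt_of_lt (show j < l' by omega),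
        delAt_of_lt h]
      split_ifs <;> first | rfl | omega
    · rw [delAt_of_lt (show j < l' + 2 by omega)]
      split_ifs <;> first | rfl | omega
    · rw [delAt_of_lt (show j < l' + 2 by omega)]
      split_ifs <;> first | rfl | omega
    · rw [delAt_of_lt (show j < l' + 2 by omega), delAt_of_le (show l + 2 ≤ j by omega),
        delAt_of_lt (show j - 2 < l' by omega)]
      split_ifs <;> first | rfl | omega
    · rw [delAt_of_le (show l + 2 ≤ j by omega)]
      split_ifs <;> first | rfl | omega
    · rw [delAt_of_le (show l + 2 ≤ j by omega)]
      split_ifs <;> first | rfl | omega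
    · rw [delAt_of_le (show l' + 2 + 2 ≤ j by omega), delAt_of_le (show l + 2 ≤ j by omega),
        delAt_of_le (show l' + 2 ≤ j - 2 by omega), delAt_of_le (show l + 2 ≤ j - 2 by omega)]
      split_ifs <;> first | rfl | omega

/-- The mate of `j` after the lines at `l` and `l + 1` have been joined. -/
def joinMate (l : ℕ) (f : ℕ → ℕ) (j : ℕ) : ℕ :=
  if f j = l then f (l + 1) else if f j = l + 1 then f l else f j

theorem joinMate_comm {l l' : ℕ} (h : l + 2 ≤ l') {f : ℕ → ℕ} (hf : ∀ j, f (f j) = j) {j : ℕ}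
    (h₁ : j ≠ l) (h₂ : j ≠ l + 1) (h₃ : j ≠ l') (h₄ : j ≠ l' + 1) :
    joinMate l (joinMate l' f) j = joinMate l' (joinMate l f) j := by
  unfold joinMate
  grind (splits := 20)

theorem cap_mate (l : ℕ) (a : Dir) (g : M) (σ : Link M) (j : ℕ) :
    (σ.cap l a g).mate j = delAt l (joinMate l σ.mate (insAt l j)) := rfl

theorem joinMate_ne {l : ℕ} {f : ℕ → ℕ} (hf : ∀ j, f (f j) = j) (h₁ : f l ≠ l)
    (h₂ : f (l + 1) ≠ l + 1) {j : ℕ} (hj : j ≠ l) (hj' : j ≠ l + 1) :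
    joinMate l f j ≠ l ∧ joinMate l f j ≠ l + 1 := by
  unfold joinMate; grind

theorem insAt_injective {l j j' : ℕ} : insAt l j = insAt l j' ↔ j = j' := by
  unfold insAt; split_ifs <;> omega

/-- Removing the lines at `l` and `l + 1` commutes with joining other lines. -/
theorem joinMate_reindex {l : ℕ} {f f' : ℕ → ℕ} (hf : ∀ j, insAt l (f' j) = f (insAt l j))
    {l' l'' : ℕ} (h : insAt l l' = l'') (h' : insAt l (l' + 1) = l'' + 1) (j : ℕ) :
    insAt l (joinMate l' f' j) = joinMate l'' f (insAt l j) := by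
  subst h
  unfold joinMate
  simp only [← hf, ← h', insAt_injective]
  split_ifs <;> simp [hf]

theorem insAt_cap_mate {l : ℕ} {a : Dir} {g : M} {σ : Link M} (hσ : ∀ j, σ.mate (σ.mate j) = j)
    (h₁ : σ.mate l ≠ l) (h₂ : σ.mate (l + 1) ≠ l + 1) (j : ℕ) :
    insAt l ((σ.cap l a g).mate j) = joinMate l σ.mate (insAt l j) := by
  obtain ⟨h, h'⟩ := joinMate_ne hσ h₁ h₂ (insAt_ne l j).1 (insAt_ne l j).2
  rw [cap_mate, insAt_delAt h h']

theorem cap_mate_mate {l : ℕ} {a : Dir} {g : M} {σ : Link M} (hσ : ∀ j, σ.mate (σ.mate j) = j)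
    (h₁ : σ.mate l ≠ l) (h₂ : σ.mate (l + 1) ≠ l + 1) (j : ℕ) :
    (σ.cap l a g).mate ((σ.cap l a g).mate j) = j := by
  obtain ⟨h, h'⟩ := insAt_ne l j
  rw [← insAt_injective (l := l), insAt_cap_mate hσ h₁ h₂, insAt_cap_mate hσ h₁ h₂]
  unfold joinMate
  grind

theorem cap_mate_ne {l : ℕ} {a : Dir} {g : M} {σ : Link M} (hσ : ∀ j, σ.mate (σ.mate j) = j)
    (h₁ : σ.mate l ≠ l) (h₂ : σ.mate (l + 1) ≠ l + 1) {j : ℕ}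
    (hj : σ.mate (insAt l j) ≠ insAt l j) : (σ.cap l a g).mate j ≠ j := by
  rw [← insAt_injective (l := l).ne, insAt_cap_mate hσ h₁ h₂]
  unfold joinMate
  grind

theorem joinMate_eq (l : ℕ) (a : Dir) (f : ℕ → ℕ) (j : ℕ) : joinMate l f j =
    if f j = upLeg l a then f (downLeg l a) else if f j = downLeg l a then f (upLeg l a) else f j := by
  cases a
  · rfl
  · by_cases h : f j = l
    · simp [joinMate, upLeg, downLeg, h]
    · simp [joinMate, upLeg, downLeg, h]

/-- Two maxima side by side join up to three arcs into one, and the label collects the pieces in the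
order of travel whichever maximum is added first. An arc between the two up legs, for which there is
no such order, is ruled out by `hu`. -/
theorem cap_cap_comm {l l' : ℕ} (hl : l ≤ l') (a a' : Dir) (g g' : M) (σ : Link M)
    (hσ : ∀ j, σ.mate (σ.mate j) = j) (h₁ : σ.mate l ≠ l) (h₂ : σ.mate (l + 1) ≠ l + 1)
    (h₃ : σ.mate (l' + 2) ≠ l' + 2) (h₄ : σ.mate (l' + 3) ≠ l' + 3)
    (hu : σ.mate (upLeg l a) ≠ upLeg (l' + 2) a') :
    (σ.cap l a g).cap l' a' g' = (σ.cap (l' + 2) a' g').cap l a g := by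
  have e₁ : insAt l l' = l' + 2 := insAt_of_le hl
  have e₂ : insAt l (l' + 1) = l' + 2 + 1 := insAt_of_le (by omega)
  have e₃ : insAt (l' + 2) l = l := insAt_of_lt (by omega)
  have e₄ : insAt (l' + 2) (l + 1) = l + 1 := insAt_of_lt (by omega)
  have eu : insAt l (upLeg l' a') = upLeg (l' + 2) a' := by cases a' <;> simp [upLeg, e₁, e₂]
  have eu' : insAt (l' + 2) (upLeg l a) = upLeg l a := by cases a <;> simp [upLeg, e₃, e₄]
  have ed : insAt l (downLeg l' a') = downLeg (l' + 2) a' := by cases a' <;> simp [downLeg, e₁, e₂]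
  have ed' : insAt (l' + 2) (downLeg l a) = downLeg l a := by cases a <;> simp [downLeg, e₃, e₄]
  ext j
  -- The mates are compared after all four removed positions have been put back: `insAt` is
  -- injective, and there a cap acts by `joinMate` without renumbering.
  · have key : insAt l (insAt l' (((σ.cap l a g).cap l' a' g').mate j)) =
        insAt l (insAt l' (((σ.cap (l' + 2) a' g').cap l a g).mate j)) := by
      rw [insAt_cap_mate (cap_mate_mate hσ h₁ h₂) (cap_mate_ne hσ h₁ h₂ (by rwa [e₁]))
          (cap_mate_ne hσ h₁ h₂ (by rwa [e₂])),
        joinMate_reindex (fun i => insAt_cap_mate hσ h₁ h₂ i) e₁ e₂, insAt_insAt hl, insAt_insAt hl,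
        insAt_cap_mate (cap_mate_mate hσ h₃ h₄) (cap_mate_ne hσ h₃ h₄ (by rwa [e₃]))
          (cap_mate_ne hσ h₃ h₄ (by rwa [e₄])),
        joinMate_reindex (fun i => insAt_cap_mate hσ h₃ h₄ i) e₃ e₄, joinMate_comm (l := l) (l' := l' + 2) (by omega) hσ]
      · exact fun h => (insAt_ne l j).1 (insAt_injective.1 (h.trans e₃.symm))
      · exact fun h => (insAt_ne l j).2 (insAt_injective.1 (h.trans e₄.symm))
      · exact (insAt_ne _ _).1
      · exact (insAt_ne _ _).2
    simpa only [insAt_injective] using key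
  · have c₁ : (σ.cap l a g).mate (insAt l' j) = upLeg l' a' ↔
        joinMate l σ.mate (insAt l (insAt l' j)) = upLeg (l' + 2) a' := by
      rw [← insAt_injective (l := l), insAt_cap_mate hσ h₁ h₂, eu]
    have c₂ : (σ.cap (l' + 2) a' g').mate (insAt l j) = upLeg l a ↔
        joinMate (l' + 2) σ.mate (insAt l (insAt l' j)) = upLeg l a := by
      rw [← insAt_injective (l := l' + 2), insAt_cap_mate hσ h₃ h₄, eu', insAt_insAt hl]
    have n₁ := insAt_ne l (insAt l' j)
    have n₂ := insAt_ne (l' + 2) (insAt l j)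
    rw [← insAt_insAt hl] at n₂
    rw [joinMate_eq l a] at c₁
    rw [joinMate_eq (l' + 2) a'] at c₂
    have hi : ∀ x, σ.mate x = σ.mate (insAt l (insAt l' j)) → x = insAt l (insAt l' j) := by
      intro x hx
      rw [← hσ x, hx, hσ]
    have hu₂ : σ.mate (upLeg (l' + 2) a') ≠ upLeg l a := fun h => hu (by rw [← h, hσ])
    have m₁ : insAt l (insAt l' j) ≠ downLeg l a := by cases a <;> simp only [downLeg] <;> tauto
    have m₂ : insAt l (insAt l' j) ≠ downLeg (l' + 2) a' := by
      cases a' <;> simp only [downLeg] <;> tauto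
    have m₃ : insAt l (insAt l' j) ≠ upLeg l a := by cases a <;> simp only [upLeg] <;> tauto
    have m₄ : insAt l (insAt l' j) ≠ upLeg (l' + 2) a' := by
      cases a' <;> simp only [upLeg] <;> tauto
    have k₁ := upLeg_mem l a
    have k₂ := upLeg_mem (l' + 2) a'
    have k₃ := downLeg_mem l a
    have k₄ := downLeg_mem (l' + 2) a'
    rw [show ((σ.cap l a g).cap l' a' g').label j = if (σ.cap l a g).mate (insAt l' j) = upLeg l' a'
      then (σ.cap l a g).label (insAt l' j) * ((σ.cap l a g).label (upLeg l' a') * g' *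
        (σ.cap l a g).label (downLeg l' a')) else (σ.cap l a g).label (insAt l' j) from rfl,
      show ((σ.cap (l' + 2) a' g').cap l a g).label j =
        if (σ.cap (l' + 2) a' g').mate (insAt l j) = upLeg l a
        then (σ.cap (l' + 2) a' g').label (insAt l j) * ((σ.cap (l' + 2) a' g').label (upLeg l a) *
          g * (σ.cap (l' + 2) a' g').label (downLeg l a)) else
          (σ.cap (l' + 2) a' g').label (insAt l j) from rfl]
    simp only [c₁, c₂]
    simp only [cap, eu, eu', ed, ed', ← insAt_insAt hl]
    clear c₁ c₂
    generalize insAt l (insAt l' j) = i at *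
    generalize upLeg l a = u at *
    generalize downLeg l a = d at *
    generalize upLeg (l' + 2) a' = u' at *
    generalize downLeg (l' + 2) a' = d' at *
    have hd : σ.mate i = u → σ.mate d' ≠ u := fun h h' => m₂ (hi _ (h'.trans h.symm)).symm
    have hd' : σ.mate i = u' → σ.mate d ≠ u' := fun h h' => m₁ (hi _ (h'.trans h.symm)).symm
    -- The arc from `i` runs into the one maximum, into the other, or into neither; in the first two
    -- cases it may go on through the remaining maximum.
    by_cases p : σ.mate i = u
    · have := hd p
      have : u ≠ u' := by omega
      have : u ≠ d' := by omega
      by_cases q : σ.mate d = u' <;> simp [*, mul_assoc]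
    · by_cases q : σ.mate i = u'
      · have := hd' q
        have : u' ≠ u := by omega
        have : u' ≠ d := by omega
        by_cases q : σ.mate d' = u <;> simp [*, mul_assoc]
      · have r₁ : ¬ (if σ.mate i = d then σ.mate u else σ.mate i) = u' := by split_ifs <;> assumption
        have r₂ : ¬ (if σ.mate i = d' then σ.mate u' else σ.mate i) = u := by split_ifs <;> assumption
        simp [*]

theorem cup_mate_insAt (l : ℕ) (a : Dir) (g : M) (σ : Link M) (j : ℕ) :
    (σ.cup l a g).mate (insAt l j) = insAt l (σ.mate j) := by
  simp [cup, (insAt_ne l j).1, (insAt_ne l j).2, delAt_insAt]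

theorem cup_label_insAt (l : ℕ) (a : Dir) (g : M) (σ : Link M) (j : ℕ) :
    (σ.cup l a g).label (insAt l j) = σ.label j := by
  obtain ⟨h, h'⟩ := insAt_ne l j
  cases a <;> simp [cup, upLeg, downLeg, h, h', delAt_insAt]

/-- A position is either one of the two new ones or comes from an old position. -/
theorem eq_or_insAt (l j : ℕ) : j = l ∨ j = l + 1 ∨ ∃ i, j = insAt l i := by
  by_cases h : j = l
  · exact .inl h
  by_cases h' : j = l + 1
  · exact .inr (.inl h')
  · exact .inr (.inr ⟨_, (insAt_delAt h h').symm⟩)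

theorem cap_cup_comm {l l' : ℕ} (hl : l ≤ l') (a a' : Dir) (g g' : M) (σ : Link M)
    (hσ : ∀ j, σ.mate (σ.mate j) = j) (h₁ : σ.mate l ≠ l) (h₂ : σ.mate (l + 1) ≠ l + 1) :
    (σ.cap l a g).cup l' a' g' = (σ.cup (l' + 2) a' g').cap l a g := by
  have e₁ : insAt l l' = l' + 2 := insAt_of_le hl
  have e₂ : insAt l (l' + 1) = l' + 2 + 1 := insAt_of_le (by omega)
  have e₃ : insAt (l' + 2) l = l := insAt_of_lt (by omega)
  have e₄ : insAt (l' + 2) (l + 1) = l + 1 := insAt_of_lt (by omega)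
  have eu' : insAt (l' + 2) (upLeg l a) = upLeg l a := by cases a <;> simp [upLeg, e₃, e₄]
  have ed' : insAt (l' + 2) (downLeg l a) = downLeg l a := by cases a <;> simp [downLeg, e₃, e₄]
  have m₁ : (σ.cup (l' + 2) a' g').mate l = insAt (l' + 2) (σ.mate l) := by
    rw [← e₃, cup_mate_insAt, e₃]
  have m₂ : (σ.cup (l' + 2) a' g').mate (l + 1) = insAt (l' + 2) (σ.mate (l + 1)) := by
    rw [← e₄, cup_mate_insAt, e₄]
  have mu : (σ.cup (l' + 2) a' g').label (upLeg l a) = σ.label (upLeg l a) := by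
    rw [← eu', cup_label_insAt, eu']
  have md : (σ.cup (l' + 2) a' g').label (downLeg l a) = σ.label (downLeg l a) := by
    rw [← ed', cup_label_insAt, ed']
  have n₁ : (σ.cup (l' + 2) a' g').mate (l' + 2) = l' + 3 := by simp [cup]
  have n₂ : (σ.cup (l' + 2) a' g').mate (l' + 2 + 1) = l' + 2 := by simp [cup]
  ext j
  · obtain rfl | rfl | ⟨i, rfl⟩ := eq_or_insAt l' j
    · rw [cap_mate, e₁, joinMate, n₁, if_neg (by omega), if_neg (by omega), delAt_of_le (by omega)]
      simp [cup]
    · rw [cap_mate, e₂, joinMate, n₂, if_neg (by omega), if_neg (by omega), delAt_of_le (by omega)]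
      simp [cup]
    · rw [cup_mate_insAt, cap_mate, cap_mate, insAt_insAt hl]
      obtain ⟨h, h'⟩ := joinMate_ne hσ h₁ h₂ (insAt_ne l i).1 (insAt_ne l i).2
      rw [← joinMate_reindex (fun j => (cup_mate_insAt _ _ _ _ j).symm) e₃ e₄,
        ← insAt_injective (l := l), insAt_insAt hl, insAt_delAt h h', insAt_delAt]
      · exact fun q => h (insAt_injective.1 (q.trans e₃.symm))
      · exact fun q => h' (insAt_injective.1 (q.trans e₄.symm))
  · have k₁ := upLeg_mem l a
    obtain rfl | rfl | ⟨i, rfl⟩ := eq_or_insAt l' j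
    · simp only [cap, e₁, n₁]
      rw [if_neg (by omega)]
      cases a' <;> simp [cup, upLeg, downLeg]
    · simp only [cap, e₂, n₂]
      rw [if_neg (by omega)]
      cases a' <;> simp [cup, upLeg, downLeg]
    · rw [cup_label_insAt]
      simp only [cap]
      rw [insAt_insAt hl, cup_mate_insAt, cup_label_insAt, mu, md]
      have : insAt (l' + 2) (σ.mate (insAt l i)) = upLeg l a ↔ σ.mate (insAt l i) = upLeg l a := by
        conv_lhs => rw [← eu']
        exact insAt_injective
      simp only [this]

end Link

theorem Dir.flip_ne (d : Dir) : d.flip ≠ d := by cases d <;> simp [Dir.flip]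

theorem Dir.flip_flip (d : Dir) : d.flip.flip = d := by cases d <;> rfl

/-! ### Directions of the lines at the old and new positions; validity of links. -/

section Positions

variable {L R : List Dir} (a b : Dir)

theorem getElem?_left : (L ++ [a, b] ++ R)[L.length]? = some a := by
  simp

theorem getElem?_right : (L ++ [a, b] ++ R)[L.length + 1]? = some b := by
  simp

theorem getElem?_swapAt (j : ℕ) :
    (L ++ [a, b] ++ R)[swapAt L.length j]? = (L ++ [b, a] ++ R)[j]? := by
  unfold swapAt
  split_ifs with h h'
  · subst h; rw [getElem?_right, getElem?_left]
  · subst h'; rw [getElem?_right, getElem?_left]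
  · obtain h₁ | h₁ : j < L.length ∨ L.length + 2 ≤ j := by omega
    · simp [List.getElem?_append, h₁]
    · obtain ⟨i, rfl⟩ := Nat.exists_eq_add_of_le h₁
      simp [List.getElem?_append, Nat.add_assoc, Nat.add_comm 2 i]

theorem getElem?_insAt (j : ℕ) :
    (L ++ [a, b] ++ R)[insAt L.length j]? = (L ++ [] ++ R)[j]? := by
  unfold insAt
  split_ifs with h
  · simp [List.getElem?_append, h]
  · obtain ⟨i, rfl⟩ := Nat.exists_eq_add_of_le (Nat.le_of_not_lt h)
    simp [List.getElem?_append, Nat.add_assoc]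

theorem getElem?_upLeg : (L ++ [a, a.flip] ++ R)[upLeg L.length a]? = some .up := by
  cases a
  · exact getElem?_left _ _
  · exact getElem?_right _ _

theorem getElem?_downLeg : (L ++ [a, a.flip] ++ R)[downLeg L.length a]? = some .down := by
  cases a
  · exact getElem?_right _ _
  · exact getElem?_left _ _

end Positions

namespace Link

variable {M : Type*}

/-- Taken with `i = j`, this excludes fixed points of `mate` among the lines of the level; outside
the level fixed points do occur. -/
theorem Valid.mate_ne {σ : Link M} {lv : List Dir} (hv : σ.Valid lv) {i j : ℕ} {d : Dir}
    (hi : lv[i]? = some d) (hj : lv[j]? = some d) : σ.mate i ≠ j := by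
  intro h
  have := hv.mate_dir _ _ hi
  rw [h, hj] at this
  exact d.flip_ne (Option.some.inj this).symm

variable [Monoid M]

theorem cup_cap_comm {l l' : ℕ} (hl : l ≤ l') (a a' : Dir) (g g' : M) (σ : Link M)
    (hσ : ∀ j, σ.mate (σ.mate j) = j) (h₁ : σ.mate l' ≠ l') (h₂ : σ.mate (l' + 1) ≠ l' + 1) :
    (σ.cup l a g).cap (l' + 2) a' g' = (σ.cap l' a' g').cup l a g := by
  have e₁ : insAt l l' = l' + 2 := insAt_of_le hl
  have e₂ : insAt l (l' + 1) = l' + 2 + 1 := insAt_of_le (by omega)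
  have e₃ : insAt (l' + 2) l = l := insAt_of_lt (by omega)
  have e₄ : insAt (l' + 2) (l + 1) = l + 1 := insAt_of_lt (by omega)
  have eu : insAt l (upLeg l' a') = upLeg (l' + 2) a' := by cases a' <;> simp [upLeg, e₁, e₂]
  have ed : insAt l (downLeg l' a') = downLeg (l' + 2) a' := by cases a' <;> simp [downLeg, e₁, e₂]
  have n₁ : (σ.cup l a g).mate l = l + 1 := by simp [cup]
  have n₂ : (σ.cup l a g).mate (l + 1) = l := by simp [cup]
  ext j
  · obtain rfl | rfl | ⟨i, rfl⟩ := eq_or_insAt l j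
    · rw [cap_mate, e₃, joinMate, n₁, if_neg (by omega), if_neg (by omega), delAt_of_lt (by omega)]
      simp [cup]
    · rw [cap_mate, e₄, joinMate, n₂, if_neg (by omega), if_neg (by omega), delAt_of_lt (by omega)]
      simp [cup]
    · rw [cup_mate_insAt, cap_mate, cap_mate, ← insAt_insAt hl,
        ← joinMate_reindex (fun j => (cup_mate_insAt _ _ _ _ j).symm) e₁ e₂]
      obtain ⟨h, h'⟩ := joinMate_ne hσ h₁ h₂ (insAt_ne l' i).1 (insAt_ne l' i).2
      rw [← insAt_injective (l := l' + 2), ← insAt_insAt hl, insAt_delAt h h', insAt_delAt]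
      · exact fun q => h (insAt_injective.1 (q.trans e₁.symm))
      · exact fun q => h' (insAt_injective.1 (q.trans e₂.symm))
  · have k := upLeg_mem (l' + 2) a'
    have k' := downLeg_mem (l' + 2) a'
    obtain rfl | rfl | ⟨i, rfl⟩ := eq_or_insAt l j
    · simp only [cap, e₃, n₁]
      rw [if_neg (by omega)]
      cases a <;> simp [cup, upLeg, downLeg]
    · simp only [cap, e₄, n₂]
      rw [if_neg (by omega)]
      cases a <;> simp [cup, upLeg, downLeg]
    · rw [cup_label_insAt]
      simp only [cap]
      rw [← insAt_insAt hl, cup_mate_insAt, cup_label_insAt, ← eu, ← ed, cup_label_insAt,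
        cup_label_insAt]
      simp only [insAt_injective]

/-- At a maximum the legs have opposite directions, so the mates of the legs, each opposite to its
leg, are opposite to each other and may be joined. -/
theorem Valid.act {σ : Link M} (g : Extremum → M) (p : Piece) (x : M × M) {L R : List Dir}
    (hv : σ.Valid (L ++ p.dom ++ R)) : (σ.act g p L.length x).Valid (L ++ p.cod ++ R) := by
  rcases p with ⟨o, a, b⟩ | a | a
  · refine ⟨fun j => ?_, fun j d h => ?_⟩
    · simp [Link.act, cross, swapAt_swapAt, hv.mate_mate]
    · simp only [Piece.cod] at h ⊢
      rw [← getElem?_swapAt] at h ⊢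
      simp only [Link.act, cross, swapAt_swapAt]
      exact hv.mate_dir _ _ h
  · have h₁ := hv.mate_ne (getElem?_left _ _) (getElem?_left _ _)
    have h₂ := hv.mate_ne (getElem?_right _ _) (getElem?_right _ _)
    refine ⟨fun j => cap_mate_mate hv.mate_mate h₁ h₂ j, fun j d h => ?_⟩
    simp only [Piece.cod] at h ⊢
    rw [← getElem?_insAt a a.flip] at h ⊢
    simp only [Link.act]
    rw [insAt_cap_mate hv.mate_mate h₁ h₂]
    have hd := hv.mate_dir _ _ h
    have hm := hv.mate_mate (insAt L.length j)
    have l₁ := getElem?_left (L := L) (R := R) a a.flip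
    have l₂ := getElem?_right (L := L) (R := R) a a.flip
    have m₁ := hv.mate_dir _ _ l₁
    have m₂ := hv.mate_dir _ _ l₂
    simp only [Piece.dom] at *
    unfold joinMate
    split_ifs with c c'
    · rw [c, l₁] at hd
      rw [m₂, Option.some.inj hd, Dir.flip_flip]
    · rw [c', l₂] at hd
      rw [m₁, Option.some.inj hd]
    · exact hd
  · refine ⟨fun j => ?_, fun j d h => ?_⟩
    · obtain rfl | rfl | ⟨i, rfl⟩ := eq_or_insAt L.length j
      · simp [Link.act, cup]
      · simp [Link.act, cup]
      · simp only [Link.act, cup_mate_insAt, hv.mate_mate]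
    · simp only [Piece.cod] at h ⊢
      obtain rfl | rfl | ⟨i, rfl⟩ := eq_or_insAt L.length j
      · rw [getElem?_left] at h
        simp only [Link.act, cup, if_true]
        rw [getElem?_right, Option.some.inj h]
      · rw [getElem?_right] at h
        have e : (σ.act g (.cup a) L.length x).mate (L.length + 1) = L.length := by
          simp [Link.act, cup]
        rw [e, getElem?_left, ← Option.some.inj h, Dir.flip_flip]
      · simp only [Link.act, cup_mate_insAt]
        rw [getElem?_insAt] at h ⊢
        exact hv.mate_dir _ _ h

/-- Validity supplies the conditions on directions and fixed points in the nine cases. The position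
of `q` depends on whether it sees the upper or the lower side of `p`. -/
theorem act_comm {σ : Link M} (g : Extremum → M) (p q : Piece) (x y : M × M) {L m R : List Dir}
    (hv : σ.Valid (L ++ p.dom ++ (m ++ q.dom ++ R))) :
    (σ.act g p L.length x).act g q (L.length + p.cod.length + m.length) y =
      (σ.act g q (L.length + p.dom.length + m.length) y).act g p L.length x := by
  have e : L ++ p.dom ++ (m ++ q.dom ++ R) = (L ++ p.dom ++ m) ++ q.dom ++ R := by simp
  have hv' := e ▸ hv
  have el : (L ++ p.dom ++ m).length = L.length + p.dom.length + m.length := by simp; omega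
  generalize hl : (L ++ p.dom ++ m) = L' at *
  rw [← el]
  rcases p with ⟨o, a, b⟩ | a | a <;> rcases q with ⟨o', a', b'⟩ | a' | a' <;>
    simp only [Piece.dom, Piece.cod, List.length_cons, List.length_nil, Nat.reduceAdd,
      Nat.add_zero] at *
  · rw [← el]
    exact cross_cross_comm (by omega) _ _ _ _ _ _ _ _ _
  · rw [← el]
    refine cross_cap_comm (by omega) _ _ _ _ _ _ _ ?_ ?_
    · rintro rfl
      exact hv.mate_ne (getElem?_left _ _) (e ▸ getElem?_upLeg _)
    · rintro rfl
      exact hv.mate_ne (getElem?_right _ _) (e ▸ getElem?_upLeg _)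
  · rw [← el]
    exact cross_cup_comm (by omega) _ _ _ _ _ _ _
  · rw [el, Nat.add_right_comm]
    refine cap_cross_comm (by omega) _ _ _ _ _ _ _ ?_ ?_ hv.mate_mate
      (hv.mate_ne (getElem?_left _ _) (getElem?_left _ _))
      (hv.mate_ne (getElem?_right _ _) (getElem?_right _ _))
    · rintro rfl
      rw [show L.length + m.length + 2 = L'.length by omega]
      exact hv.mate_ne (e ▸ getElem?_left _ _) (getElem?_upLeg _)
    · rintro rfl
      rw [show L.length + m.length + 3 = L'.length + 1 by omega]
      exact hv.mate_ne (e ▸ getElem?_right _ _) (getElem?_upLeg _)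
  · rw [el, Nat.add_right_comm]
    refine cap_cap_comm (by omega) _ _ _ _ _ hv.mate_mate
      (hv.mate_ne (getElem?_left _ _) (getElem?_left _ _))
      (hv.mate_ne (getElem?_right _ _) (getElem?_right _ _)) ?_ ?_ ?_
    · rw [show L.length + m.length + 2 = L'.length by omega]
      exact hv'.mate_ne (getElem?_left _ _) (getElem?_left _ _)
    · rw [show L.length + m.length + 3 = L'.length + 1 by omega]
      exact hv'.mate_ne (getElem?_right _ _) (getElem?_right _ _)
    · rw [show L.length + m.length + 2 = L'.length by omega]
      exact hv.mate_ne (getElem?_upLeg _) (e ▸ getElem?_upLeg _)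
  · rw [el, Nat.add_right_comm]
    exact cap_cup_comm (by omega) _ _ _ _ _ hv.mate_mate
      (hv.mate_ne (getElem?_left _ _) (getElem?_left _ _))
      (hv.mate_ne (getElem?_right _ _) (getElem?_right _ _))
  · rw [el, Nat.add_right_comm]
    exact cup_cross_comm (by omega) _ _ _ _ _ _ _
  · rw [el, Nat.add_right_comm]
    rw [← el]
    exact cup_cap_comm (by omega) _ _ _ _ _ hv.mate_mate
      (hv'.mate_ne (getElem?_left _ _) (getElem?_left _ _))
      (hv'.mate_ne (getElem?_right _ _) (getElem?_right _ _))
  · rw [el, Nat.add_right_comm]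
    exact cup_cup_comm (by omega) _ _ _ _ _

end Link

/-! ### Traces of the loops closed by maxima. -/

section Factor

variable {k A : Type*} [Field k] [Ring A] [Algebra k A]

open Link

open Classical in
/-- The trace of the loop which is closed by adding the component `p` at position `l`; `1` if no
loop is closed. -/
noncomputable def closing (tr : A →ₗ[k] k) (g : Extremum → A) (p : Piece) (l : ℕ) (σ : Link A) : k :=
  match p with
  | .cross _ _ _ => 1
  | .cap a => if σ.mate (downLeg l a) = upLeg l a then
      tr (σ.label (downLeg l a) * σ.label (upLeg l a) * g (capType a)) else 1
  | .cup _ => 1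

theorem closing_congr {tr : A →ₗ[k] k} {g : Extremum → A} {p : Piece} {l l' : ℕ} {σ σ' : Link A}
    (hm : ∀ a, p = .cap a → (σ.mate (downLeg l a) = upLeg l a ↔ σ'.mate (downLeg l' a) = upLeg l' a))
    (hd : ∀ a, p = .cap a → σ.label (downLeg l a) = σ'.label (downLeg l' a))
    (hu : ∀ a, p = .cap a → σ.label (upLeg l a) = σ'.label (upLeg l' a)) :
    closing tr g p l σ = closing tr g p l' σ' := by
  rcases p with ⟨o, a, b⟩ | a | a
  · rfl
  · simp only [closing, hm a rfl, hd a rfl, hu a rfl]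
  · rfl

/-- Two maxima may complete one loop together. The one added last takes the trace, and the two
resulting words are cyclic permutations of each other, so the trace property is needed. -/
theorem closing_cap_cap {tr : A →ₗ[k] k} (htr : Tracelike tr) (g : Extremum → A) {l l' : ℕ}
    (hl : l ≤ l') (a a' : Dir) (x y : A × A) (σ : Link A)
    (hσ : ∀ j, σ.mate (σ.mate j) = j) (h₁ : σ.mate l ≠ l) (h₂ : σ.mate (l + 1) ≠ l + 1)
    (h₃ : σ.mate (l' + 2) ≠ l' + 2) (h₄ : σ.mate (l' + 3) ≠ l' + 3)
    (hu : σ.mate (upLeg l a) ≠ upLeg (l' + 2) a') :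
    closing tr g (.cap a) l σ * closing tr g (.cap a') l' (σ.act g (.cap a) l x) =
      closing tr g (.cap a') (l' + 2) σ *
        closing tr g (.cap a) l (σ.act g (.cap a') (l' + 2) y) := by
  have e₁ : insAt l l' = l' + 2 := insAt_of_le hl
  have e₂ : insAt l (l' + 1) = l' + 2 + 1 := insAt_of_le (by omega)
  have e₃ : insAt (l' + 2) l = l := insAt_of_lt (by omega)
  have e₄ : insAt (l' + 2) (l + 1) = l + 1 := insAt_of_lt (by omega)
  have eu : insAt l (upLeg l' a') = upLeg (l' + 2) a' := by cases a' <;> simp [upLeg, e₁, e₂]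
  have eu' : insAt (l' + 2) (upLeg l a) = upLeg l a := by cases a <;> simp [upLeg, e₃, e₄]
  have ed : insAt l (downLeg l' a') = downLeg (l' + 2) a' := by cases a' <;> simp [downLeg, e₁, e₂]
  have ed' : insAt (l' + 2) (downLeg l a) = downLeg l a := by cases a <;> simp [downLeg, e₃, e₄]
  have c₁ : (σ.cap l a (g (capType a))).mate (downLeg l' a') = upLeg l' a' ↔
      joinMate l σ.mate (downLeg (l' + 2) a') = upLeg (l' + 2) a' := by
    rw [← insAt_injective (l := l), insAt_cap_mate hσ h₁ h₂, eu, ed]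
  have c₂ : (σ.cap (l' + 2) a' (g (capType a'))).mate (downLeg l a) = upLeg l a ↔
      joinMate (l' + 2) σ.mate (downLeg l a) = upLeg l a := by
    rw [← insAt_injective (l := l' + 2), insAt_cap_mate hσ h₃ h₄, eu', ed']
  rw [joinMate_eq l a] at c₁
  rw [joinMate_eq (l' + 2) a'] at c₂
  have hu₂ : σ.mate (upLeg (l' + 2) a') ≠ upLeg l a := fun h => hu (by rw [← h, hσ])
  have k₁ := upLeg_mem l a
  have k₂ := upLeg_mem (l' + 2) a'
  have k₃ := downLeg_mem l a
  have k₄ := downLeg_mem (l' + 2) a'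
  simp only [closing, act, c₁, c₂]
  simp only [cap, eu, eu', ed, ed']
  clear c₁ c₂
  have hinj : ∀ x y, σ.mate x = σ.mate y → x = y := fun x y h => by rw [← hσ x, h, hσ]
  generalize upLeg l a = u at *
  generalize downLeg l a = d at *
  generalize upLeg (l' + 2) a' = u' at *
  generalize downLeg (l' + 2) a' = d' at *
  have n₁ : d ≠ d' := by omega
  have n₂ : u ≠ u' := by omega
  have n₃ : u ≠ d' := by omega
  have n₄ : u' ≠ d := by omega
  have n₁' := n₁.symm
  have n₂' := n₂.symm
  have n₃' := n₃.symm
  have n₄' := n₄.symm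
  by_cases p : σ.mate d = u
  · have p' : σ.mate d' ≠ u := fun h => n₁ (hinj _ _ (p.trans h.symm))
    have p₂ : σ.mate u = d := by rw [← p, hσ]
    by_cases q : σ.mate d' = u'
    · have q₂ : σ.mate u' = d' := by rw [← q, hσ]
      simp [*, mul_comm]
    · by_cases r : σ.mate d' = d
      · have : d' = u := hinj _ _ (r.trans p₂.symm)
        omega
      · simp [*]
  · by_cases q : σ.mate d' = u'
    · have q' : σ.mate d ≠ u' := fun h => n₁ (hinj _ _ (h.trans q.symm))
      have q₂ : σ.mate u' = d' := by rw [← q, hσ]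
      by_cases r : σ.mate d = d'
      · have : d = u' := hinj _ _ (r.trans q₂.symm)
        omega
      · simp [*]
    -- Both maxima lie on one loop, consisting of two arcs which lead from each maximum to the
    -- other.
    · by_cases r : σ.mate d' = u ∧ σ.mate d = u'
      · obtain ⟨r, r'⟩ := r
        simp only [r, r', hu, hu₂, n₂, n₂', if_true, if_false, one_mul]
        rw [show σ.label d' * (σ.label u * g (capType a) * σ.label d) * σ.label u' * g (capType a')
          = (σ.label d' * σ.label u * g (capType a)) *
            (σ.label d * (σ.label u' * g (capType a'))) by simp only [mul_assoc], htr]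
        simp only [mul_assoc]
      · rw [if_neg p, if_neg q, if_neg, if_neg]
        · split_ifs <;> tauto
        · split_ifs <;> tauto

/-- Only two maxima interact. Otherwise at most one of the pieces has a nontrivial factor, and the
other piece changes, up to renumbering, neither the mates nor the labels at its legs. -/
theorem closing_comm {tr : A →ₗ[k] k} (htr : Tracelike tr) {σ : Link A} (g : Extremum → A)
    (p q : Piece) (x y : A × A) {L m R : List Dir}
    (hv : σ.Valid (L ++ p.dom ++ (m ++ q.dom ++ R))) :
    closing tr g p L.length σ *
        closing tr g q (L.length + p.cod.length + m.length) (σ.act g p L.length x) =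
      closing tr g q (L.length + p.dom.length + m.length) σ *
        closing tr g p L.length (σ.act g q (L.length + p.dom.length + m.length) y) := by
  have e : L ++ p.dom ++ (m ++ q.dom ++ R) = (L ++ p.dom ++ m) ++ q.dom ++ R := by simp
  have hv' := e ▸ hv
  have el : (L ++ p.dom ++ m).length = L.length + p.dom.length + m.length := by simp; omega
  generalize hl : (L ++ p.dom ++ m) = L' at *
  rw [← el]
  rcases p with ⟨o, a, b⟩ | a | a <;> rcases q with ⟨o', a', b'⟩ | a' | a' <;>
    simp only [Piece.dom, Piece.cod, List.length_cons, List.length_nil, Nat.reduceAdd,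
      Nat.add_zero] at *
  · simp [closing]
  · rw [← el]
    refine (one_mul _).trans (Eq.trans ?_ (mul_one _).symm)
    obtain ⟨h₁, h₂⟩ := upLeg_mem L'.length a'
    obtain ⟨h₃, h₄⟩ := downLeg_mem L'.length a'
    refine closing_congr ?_ ?_ ?_ <;> rintro _ ⟨⟩
    · simp only [act, cross, swapAt_eq_iff]
      rw [swapAt_of_gt (by omega), swapAt_of_gt (by omega)]
    · simp only [act, cross]
      rw [if_neg (by omega), if_neg (by omega)]
    · simp only [act, cross]
      rw [if_neg (by omega), if_neg (by omega)]
  · simp [closing]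
  · refine (mul_one _).trans (Eq.trans ?_ (one_mul _).symm)
    obtain ⟨h₁, h₂⟩ := upLeg_mem L.length a
    obtain ⟨h₃, h₄⟩ := downLeg_mem L.length a
    refine closing_congr ?_ ?_ ?_ <;> rintro _ ⟨⟩
    · simp only [act, cross, swapAt_eq_iff]
      rw [swapAt_of_lt (by omega), swapAt_of_lt (by omega)]
    · simp only [act, cross]
      rw [if_neg (by omega), if_neg (by omega)]
    · simp only [act, cross]
      rw [if_neg (by omega), if_neg (by omega)]
  · rw [el, Nat.add_right_comm]
    refine closing_cap_cap htr _ (by omega) _ _ _ _ _ hv.mate_mate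
      (hv.mate_ne (getElem?_left _ _) (getElem?_left _ _))
      (hv.mate_ne (getElem?_right _ _) (getElem?_right _ _)) ?_ ?_ ?_
    · rw [show L.length + m.length + 2 = L'.length by omega]
      exact hv'.mate_ne (getElem?_left _ _) (getElem?_left _ _)
    · rw [show L.length + m.length + 3 = L'.length + 1 by omega]
      exact hv'.mate_ne (getElem?_right _ _) (getElem?_right _ _)
    · rw [show L.length + m.length + 2 = L'.length by omega]
      exact hv.mate_ne (getElem?_upLeg _) (e ▸ getElem?_upLeg _)
  · refine (mul_one _).trans (Eq.trans ?_ (one_mul _).symm)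
    obtain ⟨h₁, h₂⟩ := upLeg_mem L.length a
    obtain ⟨h₃, h₄⟩ := downLeg_mem L.length a
    have eu := insAt_of_lt (l := L'.length) (j := upLeg L.length a) (by omega)
    have ed := insAt_of_lt (l := L'.length) (j := downLeg L.length a) (by omega)
    refine closing_congr ?_ ?_ ?_ <;> rintro _ ⟨⟩ <;> simp only [act]
    · conv_rhs => rw [← eu, ← ed, cup_mate_insAt, insAt_injective]
    · conv_rhs => rw [← ed, cup_label_insAt]
    · conv_rhs => rw [← eu, cup_label_insAt]
  · simp [closing]
  · refine (one_mul _).trans (Eq.trans ?_ (mul_one _).symm)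
    have eu : insAt L.length (upLeg L'.length a') = upLeg (L.length + 2 + m.length) a' := by
      cases a' <;> simp only [upLeg] <;> rw [insAt_of_le (by omega)] <;> omega
    have ed : insAt L.length (downLeg L'.length a') = downLeg (L.length + 2 + m.length) a' := by
      cases a' <;> simp only [downLeg] <;> rw [insAt_of_le (by omega)] <;> omega
    refine closing_congr ?_ ?_ ?_ <;> rintro _ ⟨⟩ <;> simp only [act]
    · rw [← eu, ← ed, cup_mate_insAt, insAt_injective]
    · rw [← ed, cup_label_insAt]
    · rw [← eu, cup_label_insAt]
  · simp [closing]

end Factor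

namespace Link

variable {M : Type*} [Monoid M]

/-- The label of the arc entering at position `j`. -/
def word (σ : Link M) (j : ℕ) : M := σ.label j * σ.label (σ.mate j)

/-! ### The words of the arcs, which are all that matters in a link. -/

section Words

variable {σ : Link M} {L R : List Dir} {a b : Dir}

theorem cross_mate_swapAt (l : ℕ) (x y : M) (j : ℕ) :
    (σ.cross l a b x y).mate (swapAt l j) = swapAt l (σ.mate j) := by
  simp [cross, swapAt_swapAt]

theorem cross_label_swapAt (l : ℕ) (x y : M) (j : ℕ) :
    (σ.cross l a b x y).label (swapAt l j) = if j = l then mulAlong a (σ.label j) x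
      else if j = l + 1 then mulAlong b (σ.label j) y else σ.label j := by
  by_cases h : j = l
  · simp [cross, swapAt, h]
  · by_cases h' : j = l + 1
    · simp [cross, swapAt, h']
    · simp [cross, swapAt, h, h']

/-- The label met on the line entering a crossing at position `j` from below. -/
def crossLabel (l : ℕ) (x y : M) (j : ℕ) : M := if j = l then x else if j = l + 1 then y else 1

theorem cross_label_down {x y : M} {j : ℕ} (h : (L ++ [a, b] ++ R)[j]? = some .down) :
    (σ.cross L.length a b x y).label (swapAt L.length j) =
      crossLabel L.length x y j * σ.label j := by
  rw [cross_label_swapAt, crossLabel]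
  split_ifs with h₁ h₂
  · rw [h₁, getElem?_left] at h
    rw [Option.some.inj h, mulAlong]
  · rw [h₂, getElem?_right] at h
    rw [Option.some.inj h, mulAlong]
  · rw [one_mul]

theorem cross_label_up {x y : M} {j : ℕ} (h : (L ++ [a, b] ++ R)[j]? = some .up) :
    (σ.cross L.length a b x y).label (swapAt L.length j) =
      σ.label j * crossLabel L.length x y j := by
  rw [cross_label_swapAt, crossLabel]
  split_ifs with h₁ h₂
  · rw [h₁, getElem?_left] at h
    rw [Option.some.inj h, mulAlong]
  · rw [h₂, getElem?_right] at h
    rw [Option.some.inj h, mulAlong]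
  · rw [mul_one]

/-- An arc passes through the new slice once on its way down, before everything else, and once on
its way up, after everything else. -/
theorem cross_word (hv : σ.Valid (L ++ [a, b] ++ R)) {x y : M} {j : ℕ}
    (h : (L ++ [a, b] ++ R)[j]? = some .down) :
    (σ.cross L.length a b x y).word (swapAt L.length j) =
      crossLabel L.length x y j * σ.word j * crossLabel L.length x y (σ.mate j) := by
  rw [word, cross_mate_swapAt, cross_label_down h, cross_label_up (hv.mate_dir _ _ h), word]
  simp only [mul_assoc]

theorem cup_word_downLeg (l : ℕ) (g : M) : (σ.cup l a g).word (downLeg l a) = g := by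
  cases a <;> simp [word, cup, downLeg, upLeg]

theorem cup_word_insAt (l : ℕ) (g : M) (j : ℕ) : (σ.cup l a g).word (insAt l j) = σ.word j := by
  rw [word, cup_mate_insAt, cup_label_insAt, cup_label_insAt, word]

/-- The mate of a line directed down is directed up, so of the two legs only the up leg can be
reached. -/
theorem cap_mate_insAt_ne (hv : σ.Valid (L ++ [a, a.flip] ++ R)) (g : M) (j : ℕ)
    (h : (L ++ [] ++ R)[j]? = some .down) :
    insAt L.length ((σ.cap L.length a g).mate j) =
      if σ.mate (insAt L.length j) = upLeg L.length a then σ.mate (downLeg L.length a)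
      else σ.mate (insAt L.length j) := by
  rw [insAt_cap_mate hv.mate_mate (hv.mate_ne (getElem?_left _ _) (getElem?_left _ _))
      (hv.mate_ne (getElem?_right _ _) (getElem?_right _ _)), joinMate_eq _ a]
  rw [← getElem?_insAt a a.flip] at h
  have := hv.mate_ne h (getElem?_downLeg a)
  simp [this]

theorem cap_word (hv : σ.Valid (L ++ [a, a.flip] ++ R)) (g : M) (j : ℕ)
    (h : (L ++ [] ++ R)[j]? = some .down) :
    (σ.cap L.length a g).word j =
      if σ.mate (insAt L.length j) = upLeg L.length a then
        σ.word (insAt L.length j) * g * σ.word (downLeg L.length a)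
      else σ.word (insAt L.length j) := by
  have hm := cap_mate_insAt_ne hv g j h
  rw [← getElem?_insAt a a.flip] at h
  simp only [word, cap] at hm ⊢
  rw [hm]
  split_ifs with h₁ h₂ h₂
  · rw [hv.mate_mate] at h₂
    cases a <;> simp [upLeg, downLeg] at h₂
  · rw [h₁]
    simp only [mul_assoc]
  · rw [hv.mate_mate] at h₂
    rw [h₂, getElem?_upLeg] at h
    simp at h
  · rfl

end Words

/-- Two links with the same mates and the same words on the arcs. -/
structure Same (σ σ' : Link M) (lv : List Dir) : Prop where
  mate : σ.mate = σ'.mate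
  word : ∀ j, lv[j]? = some .down → σ.word j = σ'.word j

theorem Valid.of_mate {σ σ' : Link M} {lv : List Dir} (hv : σ.Valid lv) (h : σ.mate = σ'.mate) :
    σ'.Valid lv := ⟨h ▸ hv.mate_mate, h ▸ hv.mate_dir⟩

/-- The new words are functions of the old mates and words, so the distribution of a word over the
two ends of its arc never matters. -/
theorem Same.act {σ σ' : Link M} {L R : List Dir} (g : Extremum → M) {p : Piece} (x : M × M)
    (hv : σ.Valid (L ++ p.dom ++ R)) (h : σ.Same σ' (L ++ p.dom ++ R)) :
    (σ.act g p L.length x).Same (σ'.act g p L.length x) (L ++ p.cod ++ R) := by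
  have hv' := hv.of_mate h.mate
  rcases p with ⟨o, a, b⟩ | a | a
  · refine ⟨by simp only [Link.act, cross, h.mate], fun j hj => ?_⟩
    simp only [Piece.cod] at hj
    rw [← getElem?_swapAt] at hj
    simp only [Link.act]
    rw [← swapAt_swapAt L.length j, cross_word hv hj, cross_word hv' hj, h.word _ hj, h.mate]
  · refine ⟨by simp only [Link.act, cap, h.mate], fun j hj => ?_⟩
    simp only [Piece.cod] at hj
    simp only [Link.act]
    rw [cap_word hv _ _ hj, cap_word hv' _ _ hj]
    rw [← getElem?_insAt a a.flip] at hj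
    rw [h.mate, h.word _ hj, h.word _ (getElem?_downLeg a)]
  · refine ⟨by simp only [Link.act, cup, h.mate], fun j hj => ?_⟩
    simp only [Link.act, Piece.cod] at hj ⊢
    obtain e | ⟨i, rfl⟩ : j = downLeg L.length a ∨ ∃ i, j = insAt L.length i := by
      cases a
      · obtain rfl | h | h := eq_or_insAt L.length j
        · rw [getElem?_left] at hj
          simp at hj
        · exact .inl h
        · exact .inr h
      · obtain h | rfl | h := eq_or_insAt L.length j
        · exact .inl h
        · rw [getElem?_right] at hj
          simp [Dir.flip] at hj
        · exact .inr h
    · rw [e, cup_word_downLeg, cup_word_downLeg]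
    · rw [getElem?_insAt] at hj
      rw [cup_word_insAt, cup_word_insAt, h.word _ hj]

/-- The link with the label at position `j` replaced by `y`. -/
def setLabel (σ : Link M) (j : ℕ) (y : M) : Link M := ⟨σ.mate, Function.update σ.label j y⟩

end Link

/-! ### The state sum and its linearity in the labels. -/

section StateSum

variable {k A : Type*} [Field k] [Ring A] [Algebra k A]

open Link

theorem Link.Same.closing_eq {tr : A →ₗ[k] k} {g : Extremum → A} {σ σ' : Link A} {p : Piece}
    {L R : List Dir} (h : σ.Same σ' (L ++ p.dom ++ R)) :
    closing tr g p L.length σ = closing tr g p L.length σ' := by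
  rcases p with ⟨o, a, b⟩ | a | a
  · rfl
  · simp only [closing, h.mate]
    split_ifs with hm
    · have := h.word _ (getElem?_downLeg a)
      rw [Link.word, Link.word, h.mate, hm] at this
      rw [this]
    · rfl
  · rfl

/-- The pairs of labels over which the sum is taken at a component. -/
noncomputable def pieceLabels (dec : Bool → Dir → Dir → A ⊗[k] A) : Piece → Finset (A × A)
  | .cross o a b => OrientedQuantumAlgebra.terms (dec o a b)
  | .cap _ => {(1, 1)}
  | .cup _ => {(1, 1)}

/-- The sum, over all labellings of the crossings in the given slices, of the product of the traces
of the loops which arise when the slices are put on top of a link. -/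
noncomputable def stateSum (dec : Bool → Dir → Dir → A ⊗[k] A) (tr : A →ₗ[k] k)
    (g : Extremum → A) : List Slice → Link A → k
  | [], _ => 1
  | s :: Y, σ => ∑ x ∈ pieceLabels dec s.piece, closing tr g s.piece s.left.length σ *
      stateSum dec tr g Y (σ.act g s.piece s.left.length x)

variable {dec : Bool → Dir → Dir → A ⊗[k] A} {tr : A →ₗ[k] k} {g : Extremum → A}

theorem Link.Same.stateSum_eq {Y : List Slice} {lv lv' : List Dir} {σ σ' : Link A}
    (hY : Composes lv Y lv') (hv : σ.Valid lv) (h : σ.Same σ' lv) :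
    stateSum dec tr g Y σ = stateSum dec tr g Y σ' := by
  induction Y generalizing lv σ σ' with
  | nil => rfl
  | cons s Y ih =>
    obtain ⟨rfl, hY⟩ := hY
    refine Finset.sum_congr rfl fun x _ => ?_
    rw [h.closing_eq, ih hY (hv.act _ _ _) (h.act _ _ hv)]

theorem mulAlong_linear (d : Dir) (x : A) : ∃ φ : A →ₗ[k] A, ∀ y, mulAlong d y x = φ y := by
  cases d
  · exact ⟨LinearMap.mulRight k x, fun y => rfl⟩
  · exact ⟨LinearMap.mulLeft k x, fun y => rfl⟩

/-- A label of a line at the level survives in exactly one place: it is carried linearly into the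
label of one line above the slice, or its loop is closed and it enters under the trace. -/
theorem Link.act_setLabel {σ : Link A} {p : Piece} {L R : List Dir}
    (hv : σ.Valid (L ++ p.dom ++ R)) {j : ℕ} {d : Dir} (hj : (L ++ p.dom ++ R)[j]? = some d)
    (x : A × A) :
    (∃ i, (∃ d', (L ++ p.cod ++ R)[i]? = some d') ∧ ∃ φ : A →ₗ[k] A, ∀ y,
      (σ.setLabel j y).act g p L.length x = (σ.act g p L.length x).setLabel i (φ y) ∧
      closing tr g p L.length (σ.setLabel j y) = closing tr g p L.length σ) ∨
    ∃ φ : A →ₗ[k] k, ∀ y, (σ.setLabel j y).act g p L.length x = σ.act g p L.length x ∧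
      closing tr g p L.length (σ.setLabel j y) = φ y := by
  rcases p with ⟨o, a, b⟩ | a | a
  · left
    simp only [Piece.dom, Piece.cod] at *
    refine ⟨swapAt L.length j, ⟨d, by rw [getElem?_swapAt]; exact hj⟩, ?_⟩
    generalize (if o then x.1 else x.2) = u
    generalize (if o then x.2 else x.1) = v
    obtain ⟨φ, hφ⟩ := mulAlong_linear (k := k) a (if o then x.1 else x.2)
    obtain ⟨ψ, hψ⟩ := mulAlong_linear (k := k) b (if o then x.2 else x.1)
    refine ⟨if j = L.length then φ else if j = L.length + 1 then ψ else LinearMap.id,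
      fun y => ⟨?_, rfl⟩⟩
    ext i
    · rfl
    · obtain ⟨i, rfl⟩ : ∃ i', swapAt L.length i' = i := ⟨_, swapAt_swapAt _ i⟩
      simp only [act, setLabel, cross_label_swapAt, Function.update_apply, swapAt_eq_iff,
        swapAt_swapAt]
      split_ifs <;> simp_all
  · simp only [Piece.dom, Piece.cod] at *
    have h₁ := hv.mate_ne (getElem?_left _ _) (getElem?_left _ _)
    have h₂ := hv.mate_ne (getElem?_right _ _) (getElem?_right _ _)
    have hu := getElem?_upLeg (L := L) (R := R) a
    have hd := getElem?_downLeg (L := L) (R := R) a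
    have hmu := hv.mate_dir _ _ hu
    have nu : ∀ i, insAt L.length i ≠ upLeg L.length a := by
      intro i
      cases a
      · exact (insAt_ne _ _).1
      · exact (insAt_ne _ _).2
    have nd : ∀ i, insAt L.length i ≠ downLeg L.length a := by
      intro i
      cases a
      · exact (insAt_ne _ _).2
      · exact (insAt_ne _ _).1
    have nud := upLeg_ne_downLeg L.length a
    have hex : ∀ i, i ≠ upLeg L.length a → i ≠ downLeg L.length a → ∃ i', i = insAt L.length i' := by
      intro i h h'
      obtain h₀ | h₀ | h₀ := eq_or_insAt L.length i
      · cases a <;> contradiction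
      · cases a <;> contradiction
      · exact h₀
    by_cases hju : j = upLeg L.length a ∨ j = downLeg L.length a
    · have hjn : ∀ i, insAt L.length i ≠ j := by
        rintro i rfl
        exact hju.elim (nu i) (nd i)
      by_cases hm : σ.mate (downLeg L.length a) = upLeg L.length a
      · right
        -- The two legs form a loop, so no other arc ends at the up leg and the surviving labels do
        -- not involve `y`.
        have hmi : ∀ i, σ.mate (insAt L.length i) ≠ upLeg L.length a := by
          intro i h
          apply nd i
          rw [← hv.mate_mate (insAt L.length i), h, ← hm, hv.mate_mate]
        refine ⟨tr ∘ₗ if j = upLeg L.length a then LinearMap.mulRight k (g (capType a)) ∘ₗ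
            LinearMap.mulLeft k (σ.label (downLeg L.length a)) else
            LinearMap.mulRight k (σ.label (upLeg L.length a) * g (capType a)), fun y => ⟨?_, ?_⟩⟩
        · ext i
          · rfl
          · simp [act, cap, setLabel, hmi, hjn]
        · simp only [closing, setLabel, hm, if_true]
          by_cases hj' : j = upLeg L.length a
          · subst hj'
            simp [nud.symm]
          · obtain rfl := hju.resolve_left hj'
            simp [nud, nud.symm, mul_assoc]
      · left
        have n₁ := hv.mate_ne hu hu
        have n₂ : σ.mate (upLeg L.length a) ≠ downLeg L.length a := by
          intro h
          exact hm (by rw [← h, hv.mate_mate])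
        -- The position `e` belongs to the far end of the arc that arrives at the up leg; its label
        -- absorbs the labels of both legs.
        obtain ⟨e, he⟩ := hex _ n₁ n₂
        have hmi : ∀ i, σ.mate (insAt L.length i) = upLeg L.length a ↔ i = e := by
          intro i
          rw [← insAt_injective (l := L.length) (j := i) (j' := e), ← he]
          constructor
          · intro h
            rw [← h, hv.mate_mate]
          · intro h
            rw [h, hv.mate_mate]
        refine ⟨e, ⟨_, by rw [← getElem?_insAt a a.flip, ← he]; exact hmu⟩,
          LinearMap.mulLeft k (σ.label (insAt L.length e)) ∘ₗ if j = upLeg L.length a then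
            LinearMap.mulRight k (g (capType a) * σ.label (downLeg L.length a)) else
            LinearMap.mulLeft k (σ.label (upLeg L.length a) * g (capType a)), fun y => ⟨?_, ?_⟩⟩
        · ext i
          · rfl
          · simp only [act, cap, setLabel, Function.update_apply, hmi, hjn, if_false]
            by_cases hj' : j = upLeg L.length a
            · subst hj'
              by_cases h : i = e
              · simp [nud.symm, h, mul_assoc]
              · simp [h]
            · obtain rfl := hju.resolve_left hj'
              by_cases h : i = e
              · simp [nud, nud.symm, h, mul_assoc]
              · simp [h]
        · simp [closing, setLabel, hm]
    · left
      push Not at hju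
      obtain ⟨i, rfl⟩ := hex j hju.1 hju.2
      refine ⟨i, ⟨d, by rw [← getElem?_insAt a a.flip]; exact hj⟩,
        if σ.mate (insAt L.length i) = upLeg L.length a then LinearMap.mulRight k
          (σ.label (upLeg L.length a) * g (capType a) * σ.label (downLeg L.length a))
        else LinearMap.id, fun y => ⟨?_, ?_⟩⟩
      · ext i'
        · rfl
        · simp only [act, cap, setLabel, Function.update_apply, (nu i).symm, (nd i).symm,
            insAt_injective, if_false]
          by_cases h : i' = i
          · subst h
            simp only [if_true]
            split_ifs <;> simp [mul_assoc]
          · simp only [h, if_false]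
      · simp only [closing, setLabel, Function.update_apply, (nu i).symm, (nd i).symm, if_false]
  · left
    simp only [Piece.dom, Piece.cod] at *
    refine ⟨insAt L.length j, ⟨d, by rw [getElem?_insAt]; exact hj⟩, LinearMap.id,
      fun y => ⟨?_, rfl⟩⟩
    ext i
    · rfl
    · obtain rfl | rfl | ⟨i, rfl⟩ := eq_or_insAt L.length i
      · simp only [act, setLabel]
        rw [Function.update_of_ne (insAt_ne _ _).1.symm]
        cases a <;> simp [cup, downLeg, upLeg]
      · simp only [act, setLabel]
        rw [Function.update_of_ne (insAt_ne _ _).2.symm]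
        cases a <;> simp [cup, downLeg, upLeg]
      · simp only [act, setLabel, Function.update_apply, insAt_injective, cup_label_insAt,
          LinearMap.id_apply]

/-- Since no lines remain at the top, every label at the level is eventually absorbed by the trace
of a loop. Without this the claim would fail, the state sum of no slices being the constant `1`. -/
theorem stateSum_isLinearMap {Y : List Slice} {lv : List Dir} {σ : Link A}
    (hY : Composes lv Y []) (hv : σ.Valid lv) {j : ℕ} {d : Dir} (hj : lv[j]? = some d) :
    IsLinearMap k fun y => stateSum dec tr g Y (σ.setLabel j y) := by
  induction Y generalizing lv σ j d with
  | nil => simp [show lv = [] from hY] at hj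
  | cons s Y ih =>
    obtain ⟨rfl, hY⟩ := hY
    have key : ∀ x : A × A, ∃ φ : A →ₗ[k] k, ∀ y,
        closing tr g s.piece s.left.length (σ.setLabel j y) *
          stateSum dec tr g Y ((σ.setLabel j y).act g s.piece s.left.length x) = φ y := by
      intro x
      obtain ⟨i, ⟨d', hi⟩, φ, h⟩ | ⟨φ, h⟩ := act_setLabel (k := k) (tr := tr) (g := g) hv hj x
      · have := ih hY (hv.act g s.piece x) hi
        refine ⟨closing tr g s.piece s.left.length σ • (this.mk' _ ∘ₗ φ), fun y => ?_⟩
        rw [(h y).1, (h y).2]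
        rfl
      · refine ⟨stateSum dec tr g Y (σ.act g s.piece s.left.length x) • φ, fun y => ?_⟩
        rw [(h y).1, (h y).2, mul_comm]
        rfl
    choose φ hφ using key
    have : (fun y => stateSum dec tr g (s :: Y) (σ.setLabel j y)) =
        (∑ x ∈ pieceLabels dec s.piece, φ x : A →ₗ[k] k) := by
      ext y
      simp only [stateSum, hφ, LinearMap.sum_apply]
    rw [this]
    exact LinearMap.isLinear _

end StateSum

open Link OrientedQuantumAlgebra

/-- The label of a local extremum. -/
def extremumLabel {A : Type*} [Ring A] (G : Aˣ) : Extremum → A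
  | .uMinus => G
  | .uPlus => (↑G⁻¹ : A)
  | .dPlus => 1
  | .dMinus => 1

/-- The label of the line `/` of a crossing. -/
def slash {M : Type*} (o : Bool) (x : M × M) : M := if o then x.1 else x.2

/-- The label of the line `\` of a crossing. -/
def backslash {M : Type*} (o : Bool) (x : M × M) : M := if o then x.2 else x.1

theorem mulAlong_assoc {M : Type*} [Monoid M] (d : Dir) (x y z : M) :
    mulAlong d (mulAlong d x y) z = mulAlong d x (mulAlong d y z) := by
  cases d <;> simp [mulAlong, mul_assoc]

theorem mulAlong_one {M : Type*} [Monoid M] (d : Dir) (x : M) : mulAlong d x 1 = x := by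
  cases d <;> simp [mulAlong]

theorem Link.Valid.setLabel {M : Type*} {σ : Link M} {lv : List Dir} (hv : σ.Valid lv) (j : ℕ) (x : M) :
    (σ.setLabel j x).Valid lv := ⟨hv.mate_mate, hv.mate_dir⟩

theorem Link.setLabel_comm {M : Type*} (σ : Link M) {i j : ℕ} (h : i ≠ j) (x y : M) :
    (σ.setLabel i x).setLabel j y = (σ.setLabel j y).setLabel i x := by
  simp only [Link.setLabel, Function.update_comm h]

theorem Link.setLabel_self {M : Type*} (σ : Link M) (i : ℕ) : σ.setLabel i (σ.label i) = σ := by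
  simp [Link.setLabel]

/-! ### The relations between decorations; interchange, straightening and the second Reidemeister
move. -/

section Moves

variable {k A : Type*} [Field k] [Ring A] [Algebra k A]

/-- The relations between the decorations of crossings which correspond to the moves. -/
structure Relations (dec : Bool → Dir → Dir → A ⊗[k] A) (G : Aˣ) : Prop where
  cancel : ∀ o a b, ∑ x ∈ terms (dec o a b), ∑ y ∈ terms (dec (!o) b a),
    mulAlong a (slash o x) (backslash (!o) y) ⊗ₜ[k] mulAlong b (backslash o x) (slash (!o) y) =
      1 ⊗ₜ[k] 1
  triangle : ∀ o a b c, ∑ x ∈ terms (dec o a b), ∑ y ∈ terms (dec o a c), ∑ z ∈ terms (dec o b c),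
    (mulAlong a (slash o x) (slash o y) ⊗ₜ[k] mulAlong b (backslash o x) (slash o z)) ⊗ₜ[k]
      mulAlong c (backslash o y) (backslash o z) =
    ∑ x ∈ terms (dec o a b), ∑ y ∈ terms (dec o a c), ∑ z ∈ terms (dec o b c),
    (mulAlong a (slash o y) (slash o x) ⊗ₜ[k] mulAlong b (slash o z) (backslash o x)) ⊗ₜ[k]
      mulAlong c (backslash o z) (backslash o y)
  slideMax : ∀ o a c, ∑ x ∈ terms (dec o a c),
      mulAlong a (slash o x) (extremumLabel G (capType a)) ⊗ₜ[k] backslash o x =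
    ∑ y ∈ terms (dec (!o) c a.flip),
      mulAlong a (extremumLabel G (capType a)) (backslash (!o) y) ⊗ₜ[k] slash (!o) y
  slideMin : ∀ o a c, ∑ x ∈ terms (dec o c a),
      mulAlong a (extremumLabel G (cupType a)) (backslash o x) ⊗ₜ[k] slash o x =
    ∑ y ∈ terms (dec (!o) a.flip c),
      mulAlong a (slash (!o) y) (extremumLabel G (cupType a)) ⊗ₜ[k] backslash (!o) y

variable {dec : Bool → Dir → Dir → A ⊗[k] A} {tr : A →ₗ[k] k} {G : Aˣ} {Y : List Slice}
  {L R : List Dir} {σ : Link A}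

theorem stateSum_interchange (htr : Tracelike tr) (g : Extremum → A) (p q : Piece) (m : List Dir)
    (hv : σ.Valid (L ++ p.dom ++ (m ++ q.dom ++ R))) :
    stateSum dec tr g (⟨L, p, m ++ q.dom ++ R⟩ :: ⟨L ++ (p.cod ++ m), q, R⟩ :: Y) σ =
      stateSum dec tr g (⟨L ++ (p.dom ++ m), q, R⟩ :: ⟨L, p, m ++ q.cod ++ R⟩ :: Y) σ := by
  have e₁ : (L ++ (p.cod ++ m)).length = L.length + p.cod.length + m.length := by simp; omega
  have e₂ : (L ++ (p.dom ++ m)).length = L.length + p.dom.length + m.length := by simp; omega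
  simp only [stateSum, e₁, e₂, Finset.mul_sum]
  rw [Finset.sum_comm]
  refine Finset.sum_congr rfl fun y _ => Finset.sum_congr rfl fun x _ => ?_
  rw [← mul_assoc, ← mul_assoc, closing_comm htr g p q x y hv, act_comm g p q x y hv]

theorem insAt_succ_of_ne {l j : ℕ} (h : j ≠ l) : insAt (l + 1) j = insAt l j := by
  unfold insAt; split_ifs <;> omega

/-- Straightening may move a factor from one end of the arc to the other, so the links need not be
equal but only have the same mates and words; `g` and `g'` become neighbours in the word and cancel.
-/
theorem cup_cap_left_same {M : Type*} [Monoid M] {σ : Link M} {L R : List Dir} {a : Dir} {g g' : M}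
    (hg : g * g' = 1) (hg' : g' * g = 1) (hv : σ.Valid (L ++ [a] ++ R)) :
    ((σ.cup (L.length + 1) a.flip g).cap L.length a g').Same σ (L ++ [a] ++ R) := by
  have ha : (L ++ [a] ++ R)[L.length]? = some a := by simp
  have hne := hv.mate_ne ha ha
  have hv₁ : (σ.cup (L.length + 1) a.flip g).Valid (L ++ [a, a.flip] ++ ([a] ++ R)) := by
    have := Valid.act (L := L ++ [a]) (R := R) (σ := σ) (fun _ => g) (.cup a.flip) (1, 1)
      (by simpa [Piece.dom] using hv)
    simpa [Piece.cod, Dir.flip_flip, act] using this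
  have e₀ : insAt L.length L.length = L.length + 2 := insAt_of_le le_rfl
  have e₁ : insAt (L.length + 1) L.length = L.length := insAt_of_lt (by omega)
  have n₁ : (σ.cup (L.length + 1) a.flip g).mate (L.length + 1) = L.length + 2 := by simp [cup]
  have n₂ : (σ.cup (L.length + 1) a.flip g).mate (L.length + 2) = L.length + 1 := by simp [cup]
  have n₃ : (σ.cup (L.length + 1) a.flip g).mate L.length =
      insAt (L.length + 1) (σ.mate L.length) := by
    have := cup_mate_insAt (L.length + 1) a.flip g σ L.length
    rwa [e₁] at this
  have w₃ : (σ.cup (L.length + 1) a.flip g).word L.length = σ.word L.length := by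
    have := cup_word_insAt (σ := σ) (a := a.flip) (L.length + 1) g L.length
    rwa [e₁] at this
  constructor
  · ext j
    rw [cap_mate, joinMate, n₁, n₃]
    by_cases hj : j = L.length
    · subst hj
      rw [e₀, n₂, if_neg (by omega), if_pos rfl, insAt_succ_of_ne hne, delAt_insAt]
    · rw [← insAt_succ_of_ne hj, cup_mate_insAt]
      by_cases hm : σ.mate j = L.length
      · rw [hm, e₁, if_pos rfl, ← e₀, delAt_insAt]
      · rw [insAt_succ_of_ne hm, if_neg (insAt_ne _ _).1, if_neg (insAt_ne _ _).2, delAt_insAt]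
  · intro j hj
    rw [cap_word hv₁ _ _ (by simpa using hj)]
    cases a
    · have hjl : j ≠ L.length := by
        rintro rfl
        rw [ha] at hj
        simp at hj
      have : (σ.cup (L.length + 1) Dir.up.flip g).word (downLeg L.length .up) = g :=
        cup_word_downLeg _ _
      rw [← insAt_succ_of_ne hjl, cup_word_insAt, this, mul_assoc, hg', mul_one, ite_self]
    · by_cases hjl : j = L.length
      · subst hjl
        have : (σ.cup (L.length + 1) Dir.down.flip g).word (L.length + 2) = g :=
          cup_word_downLeg _ _
        simp [e₀, n₂, upLeg, downLeg, this, w₃, hg]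
      · rw [← insAt_succ_of_ne hjl, cup_mate_insAt, cup_word_insAt]
        exact if_neg (insAt_ne _ _).1

theorem cup_cap_right_same {M : Type*} [Monoid M] {σ : Link M} {L R : List Dir} {a : Dir}
    {g g' : M} (hg : g * g' = 1) (hg' : g' * g = 1) (hv : σ.Valid (L ++ [a] ++ R)) :
    ((σ.cup L.length a g).cap (L.length + 1) a.flip g').Same σ (L ++ [a] ++ R) := by
  have ha : (L ++ [a] ++ R)[L.length]? = some a := by simp
  have hne := hv.mate_ne ha ha
  have hv₁ : (σ.cup L.length a g).Valid ((L ++ [a]) ++ [a.flip, a.flip.flip] ++ R) := by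
    have := Valid.act (L := L) (R := [a] ++ R) (σ := σ) (fun _ => g) (.cup a) (1, 1)
      (by simpa [Piece.dom] using hv)
    simpa [Piece.cod, Dir.flip_flip, act] using this
  have e₀ : insAt L.length L.length = L.length + 2 := insAt_of_le le_rfl
  have e₁ : insAt (L.length + 1) L.length = L.length := insAt_of_lt (by omega)
  have n₁ : (σ.cup L.length a g).mate (L.length + 1) = L.length := by simp [cup]
  have n₂ : (σ.cup L.length a g).mate L.length = L.length + 1 := by simp [cup]
  have n₃ : (σ.cup L.length a g).mate (L.length + 2) = insAt L.length (σ.mate L.length) := by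
    rw [← e₀]
    exact cup_mate_insAt _ _ _ _ _
  have w₃ : (σ.cup L.length a g).word (L.length + 2) = σ.word L.length := by
    rw [← e₀]
    exact cup_word_insAt _ _ _
  constructor
  · ext j
    rw [cap_mate, joinMate, n₁, n₃]
    by_cases hj : j = L.length
    · subst hj
      rw [e₁, n₂, if_pos rfl, ← insAt_succ_of_ne hne, delAt_insAt]
    · rw [insAt_succ_of_ne hj, cup_mate_insAt]
      by_cases hm : σ.mate j = L.length
      · rw [hm, e₀, if_neg (by omega), if_pos rfl, delAt_of_lt (by omega)]
      · rw [← insAt_succ_of_ne hm, if_neg (insAt_ne _ _).1, if_neg (insAt_ne _ _).2, delAt_insAt]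
  · intro j hj
    have key := cap_word hv₁ g' j (by simpa using hj)
    rw [List.length_append, List.length_singleton] at key
    rw [key]
    cases a
    · have hjl : j ≠ L.length := by
        rintro rfl
        rw [ha] at hj
        simp at hj
      have : (σ.cup L.length Dir.up g).word (downLeg (L.length + 1) Dir.up.flip) = g :=
        cup_word_downLeg _ _
      rw [insAt_succ_of_ne hjl, cup_word_insAt, this, mul_assoc, hg', mul_one, ite_self]
    · by_cases hjl : j = L.length
      · subst hjl
        have : (σ.cup L.length Dir.down g).word L.length = g := cup_word_downLeg _ _
        simp [e₁, n₂, upLeg, downLeg, Dir.flip, this, w₃, hg]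
      · rw [insAt_succ_of_ne hjl, cup_mate_insAt, cup_word_insAt]
        exact if_neg (insAt_ne (L.length) _).2

/-- The transpositions cancel, so a double crossing only multiplies two labels of `σ`; in this form
the functional of `exists_lift_two` can be applied to it. -/
theorem cross_cross_inverse (l : ℕ) (a b : Dir) (x y x' y' : A) :
    (σ.cross l a b x y).cross l b a x' y' =
      (σ.setLabel l (mulAlong a (σ.label l) (mulAlong a x y'))).setLabel (l + 1)
        (mulAlong b (σ.label (l + 1)) (mulAlong b y x')) := by
  ext j
  · simp [cross, setLabel, swapAt_swapAt]
  · simp only [cross, setLabel, Function.update_apply, ← mulAlong_assoc]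
    by_cases h : j = l
    · simp [h]
    · by_cases h' : j = l + 1
      · simp [h']
      · simp [h, h']

/-- Linearity in each of two labels makes the state sum a functional on `A ⊗ A`. Hence a move need
only be checked as an identity of tensors, regardless of how the tensors are written as sums. -/
theorem exists_lift_two {g : Extremum → A} {lv : List Dir} (hY : Composes lv Y []) (hv : σ.Valid lv) {i j : ℕ}
    (hij : i ≠ j) {d d' : Dir} (hi : lv[i]? = some d) (hj : lv[j]? = some d') (φ ψ : A →ₗ[k] A) :
    ∃ F : A ⊗[k] A →ₗ[k] k, ∀ x y, stateSum dec tr g Y ((σ.setLabel i (φ x)).setLabel j (ψ y)) =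
      F (x ⊗ₜ y) := by
  have h₁ := fun x => stateSum_isLinearMap (dec := dec) (tr := tr) (g := g) hY (hv.setLabel i x) hj
  have h₂ := fun y => stateSum_isLinearMap (dec := dec) (tr := tr) (g := g) hY (hv.setLabel j y) hi
  refine ⟨TensorProduct.lift ((LinearMap.mk₂ k (fun x y => stateSum dec tr g Y
    ((σ.setLabel i x).setLabel j y)) ?_ ?_ ?_ ?_).compl₁₂ φ ψ), fun x y => rfl⟩
  · intro x x' y
    simp only [setLabel_comm σ hij]
    exact (h₂ y).map_add x x'
  · intro c x y
    simp only [setLabel_comm σ hij]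
    exact (h₂ y).map_smul c x
  · intro x y y'
    exact (h₁ x).map_add y y'
  · intro c x y
    exact (h₁ x).map_smul c y

theorem exists_lift_three {g : Extremum → A} {lv : List Dir} (hY : Composes lv Y []) (hv : σ.Valid lv) {i j l : ℕ}
    (hij : i ≠ j) (hil : i ≠ l) (hjl : j ≠ l) {d d' d'' : Dir} (hi : lv[i]? = some d)
    (hj : lv[j]? = some d') (hl : lv[l]? = some d'') (φ ψ χ : A →ₗ[k] A) :
    ∃ F : (A ⊗[k] A) ⊗[k] A →ₗ[k] k, ∀ x y z, stateSum dec tr g Y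
      (((σ.setLabel i (φ x)).setLabel j (ψ y)).setLabel l (χ z)) = F ((x ⊗ₜ y) ⊗ₜ z) := by
  have h₂ := fun z => exists_lift_two (dec := dec) (tr := tr) (g := g) hY (hv.setLabel l (χ z)) hij
    hi hj φ ψ
  choose F hF using h₂
  have h₁ := fun x y => stateSum_isLinearMap (dec := dec) (tr := tr) (g := g) hY
    ((hv.setLabel i (φ x)).setLabel j (ψ y)) hl
  have e : ∀ x y z, ((σ.setLabel i x).setLabel j y).setLabel l z =
      ((σ.setLabel l z).setLabel i x).setLabel j y := by
    intro x y z
    rw [setLabel_comm _ hjl, setLabel_comm _ hil]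
  have h₃ : ∀ x y z, F z (x ⊗ₜ y) = stateSum dec tr g Y
      (((σ.setLabel i (φ x)).setLabel j (ψ y)).setLabel l (χ z)) := by
    intro x y z
    rw [e, hF]
  refine ⟨TensorProduct.lift (LinearMap.mk₂ k (fun t z => F z t) ?_ ?_ ?_ ?_), fun x y z => ?_⟩
  · intro t t' z
    exact map_add _ _ _
  · intro c t z
    exact map_smul _ _ _
  · intro t z z'
    induction t with
    | zero => simp
    | add t t' ht ht' => simp only [map_add, ht, ht']; abel
    | tmul x y =>
      simp only [h₃, map_add]; exact (h₁ x y).map_add _ _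
  · intro c t z
    induction t with
    | zero => simp
    | add t t' ht ht' => simp only [map_add, ht, ht', smul_add]
    | tmul x y => simp only [h₃, map_smul]; exact (h₁ x y).map_smul _ _
  · simp [h₃]

theorem exists_mulAlong (d : Dir) (x : A) : ∃ φ : A →ₗ[k] A, ∀ y, mulAlong d x y = φ y := by
  cases d
  · exact ⟨LinearMap.mulLeft k x, fun y => rfl⟩
  · exact ⟨LinearMap.mulRight k x, fun y => rfl⟩

theorem stateSum_cross (g : Extremum → A) (o : Bool) (a b : Dir) :
    stateSum dec tr g (⟨L, .cross o a b, R⟩ :: Y) σ = ∑ x ∈ terms (dec o a b),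
      stateSum dec tr g Y (σ.cross L.length a b (slash o x) (backslash o x)) := by
  simp [stateSum, pieceLabels, closing, act, slash, backslash]

theorem stateSum_cup (g : Extremum → A) (a : Dir) :
    stateSum dec tr g (⟨L, .cup a, R⟩ :: Y) σ =
      stateSum dec tr g Y (σ.cup L.length a (g (cupType a))) := by
  simp [stateSum, pieceLabels, closing, act]

theorem stateSum_cap (g : Extremum → A) (a : Dir) :
    stateSum dec tr g (⟨L, .cap a, R⟩ :: Y) σ = closing tr g (.cap a) L.length σ *
      stateSum dec tr g Y (σ.cap L.length a (g (capType a))) := by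
  simp [stateSum, pieceLabels, act]

theorem stateSum_cancel (hdec : Relations dec G) (g : Extremum → A) (o : Bool) (a b : Dir)
    (hv : σ.Valid (L ++ [a, b] ++ R)) (hY : Composes (L ++ [a, b] ++ R) Y []) :
    stateSum dec tr g (⟨L, .cross o a b, R⟩ :: ⟨L, .cross (!o) b a, R⟩ :: Y) σ =
      stateSum dec tr g Y σ := by
  simp only [stateSum_cross, cross_cross_inverse]
  obtain ⟨φ, hφ⟩ := exists_mulAlong (k := k) a (σ.label L.length)
  obtain ⟨ψ, hψ⟩ := exists_mulAlong (k := k) b (σ.label (L.length + 1))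
  obtain ⟨F, hF⟩ := exists_lift_two (dec := dec) (tr := tr) (g := g) hY hv (by omega)
    (getElem?_left a b) (getElem?_right a b) φ ψ
  simp only [hφ, hψ, hF, ← map_sum]
  rw [hdec.cancel, ← hF, ← hφ, ← hψ, mulAlong_one, mulAlong_one, setLabel_self]
  congr 1
  exact setLabel_self _ _

end Moves

/-! ### The third Reidemeister move, and the state sums for cancelling extrema. -/

open Link OrientedQuantumAlgebra

section

variable {M : Type*} [Monoid M] {σ σ' : Link M} {L R : List Dir} {a b c : Dir}

theorem Link.Valid.cross (hv : σ.Valid (L ++ [a, b] ++ R)) (x y : M) :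
    (σ.cross L.length a b x y).Valid (L ++ [b, a] ++ R) :=
  hv.act (fun _ => 1) (.cross true a b) (x, y)

theorem Link.Valid.cup (hv : σ.Valid (L ++ R)) (g : M) :
    (σ.cup L.length a g).Valid (L ++ [a, a.flip] ++ R) :=
  Valid.act (fun _ => g) (.cup a) (1, 1) (by simpa [Piece.dom] using hv)

theorem swapAt_braid (l j : ℕ) : swapAt l (swapAt (l + 1) (swapAt l j)) =
    swapAt (l + 1) (swapAt l (swapAt (l + 1) j)) := by
  unfold swapAt; split_ifs <;> omega

theorem swapAt_insAt_succ (l j : ℕ) :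
    swapAt (l + 1) (insAt l j) = swapAt l (insAt (l + 1) j) := by
  unfold swapAt insAt; split_ifs <;> omega

/-- Both sides of the third move are written over one base link, in which the three crossings carry
the label `1`, so that a single trilinear functional evaluates both. The base mates agree by the
braid relation for transpositions. -/
theorem cross_triangle_left (l : ℕ) (x x' y y' z z' : M) :
    ((σ.cross l a b x x').cross (l + 1) a c y y').cross l b c z z' =
      ((((((σ.cross l a b 1 1).cross (l + 1) a c 1 1).cross l b c 1 1).setLabel (l + 2)
        (mulAlong a (σ.label l) (mulAlong a x y))).setLabel (l + 1)
        (mulAlong b (σ.label (l + 1)) (mulAlong b x' z))).setLabel l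
        (mulAlong c (σ.label (l + 2)) (mulAlong c y' z'))) := by
  ext j
  · rfl
  · simp only [cross, setLabel, Function.update_apply, ← mulAlong_assoc]
    obtain rfl | rfl | rfl | ⟨h₁, h₂, h₃⟩ : j = l ∨ j = l + 1 ∨ j = l + 2 ∨
      (j ≠ l ∧ j ≠ l + 1 ∧ j ≠ l + 2) := by omega
    · split_ifs <;> first | rfl | omega
    · split_ifs <;> first | rfl | omega
    · split_ifs <;> first | rfl | omega
    · split_ifs <;> first | rfl | omega

theorem cross_triangle_right (l : ℕ) (x x' y y' z z' : M) :
    ((σ.cross (l + 1) b c z z').cross l a c y y').cross (l + 1) a b x x' =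
      ((((((σ.cross l a b 1 1).cross (l + 1) a c 1 1).cross l b c 1 1).setLabel (l + 2)
        (mulAlong a (σ.label l) (mulAlong a y x))).setLabel (l + 1)
        (mulAlong b (σ.label (l + 1)) (mulAlong b z x'))).setLabel l
        (mulAlong c (σ.label (l + 2)) (mulAlong c z' y'))) := by
  ext j
  · simp only [cross, setLabel, swapAt_braid]
  · simp only [cross, setLabel, Function.update_apply, ← mulAlong_assoc]
    obtain rfl | rfl | rfl | ⟨h₁, h₂, h₃⟩ : j = l ∨ j = l + 1 ∨ j = l + 2 ∨
      (j ≠ l ∧ j ≠ l + 1 ∧ j ≠ l + 2) := by omega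
    · split_ifs <;> first | rfl | omega
    · split_ifs <;> first | rfl | omega
    · split_ifs <;> first | rfl | omega
    · split_ifs <;> first | rfl | omega

/-- Two links which agree except for the labels at the two ends of an arc. -/
theorem Same.of_pair {lv : List Dir} (hv : σ.Valid lv) (hm : σ.mate = σ'.mate) {u d : ℕ}
    (hd : lv[d]? = some .down) (hud : σ.mate d = u)
    (hl : ∀ j, j ≠ u → j ≠ d → σ.label j = σ'.label j)
    (hp : σ.label d * σ.label u = σ'.label d * σ'.label u) : σ.Same σ' lv := by
  refine ⟨hm, fun j hj => ?_⟩
  have hu := hv.mate_dir _ _ hd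
  rw [hud] at hu
  have hju : j ≠ u := by
    rintro rfl
    rw [hu] at hj
    simp [Dir.flip] at hj
  by_cases h : j = d
  · subst h
    rw [Link.word, Link.word, ← hm, hud, hp]
  · have h₁ : σ.mate j ≠ d := hv.mate_ne hj hd
    have h₂ : σ.mate j ≠ u := by
      intro h'
      apply h
      rw [← hv.mate_mate j, h', ← hud, hv.mate_mate]
    rw [Link.word, Link.word, ← hm, hl _ hju h, hl _ h₂ h₁]

end

section Moves

variable {k A : Type*} [Field k] [Ring A] [Algebra k A]
  {dec : Bool → Dir → Dir → A ⊗[k] A} {tr : A →ₗ[k] k} {G : Aˣ} {Y : List Slice}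
  {L R : List Dir} {σ : Link A}

theorem stateSum_triangle (hdec : Relations dec G) (g : Extremum → A) (o : Bool) (a b c : Dir)
    (hv : σ.Valid (L ++ [a, b, c] ++ R)) (hY : Composes (L ++ [c, b, a] ++ R) Y []) :
    stateSum dec tr g (⟨L, .cross o a b, c :: R⟩ :: ⟨L ++ [b], .cross o a c, R⟩ ::
      ⟨L, .cross o b c, a :: R⟩ :: Y) σ =
    stateSum dec tr g (⟨L ++ [a], .cross o b c, R⟩ :: ⟨L, .cross o a c, b :: R⟩ ::
      ⟨L ++ [c], .cross o a b, R⟩ :: Y) σ := by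
  have e : ∀ x : Dir, (L ++ [x]).length = L.length + 1 := by simp
  simp only [stateSum_cross, e]
  have hv₁ : (((σ.cross L.length a b 1 1).cross (L.length + 1) a c 1 1).cross L.length b c 1 1).Valid
      (L ++ [c, b, a] ++ R) := by
    have h₁ := Valid.cross (σ := σ) (L := L) (R := c :: R) (a := a) (b := b) (by simpa using hv) (1 : A) 1
    have h₂ := Valid.cross (L := L ++ [b]) (R := R) (a := a) (b := c) (by simpa using h₁) (1 : A) 1
    have h₃ := Valid.cross (L := L) (R := a :: R) (a := b) (b := c) (by simpa using h₂) (1 : A) 1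
    simpa using h₃
  obtain ⟨φ, hφ⟩ := exists_mulAlong (k := k) a (σ.label L.length)
  obtain ⟨ψ, hψ⟩ := exists_mulAlong (k := k) b (σ.label (L.length + 1))
  obtain ⟨χ, hχ⟩ := exists_mulAlong (k := k) c (σ.label (L.length + 2))
  obtain ⟨F, hF⟩ := exists_lift_three (dec := dec) (tr := tr) (g := g) hY hv₁ (i := L.length + 2)
    (j := L.length + 1) (l := L.length) (by omega) (by omega) (by omega) (d := a) (d' := b)
    (d'' := c) (by simp) (by simp)
    (by simp) φ ψ χ
  have hl : ∀ x x' y y' z z' : A, stateSum dec tr g Y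
      (((σ.cross L.length a b x x').cross (L.length + 1) a c y y').cross L.length b c z z') =
        F ((mulAlong a x y ⊗ₜ mulAlong b x' z) ⊗ₜ mulAlong c y' z') := by
    intro x x' y y' z z'
    rw [cross_triangle_left, hφ, hψ, hχ, hF]
  have hr : ∀ x x' y y' z z' : A, stateSum dec tr g Y
      (((σ.cross (L.length + 1) b c z z').cross L.length a c y y').cross (L.length + 1) a b x x') =
        F ((mulAlong a y x ⊗ₜ mulAlong b z x') ⊗ₜ mulAlong c z' y') := by
    intro x x' y y' z z'
    rw [cross_triangle_right, hφ, hψ, hχ, hF]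
  simp only [hl, hr, ← map_sum]
  rw [hdec.triangle]
  congr 1
  -- The right-hand side of the move meets the crossings in the order `b c`, `a c`, `a b`; the sums
  -- are permuted accordingly.
  conv_rhs =>
    rw [Finset.sum_comm]
    enter [2, y]
    rw [Finset.sum_comm]
  rw [Finset.sum_comm]

theorem stateSum_maxMin (a : Dir)
    (hv : σ.Valid (L ++ [a] ++ R)) (hY : Composes (L ++ [a] ++ R) Y []) :
    stateSum dec tr (extremumLabel G) (⟨L ++ [a], .cup a.flip, R⟩ :: ⟨L, .cap a, a :: R⟩ :: Y) σ =
    stateSum dec tr (extremumLabel G) Y σ := by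
  rw [stateSum_cup, stateSum_cap]
  -- The two extrema are of types `uPlus`, `uMinus`, with labels `G⁻¹`, `G`, or of types `dMinus`,
  -- `dPlus`, with labels `1`.
  have hg : extremumLabel G (cupType a.flip) * extremumLabel G (capType a) = 1 ∧
      extremumLabel G (capType a) * extremumLabel G (cupType a.flip) = 1 := by
    cases a <;> simp [extremumLabel, cupType, capType, Dir.flip]
  have e : (L ++ [a]).length = L.length + 1 := by simp
  have hs := cup_cap_left_same hg.1 hg.2 hv
  rw [e, (hs.stateSum_eq hY (hv.of_mate hs.mate.symm)), closing, if_neg, one_mul]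
  have ha : (L ++ [a] ++ R)[L.length]? = some a := by simp
  have hne := hv.mate_ne ha ha
  have n₁ : (σ.cup (L.length + 1) a.flip (extremumLabel G (cupType a.flip))).mate (L.length + 1) =
    L.length + 2 := by simp [cup]
  have n₂ := cup_mate_insAt (L.length + 1) a.flip (extremumLabel G (cupType a.flip)) σ L.length
  rw [insAt_of_lt (by omega)] at n₂
  have := (insAt_ne (L.length + 1) (σ.mate L.length)).1
  cases a
  · simp [upLeg, downLeg, n₁]
  · simpa only [upLeg, downLeg, n₂] using this

theorem stateSum_minMax (a : Dir)
    (hv : σ.Valid (L ++ [a] ++ R)) (hY : Composes (L ++ [a] ++ R) Y []) :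
    stateSum dec tr (extremumLabel G) (⟨L, .cup a, a :: R⟩ :: ⟨L ++ [a], .cap a.flip, R⟩ :: Y) σ =
    stateSum dec tr (extremumLabel G) Y σ := by
  rw [stateSum_cup, stateSum_cap]
  have hg : extremumLabel G (cupType a) * extremumLabel G (capType a.flip) = 1 ∧
      extremumLabel G (capType a.flip) * extremumLabel G (cupType a) = 1 := by
    cases a <;> simp [extremumLabel, cupType, capType, Dir.flip]
  have e : (L ++ [a]).length = L.length + 1 := by simp
  have hs := cup_cap_right_same hg.1 hg.2 hv
  rw [e, (hs.stateSum_eq hY (hv.of_mate hs.mate.symm)), closing, if_neg, one_mul]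
  have ha : (L ++ [a] ++ R)[L.length]? = some a := by simp
  have hne := hv.mate_ne ha ha
  have n₁ : (σ.cup L.length a (extremumLabel G (cupType a))).mate (L.length + 1) =
    L.length := by simp [cup]
  have n₂ := cup_mate_insAt L.length a (extremumLabel G (cupType a)) σ L.length
  rw [insAt_of_le le_rfl] at n₂
  have := (insAt_ne L.length (σ.mate L.length)).2
  cases a
  · simp only [upLeg, downLeg, Dir.flip, n₁]
    omega
  · simpa only [upLeg, downLeg, Dir.flip, n₂] using this

end Moves

/-! ### Sliding a line over or under an extremum. -/

open Link OrientedQuantumAlgebra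

/-- Pulled back through the crossings, both sides join the same two positions `l` and `l + 2` of
`f`. -/
theorem Link.joinMate_slide (l : ℕ) (f : ℕ → ℕ) (i : ℕ) :
    swapAt l (joinMate (l + 1) (fun j => swapAt l (f (swapAt l j))) (swapAt l i)) =
      swapAt (l + 1) (joinMate l (fun j => swapAt (l + 1) (f (swapAt (l + 1) j)))
        (swapAt (l + 1) i)) := by
  have s₁ := swapAt_of_gt (l := l) (j := l + 1 + 1) (by omega)
  have s₂ : swapAt l (l + 1) = l := by simp [swapAt]
  have s₃ := swapAt_of_lt (l := l + 1) (j := l) (by omega)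
  have s₄ : swapAt (l + 1) (l + 1) = l + 1 + 1 := by simp [swapAt]
  simp only [joinMate, swapAt_swapAt, swapAt_eq_iff, s₁, s₂, s₃, s₄]
  split_ifs <;> first | omega | simp only [swapAt_swapAt]

section

variable {M : Type*} [Monoid M] {σ : Link M} {L R : List Dir} {a c : Dir}

theorem Link.cap_slide_mate (hv : σ.Valid (L ++ [a, c, a.flip] ++ R)) (x y z g : M) :
    ((σ.cross L.length a c x z).cap (L.length + 1) a g).mate =
      ((σ.cross (L.length + 1) c a.flip z y).cap L.length a g).mate := by
  have h₁ := Valid.cross (L := L) (R := a.flip :: R) (by simpa using hv) x z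
  have h₂ := Valid.cross (L := L ++ [a]) (R := R) (by simpa using hv) z y
  have h₁' : (σ.cross L.length a c x z).Valid ((L ++ [c]) ++ [a, a.flip] ++ R) := by simpa using h₁
  have h₂' : (σ.cross (L.length + 1) c a.flip z y).Valid (L ++ [a, a.flip] ++ (c :: R)) := by
    simpa using h₂
  have e₁ := fun j => insAt_cap_mate (g := g) (a := a) h₁'.mate_mate
    (h₁'.mate_ne (getElem?_left _ _) (getElem?_left _ _))
    (h₁'.mate_ne (getElem?_right _ _) (getElem?_right _ _)) j
  have e₂ := fun j => insAt_cap_mate (g := g) (a := a) h₂'.mate_mate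
    (h₂'.mate_ne (getElem?_left _ _) (getElem?_left _ _))
    (h₂'.mate_ne (getElem?_right _ _) (getElem?_right _ _)) j
  simp only [List.length_append, List.length_singleton] at e₁
  have ei : Function.Injective fun i => swapAt L.length (insAt (L.length + 1) i) := by
    intro i i' h
    dsimp only at h
    have := congrArg (swapAt L.length) h
    rwa [swapAt_swapAt, swapAt_swapAt, insAt_injective] at this
  ext j
  apply ei
  dsimp only
  rw [e₁, ← swapAt_insAt_succ, e₂, ← swapAt_swapAt L.length (insAt (L.length + 1) j),
    ← swapAt_insAt_succ, ← swapAt_swapAt (L.length + 1) (insAt L.length j)]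
  generalize swapAt (L.length + 1) (insAt L.length j) = i
  rw [swapAt_swapAt]
  exact joinMate_slide L.length σ.mate i

/-- The sliding line crosses the left leg on one side of the move and the right leg on the other. In
the word of an arc over the maximum the label is thereby moved past `g`, which is `h`; the sliding
line carries `z` on both sides. -/
theorem Link.cap_slide (hv : σ.Valid (L ++ [a, c, a.flip] ++ R)) {x y z g : M}
    (h : mulAlong a x g = mulAlong a g y) :
    ((σ.cross L.length a c x z).cap (L.length + 1) a g).Same
      ((σ.cross (L.length + 1) c a.flip z y).cap L.length a g) (L ++ [c] ++ R) := by
  refine ⟨cap_slide_mate hv x y z g, fun j hj => ?_⟩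
  have hv₁ : σ.Valid (L ++ [a, c] ++ (a.flip :: R)) := by simpa using hv
  have hv₂ : σ.Valid ((L ++ [a]) ++ [c, a.flip] ++ R) := by simpa using hv
  have h₁ : (σ.cross L.length a c x z).Valid ((L ++ [c]) ++ [a, a.flip] ++ R) := by
    simpa using hv₁.cross x z
  have h₂ : (σ.cross (L.length + 1) c a.flip z y).Valid (L ++ [a, a.flip] ++ (c :: R)) := by
    simpa using hv₂.cross z y
  have w₁ := cap_word h₁ g j (by simpa using hj)
  have w₂ := cap_word h₂ g j (by simpa using hj)
  have c₁ := fun i => cross_word hv₁ (x := x) (y := z) (j := i)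
  have c₂ := fun i => cross_word hv₂ (x := z) (y := y) (j := i)
  simp only [List.length_append, List.length_singleton] at w₁ c₂
  have hi : insAt (L.length + 1) j = swapAt L.length (swapAt (L.length + 1) (insAt L.length j)) := by
    rw [swapAt_insAt_succ, swapAt_swapAt]
  have hi' : insAt L.length j = swapAt (L.length + 1) (swapAt (L.length + 1) (insAt L.length j)) := by
    rw [swapAt_swapAt]
  have hid : (L ++ [a, c, a.flip] ++ R)[swapAt (L.length + 1) (insAt L.length j)]? = some .down := by
    have := getElem?_swapAt (L := L ++ [a]) (R := R) c a.flip (insAt L.length j)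
    simp only [List.length_append, List.length_singleton] at this
    simp only [List.append_assoc, List.cons_append, List.nil_append] at this ⊢
    rw [this]
    have := getElem?_insAt (L := L) (R := c :: R) a a.flip j
    simp only [List.append_assoc, List.cons_append, List.nil_append] at this hj ⊢
    rw [this, hj]
  have hn := insAt_ne L.length j
  rw [w₁, w₂, hi]
  conv_rhs => rw [hi']
  have hne₁ : swapAt (L.length + 1) (insAt L.length j) ≠ L.length := by
    rw [Ne, swapAt_eq_iff, swapAt_of_lt (by omega)]
    exact hn.1
  have hne₂ : swapAt (L.length + 1) (insAt L.length j) ≠ L.length + 2 := by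
    rw [Ne, swapAt_eq_iff]
    simpa [swapAt] using hn.2
  generalize swapAt (L.length + 1) (insAt L.length j) = i at *
  have s₁ : swapAt L.length (L.length + 2) = L.length + 2 := swapAt_of_gt (by omega)
  have s₂ : swapAt L.length L.length = L.length + 1 := by simp [swapAt]
  have s₃ : swapAt (L.length + 1) L.length = L.length := swapAt_of_lt (by omega)
  have s₄ : swapAt (L.length + 1) (L.length + 2) = L.length + 1 := by simp [swapAt]
  have m₁ := cross_mate_swapAt (σ := σ) (a := a) (b := c) L.length x z
  have m₂ := cross_mate_swapAt (σ := σ) (a := c) (b := a.flip) (L.length + 1) z y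
  have s₅ : swapAt L.length (L.length + 1) = L.length := by simp [swapAt]
  have s₆ : swapAt (L.length + 1) (L.length + 1) = L.length + 2 := by simp [swapAt]
  have hc : ∀ i, i ≠ L.length → i ≠ L.length + 2 →
      crossLabel L.length x z i = crossLabel (L.length + 1) z y i := by
    intro i h₁ h₂
    simp only [crossLabel]
    split_ifs <;> first | rfl | omega
  have n₁ : ¬L.length = L.length + 1 + 1 := by omega
  have hc₁ : crossLabel L.length x z L.length = x := by simp [crossLabel]
  have hc₂ : crossLabel L.length x z (L.length + 2) = 1 := by simp [crossLabel]
  have hc₃ : crossLabel (L.length + 1) z y L.length = 1 := by simp [crossLabel, n₁]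
  have hc₄ : crossLabel (L.length + 1) z y (L.length + 2) = y := by simp [crossLabel]
  rw [m₁, m₂, c₁ i (by simpa using hid), c₂ i (by simpa using hid), hc i hne₁ hne₂]
  cases a
  · have hl : (L ++ [.up, c, Dir.up.flip] ++ R)[L.length + 2]? = some .down := by
      simp [Dir.flip]
    have d₁ := c₁ (L.length + 2) (by simpa using hl)
    have d₂ := c₂ (L.length + 2) (by simpa using hl)
    rw [s₁] at d₁
    rw [s₄] at d₂
    have hm := hv.mate_ne hid hl
    have hm' := hv.mate_ne hl hl
    simp only [upLeg, downLeg, swapAt_eq_iff, s₅, s₃]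
    split_ifs with h'
    · have e : σ.mate (L.length + 2) ≠ L.length := by
        intro h''
        exact hne₂ ((hv.mate_mate i).symm.trans (by
          have q := hv.mate_mate (L.length + 2)
          rw [h''] at q
          rw [h', q]))
      simp only [mulAlong] at h
      rw [d₁, d₂, h', hc₁, hc₂, hc₃, hc₄, hc _ e hm']
      simp only [mul_assoc, one_mul]
      rw [← mul_assoc x g, h, mul_assoc]
    · rw [hc _ h' hm]
  · have hl : (L ++ [.down, c, Dir.down.flip] ++ R)[L.length]? = some .down := by
      simp
    have d₁ := c₁ L.length (by simpa using hl)
    have d₂ := c₂ L.length (by simpa using hl)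
    rw [s₂] at d₁
    rw [s₃] at d₂
    have hm := hv.mate_ne hid hl
    have hm' := hv.mate_ne hl hl
    simp only [upLeg, downLeg, swapAt_eq_iff, s₁, s₆]
    split_ifs with h'
    · have e : σ.mate L.length ≠ L.length + 2 := by
        intro h''
        exact hne₁ ((hv.mate_mate i).symm.trans (by rw [h']; exact h'' ▸ hv.mate_mate L.length))
      simp only [mulAlong] at h
      rw [d₁, d₂, h', hc₁, hc₂, hc₃, hc₄, hc _ hm' e]
      simp only [mul_assoc, one_mul]
      rw [← mul_assoc g x, h, mul_assoc]
    · rw [hc _ hm h']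

/-- The two links differ at most in the labels at the ends of the arc created by the minimum, and
`h` compares the words of this arc. -/
theorem Link.cup_slide (hv : σ.Valid (L ++ [c] ++ R)) {x y z g : M}
    (h : mulAlong a g y = mulAlong a x g) :
    ((σ.cup (L.length + 1) a g).cross L.length c a z y).Same
      ((σ.cup L.length a g).cross (L.length + 1) a.flip c x z) (L ++ [a, c, a.flip] ++ R) := by
  have h₀ : σ.Valid ((L ++ [c]) ++ R) := by simpa using hv
  have h₁ := h₀.cup (a := a) g
  have h₂ := Valid.cross (σ := σ.cup (L ++ [c]).length a g) (L := L) (R := a.flip :: R) (a := c)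
    (b := a) (by simpa using h₁) z y
  simp only [List.length_append, List.length_singleton] at h₂
  have n₁ : ¬L.length = L.length + 1 + 1 := by omega
  have n₂ : ¬L.length + 1 + 1 = L.length := by omega
  have e : ∀ j, j ≠ L.length → j ≠ L.length + 2 → ∃ i, swapAt L.length (insAt (L.length + 1) i) = j := by
    intro j h₁ h₂
    obtain h | h | ⟨i, h⟩ := eq_or_insAt (L.length + 1) (swapAt L.length j)
    · rw [swapAt_eq_iff] at h
      simp [swapAt] at h
      omega
    · rw [swapAt_eq_iff] at h
      simp [swapAt] at h
      split_ifs at h <;> omega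
    · exact ⟨i, by rw [← h, swapAt_swapAt]⟩
  refine Same.of_pair (u := if a = .up then L.length else L.length + 2)
    (d := if a = .up then L.length + 2 else L.length) (by simpa using h₂) ?_ ?_ ?_ ?_ ?_
  · ext j
    by_cases hj : j = L.length
    · subst hj; simp [cross, cup, swapAt, n₁, n₂]
    by_cases hj' : j = L.length + 2
    · subst hj'; simp [cross, cup, swapAt, n₁]
    obtain ⟨i, rfl⟩ := e j hj hj'
    rw [cross_mate_swapAt, cup_mate_insAt, ← swapAt_insAt_succ, ← swapAt_insAt_succ,
      cross_mate_swapAt, cup_mate_insAt]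
  · cases a <;> simp [Dir.flip]
  · cases a <;> simp [cross, cup, swapAt, n₂]
  · intro j h₁ h₂
    obtain ⟨i, rfl⟩ := e j (by cases a <;> simp_all) (by cases a <;> simp_all)
    rw [cross_label_swapAt, ← swapAt_insAt_succ, cross_label_swapAt, cup_label_insAt,
      cup_label_insAt]
    have := insAt_ne L.length i
    have := insAt_ne (L.length + 1) i
    by_cases hi : i = L.length
    · subst hi
      rw [insAt_of_le le_rfl, insAt_of_lt (by omega)]
      simp
    · have := insAt_succ_of_ne hi
      rw [if_neg, if_neg, if_neg, if_neg]
      · omega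
      · unfold insAt; split_ifs <;> omega
      · omega
      · unfold insAt; split_ifs <;> omega
  · cases a <;> simp [cross, cup, upLeg, downLeg, mulAlong, Dir.flip, n₁] at h ⊢ <;> simp [h]

end

section Moves

variable {k A : Type*} [Field k] [Ring A] [Algebra k A]
  {dec : Bool → Dir → Dir → A ⊗[k] A} {tr : A →ₗ[k] k} {G : Aˣ} {Y : List Slice}
  {L R : List Dir} {σ : Link A}

theorem exists_lift_cross {g : Extremum → A} {a b : Dir} (hY : Composes (L ++ [b, a] ++ R) Y [])
    (hv : σ.Valid (L ++ [a, b] ++ R)) : ∃ F : A ⊗[k] A →ₗ[k] k, ∀ x y,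
      stateSum dec tr g Y (σ.cross L.length a b x y) = F (x ⊗ₜ y) := by
  obtain ⟨φ, hφ⟩ := exists_mulAlong (k := k) a (σ.label L.length)
  obtain ⟨ψ, hψ⟩ := exists_mulAlong (k := k) b (σ.label (L.length + 1))
  obtain ⟨F, hF⟩ := exists_lift_two (dec := dec) (tr := tr) (g := g) hY (hv.cross 1 1)
    (i := L.length + 1) (j := L.length) (by omega)
    (getElem?_right b a) (getElem?_left b a) φ ψ
  refine ⟨F, fun x y => ?_⟩
  rw [← hF, ← hφ, ← hψ]
  congr 1
  ext j
  · rfl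
  · simp only [cross, setLabel, Function.update_apply]
    split_ifs <;> rfl

/-- If the maximum closes a loop, the label moved past `g` has to be brought around the loop, which
takes the trace property. -/
theorem closing_slide {tr : A →ₗ[k] k} (htr : Tracelike tr) (g : Extremum → A) (l : ℕ) {a c : Dir}
    {x y z : A} (h : mulAlong a x (g (capType a)) = mulAlong a (g (capType a)) y) :
    closing tr g (.cap a) (l + 1) (σ.cross l a c x z) =
      closing tr g (.cap a) l (σ.cross (l + 1) c a.flip z y) := by
  have s₁ := swapAt_of_gt (l := l) (j := l + 1 + 1) (by omega)
  have s₂ : swapAt l (l + 1) = l := by simp [swapAt]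
  have s₃ := swapAt_of_lt (l := l + 1) (j := l) (by omega)
  have s₄ : swapAt (l + 1) (l + 1) = l + 1 + 1 := by simp [swapAt]
  have n₁ : l + 1 + 1 ≠ l := by omega
  have n₂ : l + 1 + 1 ≠ l + 1 := by omega
  have n₃ : l ≠ l + 1 := by omega
  have n₄ : l ≠ l + 1 + 1 := by omega
  have n₅ : l + 1 ≠ l := by omega
  cases a
  · simp only [closing, upLeg, downLeg, cross, swapAt_eq_iff, s₁, s₂, s₃, s₄]
    simp only [mulAlong, Dir.flip] at h ⊢
    congr 1
    simp only [n₁, n₂, n₃, n₄, n₅, if_true, if_false]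
    rw [mul_assoc, mul_assoc, h, mul_assoc y, mul_assoc y, htr y]
    simp only [mul_assoc]
  · simp only [closing, upLeg, downLeg, cross, swapAt_eq_iff, s₁, s₂, s₃, s₄]
    simp only [mulAlong, Dir.flip] at h ⊢
    congr 1
    simp only [n₁, n₂, n₃, n₄, n₅, if_true, if_false]
    simp only [mul_assoc]
    rw [htr x]
    simp only [mul_assoc, h]

theorem isUnit_extremumLabel (G : Aˣ) (e : Extremum) : IsUnit (extremumLabel G e) := by
  cases e <;> simp [extremumLabel]

theorem stateSum_slideMax (htr : Tracelike tr) (hdec : Relations dec G) (o : Bool) (a c : Dir)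
    (hv : σ.Valid (L ++ [a, c, a.flip] ++ R)) (hY : Composes (L ++ [c] ++ R) Y []) :
    stateSum dec tr (extremumLabel G) (⟨L, .cross o a c, a.flip :: R⟩ ::
      ⟨L ++ [c], .cap a, R⟩ :: Y) σ =
    stateSum dec tr (extremumLabel G) (⟨L ++ [a], .cross (!o) c a.flip, R⟩ ::
      ⟨L, .cap a, c :: R⟩ :: Y) σ := by
  rw [stateSum_cross, stateSum_cross]
  obtain ⟨g, hg⟩ := isUnit_extremumLabel G (capType a)
  have e : ∀ x : Dir, (L ++ [x]).length = L.length + 1 := by simp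
  have hv₁ : σ.Valid (L ++ [a, c] ++ (a.flip :: R)) := by simpa using hv
  have hv₂ : σ.Valid ((L ++ [a]) ++ [c, a.flip] ++ R) := by simpa using hv
  obtain ⟨F, hF⟩ := exists_lift_cross (dec := dec) (tr := tr) (g := extremumLabel G)
    (Y := ⟨L, .cap a, c :: R⟩ :: Y) ⟨by simp [Slice.dom, Piece.dom], by
      simpa [Slice.cod, Piece.cod] using hY⟩ hv₂
  have key : ∀ x y z : A, mulAlong a x (extremumLabel G (capType a)) =
      mulAlong a (extremumLabel G (capType a)) y →
      stateSum dec tr (extremumLabel G) (⟨L ++ [c], .cap a, R⟩ :: Y) (σ.cross L.length a c x z) =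
        F (z ⊗ₜ y) := by
    intro x y z h
    have h₁ : ((σ.cross L.length a c x z).cap (L ++ [c]).length a (extremumLabel G (capType a))).Valid
        ((L ++ [c]) ++ [] ++ R) :=
      Valid.act (σ := σ.cross L.length a c x z) (extremumLabel G) (.cap a) (1, 1)
        (by simpa [Piece.dom] using hv₁.cross x z)
    rw [← hF, stateSum_cap, stateSum_cap, e, e, closing_slide htr _ _ h]
    rw [(cap_slide hv h).stateSum_eq hY (by simpa using h₁)]
  -- The relation equates only sums, whereas `key` needs a partner `y` for every single label `x`.
  -- As `g` is invertible, `ψ` divides by it and provides one.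
  obtain ⟨ψ, hψ⟩ := exists_mulAlong (k := k) a (↑g⁻¹ : A)
  have hψ' : ∀ y, mulAlong a (g : A) (ψ y) = y := by
    intro y
    rw [← hψ]
    cases a <;> simp [mulAlong, mul_assoc]
  have hψ'' : ∀ y, ψ (mulAlong a (g : A) y) = y := by
    intro y
    rw [← hψ]
    cases a <;> simp [mulAlong, mul_assoc]
  have h := congrArg (F ∘ₗ (TensorProduct.comm k A A).toLinearMap ∘ₗ TensorProduct.map ψ .id)
    (hdec.slideMax o a c)
  simp only [map_sum, LinearMap.comp_apply, TensorProduct.map_tmul, LinearMap.id_apply,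
    LinearEquiv.coe_coe, TensorProduct.comm_tmul, ← hg, hψ''] at h
  simp only [hF]
  rw [(Finset.sum_congr rfl fun x _ => key _ _ _ ?_).trans h]
  rw [← hg, hψ']

theorem stateSum_slideMin (hdec : Relations dec G) (o : Bool) (a c : Dir)
    (hv : σ.Valid (L ++ [c] ++ R)) (hY : Composes (L ++ [a, c, a.flip] ++ R) Y []) :
    stateSum dec tr (extremumLabel G) (⟨L ++ [c], .cup a, R⟩ ::
      ⟨L, .cross o c a, a.flip :: R⟩ :: Y) σ =
    stateSum dec tr (extremumLabel G) (⟨L, .cup a, c :: R⟩ ::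
      ⟨L ++ [a], .cross (!o) a.flip c, R⟩ :: Y) σ := by
  rw [stateSum_cup, stateSum_cup, stateSum_cross, stateSum_cross]
  obtain ⟨g, hg⟩ := isUnit_extremumLabel G (cupType a)
  have e : ∀ x : Dir, (L ++ [x]).length = L.length + 1 := by simp
  have hv₁ := Valid.cup (σ := σ) (L := L ++ [c]) (R := R) (a := a) (by simpa using hv)
    (extremumLabel G (cupType a))
  have hv₂ := Valid.cup (σ := σ) (L := L) (R := c :: R) (a := a) (by simpa using hv)
    (extremumLabel G (cupType a))
  obtain ⟨F, hF⟩ := exists_lift_cross (dec := dec) (tr := tr) (g := extremumLabel G)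
    (L := L ++ [a]) (a := a.flip) (b := c) (R := R) (Y := Y) (by simpa using hY)
    (by simpa using hv₂)
  have key : ∀ x y z : A, mulAlong a (extremumLabel G (cupType a)) y =
      mulAlong a x (extremumLabel G (cupType a)) →
      stateSum dec tr (extremumLabel G) Y
        ((σ.cup (L.length + 1) a (extremumLabel G (cupType a))).cross L.length c a z y) =
        F (x ⊗ₜ z) := by
    intro x y z h
    have h₁ := Valid.cross (L := L) (R := a.flip :: R) (a := c) (b := a) (by simpa using hv₁) z y
    rw [← hF, e]
    exact (cup_slide hv h).stateSum_eq hY (by simpa using h₁)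
  obtain ⟨ψ, hψ⟩ := mulAlong_linear (k := k) a (↑g⁻¹ : A)
  have hψ' : ∀ y, mulAlong a (ψ y) (g : A) = y := by
    intro y
    rw [← hψ]
    cases a <;> simp [mulAlong, mul_assoc]
  have hψ'' : ∀ y, ψ (mulAlong a y (g : A)) = y := by
    intro y
    rw [← hψ]
    cases a <;> simp [mulAlong, mul_assoc]
  have h := congrArg (F ∘ₗ TensorProduct.map ψ .id) (hdec.slideMin o a c)
  simp only [map_sum, LinearMap.comp_apply, TensorProduct.map_tmul, LinearMap.id_apply,
    ← hg, hψ''] at h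
  simp only [hF, ← h]
  refine Finset.sum_congr rfl fun x _ => ?_
  rw [e]
  refine key _ _ _ ?_
  rw [← hg, hψ']

end Moves

/-! ### Moves inside a larger diagram. -/

open Link OrientedQuantumAlgebra

theorem composes_append {a c : List Dir} {X Y : List Slice} :
    Composes a (X ++ Y) c ↔ ∃ b, Composes a X b ∧ Composes b Y c := by
  induction X generalizing a with
  | nil => simp [Composes]
  | cons s X ih => simp [Composes, ih, and_assoc]

section Moves

variable {k A : Type*} [Field k] [Ring A] [Algebra k A]
  {dec : Bool → Dir → Dir → A ⊗[k] A} {tr : A →ₗ[k] k} {G : Aˣ} {X X' Y Y' : List Slice}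
  {l r lv lv' : List Dir} {σ : Link A}

theorem stateSum_localMove (htr : Tracelike tr) (hdec : Relations dec G) (h : LocalMove X X')
    (hv : σ.Valid lv) (hX : Composes lv (X.map (Slice.whisker l r) ++ Y) []) :
    stateSum dec tr (extremumLabel G) (X.map (Slice.whisker l r) ++ Y) σ =
      stateSum dec tr (extremumLabel G) (X'.map (Slice.whisker l r) ++ Y) σ := by
  cases h with
  | interchange p q m =>
    obtain ⟨rfl, -⟩ := hX
    have := stateSum_interchange (dec := dec) (L := l) (R := r) (Y := Y) (σ := σ) htr
      (extremumLabel G) p q m (by simpa [Slice.dom, Slice.whisker] using hv)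
    simpa [Slice.whisker] using this
  | maxMin a =>
    obtain ⟨rfl, h⟩ := hX
    obtain ⟨-, h⟩ := h
    have := stateSum_maxMin (dec := dec) (tr := tr) (G := G) (L := l) (R := r) (Y := Y) (σ := σ) a
      (by simpa [Slice.dom, Slice.whisker, Piece.dom] using hv)
      (by simpa [Slice.cod, Slice.whisker, Piece.cod] using h)
    simpa [Slice.whisker] using this
  | minMax a =>
    obtain ⟨rfl, h⟩ := hX
    obtain ⟨-, h⟩ := h
    have := stateSum_minMax (dec := dec) (tr := tr) (G := G) (L := l) (R := r) (Y := Y) (σ := σ) a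
      (by simpa [Slice.dom, Slice.whisker, Piece.dom] using hv)
      (by simpa [Slice.cod, Slice.whisker, Piece.cod, Dir.flip_flip] using h)
    simpa [Slice.whisker] using this
  | cancel o a b =>
    obtain ⟨rfl, h⟩ := hX
    obtain ⟨-, h⟩ := h
    have := stateSum_cancel (tr := tr) hdec (L := l) (R := r) (Y := Y) (σ := σ) (extremumLabel G)
      o a b (by simpa [Slice.dom, Slice.whisker, Piece.dom] using hv)
      (by simpa [Slice.cod, Slice.whisker, Piece.cod] using h)
    simpa [Slice.whisker] using this
  | triangle o a b c =>
    obtain ⟨rfl, h⟩ := hX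
    obtain ⟨-, h⟩ := h
    obtain ⟨-, h⟩ := h
    have := stateSum_triangle (tr := tr) hdec (L := l) (R := r) (Y := Y) (σ := σ) (extremumLabel G)
      o a b c (by simpa [Slice.dom, Slice.whisker, Piece.dom] using hv)
      (by simpa [Slice.cod, Slice.whisker, Piece.cod] using h)
    simpa [Slice.whisker] using this
  | slideMax o a c =>
    obtain ⟨rfl, h⟩ := hX
    obtain ⟨-, h⟩ := h
    have := stateSum_slideMax (dec := dec) (tr := tr) (L := l) (R := r) (Y := Y) (σ := σ) htr hdec
      o a c (by simpa [Slice.dom, Slice.whisker, Piece.dom] using hv)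
      (by simpa [Slice.cod, Slice.whisker, Piece.cod] using h)
    simpa [Slice.whisker] using this
  | slideMin o a c =>
    obtain ⟨rfl, h⟩ := hX
    obtain ⟨-, h⟩ := h
    have := stateSum_slideMin (tr := tr) (L := l) (R := r) (Y := Y) (σ := σ) hdec
      o a c (by simpa [Slice.dom, Slice.whisker, Piece.dom] using hv)
      (by simpa [Slice.cod, Slice.whisker, Piece.cod] using h)
    simpa [Slice.whisker] using this

theorem stateSum_append_congr {g : Extremum → A} (hX : Composes lv X lv')
    (h : ∀ σ : Link A, σ.Valid lv' → stateSum dec tr g Y σ = stateSum dec tr g Y' σ)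
    (hv : σ.Valid lv) : stateSum dec tr g (X ++ Y) σ = stateSum dec tr g (X ++ Y') σ := by
  induction X generalizing lv σ with
  | nil =>
    obtain rfl : lv = lv' := hX
    exact h σ hv
  | cons s X ih =>
    obtain ⟨rfl, hX⟩ := hX
    refine Finset.sum_congr rfl fun x _ => ?_
    congr 1
    exact ih hX (hv.act _ _ _)

end Moves

namespace Link

/-- The link without lines. -/
def empty (M : Type*) [One M] : Link M := ⟨id, fun _ => 1⟩

theorem empty_valid (M : Type*) [One M] : (empty M).Valid [] := ⟨fun _ => rfl, by simp⟩

end Link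

theorem stateSum_move {k A : Type*} [Field k] [Ring A] [Algebra k A]
    {dec : Bool → Dir → Dir → A ⊗[k] A} {tr : A →ₗ[k] k} {G : Aˣ} (htr : Tracelike tr)
    (hdec : Relations dec G) {K K' : Diagram} (hK : Composes [] K.slices [])
    (h : K.Move K') :
    stateSum dec tr (extremumLabel G) K.slices (empty A) =
      stateSum dec tr (extremumLabel G) K'.slices (empty A) := by
  obtain ⟨b, l, r, X, Y, L, R, h⟩ := h
  simp only [List.append_assoc] at hK ⊢
  obtain ⟨lv, h₁, h₂⟩ := composes_append.1 hK
  exact stateSum_append_congr h₁ (fun σ hv => stateSum_localMove htr hdec h hv h₂) (empty_valid A)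


/-! ### Standard pairs: the consequences of the axioms in terms of `θ = t_d ∘ t_u`. -/

open Link OrientedQuantumAlgebra

section Tensor

variable {k A : Type*} [Field k] [Ring A] [Algebra k A]

/-- The properties of `r = ρ` and `ri = ρ⁻¹` for an oriented quantum algebra `(A, ρ, 1, θ)`. -/
structure StandardPair (r ri : A ⊗[k] A) (θ : A ≃ₐ[k] A) : Prop where
  mul_inv : r * ri = 1
  inv_mul : ri * r = 1
  map_map : TensorProduct.map θ.toLinearMap θ.toLinearMap r = r
  left_mul : secondOp k A (TensorProduct.map θ.toLinearMap .id ri) * secondOp k A r = 1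
  mul_left : secondOp k A r * secondOp k A (TensorProduct.map θ.toLinearMap .id ri) = 1
  right_mul : secondOp k A (TensorProduct.map .id θ.toLinearMap r) * secondOp k A ri = 1
  mul_right : secondOp k A ri * secondOp k A (TensorProduct.map .id θ.toLinearMap r) = 1
  braid : leg12 k A r * leg13 k A r * leg23 k A r = leg23 k A r * leg13 k A r * leg12 k A r

theorem secondOp_injective : Function.Injective (secondOp k A) :=
  (TensorProduct.congr (LinearEquiv.refl k A) (MulOpposite.opLinearEquiv k)).injective

/-- Exchanging the factors of `A ⊗ A` is an anti-automorphism when seen in `A ⊗ Aᵐᵒᵖ`; it carries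
inverse pairs to inverse pairs with the order of the factors reversed. -/
theorem exists_secondOp_comm : ∃ J : A ⊗[k] Aᵐᵒᵖ →ₗ[k] A ⊗[k] Aᵐᵒᵖ,
    (∀ x, secondOp k A (TensorProduct.comm k A A x) = J (secondOp k A x)) ∧ J 1 = 1 ∧
    ∀ x y, J (x * y) = J y * J x := by
  refine ⟨TensorProduct.map (MulOpposite.opLinearEquiv k).symm.toLinearMap
    (MulOpposite.opLinearEquiv k).toLinearMap ∘ₗ
      (Algebra.TensorProduct.comm k A Aᵐᵒᵖ).toLinearMap, fun x => ?_, ?_, fun x y => ?_⟩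
  · induction x using TensorProduct.induction_on with
    | zero => simp
    | add x y hx hy => simp only [map_add, hx, hy]
    | tmul a b => simp [secondOp]
  · simp [Algebra.TensorProduct.one_def]
  · simp only [LinearMap.comp_apply, AlgEquiv.toLinearMap_apply, map_mul]
    exact map_antimul _ _ (fun _ _ => rfl) (fun _ _ => rfl) _ _

/-- The homomorphism is the reversal of the three tensor factors. -/
theorem exists_reverse_legs : ∃ f : (A ⊗[k] A) ⊗[k] A →ₐ[k] (A ⊗[k] A) ⊗[k] A, ∀ x,
    leg12 k A (TensorProduct.comm k A A x) = f (leg23 k A x) ∧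
    leg13 k A (TensorProduct.comm k A A x) = f (leg13 k A x) ∧
    leg23 k A (TensorProduct.comm k A A x) = f (leg12 k A x) := by
  refine ⟨((Algebra.TensorProduct.assoc k k k A A A).trans
    ((Algebra.TensorProduct.comm k A (A ⊗[k] A)).trans (Algebra.TensorProduct.congr
      (Algebra.TensorProduct.comm k A A) AlgEquiv.refl))).toAlgHom, fun x => ?_⟩
  induction x using TensorProduct.induction_on with
  | zero => simp
  | add x y hx hy => simp only [map_add, hx, hy, and_self]
  | tmul a b => simp [leg12, leg13, leg23]

theorem comm_mul (x y : A ⊗[k] A) : TensorProduct.comm k A A (x * y) =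
    TensorProduct.comm k A A x * TensorProduct.comm k A A y :=
  map_mul (Algebra.TensorProduct.comm k A A) x y

theorem map_comm' (f g : A →ₗ[k] A) (x : A ⊗[k] A) :
    TensorProduct.map f g (TensorProduct.comm k A A x) =
      TensorProduct.comm k A A (TensorProduct.map g f x) := by
  induction x using TensorProduct.induction_on with
  | zero => simp
  | add x y hx hy => simp only [map_add, hx, hy]
  | tmul a b => simp

/-- For `p`, `q`, `s` the legs `12`, `13`, `23` of `ρ`, these are the forms which the Yang–Baxter
equation takes when lines of the triangle change direction and some of the decorations are inverted.
-/
theorem units_braid {M : Type*} [Monoid M] (p q s : Mˣ) (h : (p * q * s : M) = s * q * p) :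
    (s⁻¹ * q⁻¹ * p⁻¹ : Mˣ) = p⁻¹ * q⁻¹ * s⁻¹ ∧ q⁻¹ * p⁻¹ * s = s * p⁻¹ * q⁻¹ ∧
    p * s⁻¹ * q⁻¹ = q⁻¹ * s⁻¹ * p ∧ q * p * s⁻¹ = s⁻¹ * p * q := by
  have h : p * q * s = s * q * p := Units.ext h
  refine ⟨?_, ?_, ?_, ?_⟩
  · rw [← mul_inv_rev, ← mul_inv_rev, ← mul_inv_rev, ← mul_inv_rev, ← mul_assoc, ← mul_assoc, h]
  · calc q⁻¹ * p⁻¹ * s = q⁻¹ * p⁻¹ * (s * q * p) * p⁻¹ * q⁻¹ := by group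
      _ = s * p⁻¹ * q⁻¹ := by rw [← h]; group
  · calc p * s⁻¹ * q⁻¹ = q⁻¹ * s⁻¹ * (s * q * p) * s⁻¹ * q⁻¹ := by group
      _ = q⁻¹ * s⁻¹ * p := by rw [← h]; group
  · calc q * p * s⁻¹ = s⁻¹ * (s * q * p) * s⁻¹ := by group
      _ = s⁻¹ * p * q := by rw [← h]; group

theorem StandardPair.inv_braid {r ri : A ⊗[k] A} {θ : A ≃ₐ[k] A} (h : StandardPair r ri θ) :
    leg23 k A ri * leg13 k A ri * leg12 k A ri = leg12 k A ri * leg13 k A ri * leg23 k A ri ∧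
    leg13 k A ri * leg12 k A ri * leg23 k A r = leg23 k A r * leg12 k A ri * leg13 k A ri ∧
    leg12 k A r * leg23 k A ri * leg13 k A ri = leg13 k A ri * leg23 k A ri * leg12 k A r ∧
    leg13 k A r * leg12 k A r * leg23 k A ri = leg23 k A ri * leg12 k A r * leg13 k A r := by
  let u : (A ⊗[k] A)ˣ := ⟨r, ri, h.mul_inv, h.inv_mul⟩
  obtain ⟨h₁, h₂, h₃, h₄⟩ := units_braid (Units.map (leg12 k A).toMonoidHom u)
    (Units.map (leg13 k A).toMonoidHom u) (Units.map (leg23 k A).toMonoidHom u) h.braid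
  exact ⟨congrArg Units.val h₁, congrArg Units.val h₂, congrArg Units.val h₃,
    congrArg Units.val h₄⟩

theorem StandardPair.map_map_inv {r ri : A ⊗[k] A} {θ : A ≃ₐ[k] A} (h : StandardPair r ri θ) :
    TensorProduct.map θ.toLinearMap θ.toLinearMap ri = ri := by
  let T : A ⊗[k] A →ₐ[k] A ⊗[k] A := Algebra.TensorProduct.map θ.toAlgHom θ.toAlgHom
  have hT : T r = r := h.map_map
  have h₁ : r * T ri = 1 := by
    conv_lhs => rw [← hT]
    rw [← map_mul, h.mul_inv, map_one]
  calc T ri = ri * (r * T ri) := by rw [← mul_assoc, h.inv_mul, one_mul]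
    _ = ri := by rw [h₁, mul_one]

/-- This is the exchange of over and under lines at all crossings; it reduces each move to one
choice of `o`. -/
theorem StandardPair.mirror {r ri : A ⊗[k] A} {θ : A ≃ₐ[k] A} (h : StandardPair r ri θ) :
    StandardPair (TensorProduct.comm k A A ri) (TensorProduct.comm k A A r) θ := by
  obtain ⟨J, hJ, hJ₁, hJm⟩ := exists_secondOp_comm (k := k) (A := A)
  obtain ⟨f, hf⟩ := exists_reverse_legs (k := k) (A := A)
  have h₁ : TensorProduct.comm k A A 1 = 1 := map_one (Algebra.TensorProduct.comm k A A)
  constructor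
  · rw [← comm_mul, h.inv_mul, h₁]
  · rw [← comm_mul, h.mul_inv, h₁]
  · rw [map_comm', h.map_map_inv]
  · rw [map_comm', hJ, hJ, ← hJm, h.mul_right, hJ₁]
  · rw [map_comm', hJ, hJ, ← hJm, h.right_mul, hJ₁]
  · rw [map_comm', hJ, hJ, ← hJm, h.mul_left, hJ₁]
  · rw [map_comm', hJ, hJ, ← hJm, h.left_mul, hJ₁]
  · simp only [(hf _).1, (hf _).2.1, (hf _).2.2, ← map_mul, h.inv_braid.1]

/-- The axiom for `A_s` says that `(1 ⊗ θ)(ρ)` and `ρ⁻¹` are inverse in `A ⊗ Aᵐᵒᵖ`. Applying `θ ⊗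
1`, and using `(θ ⊗ θ)(ρ) = ρ`, gives the same for `ρ` and `(θ ⊗ 1)(ρ⁻¹)`. -/
theorem OrientedQuantumAlgebra.standardPair (Q : OrientedQuantumAlgebra k A) :
    StandardPair (Q.rho : A ⊗[k] A) (↑Q.rho⁻¹ : A ⊗[k] A) (Q.tu.trans Q.td) := by
  have e : ∀ x : A ⊗[k] A, TensorProduct.map Q.standard.td.toLinearMap LinearMap.id x = x := by
    intro x
    induction x using TensorProduct.induction_on with
    | zero => simp
    | add x y hx hy => simp only [map_add, hx, hy]
    | tmul a b => simp [standard]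
  have h₁ := Q.standard.qa1.1
  have h₂ := Q.standard.qa1.2
  rw [e] at h₁ h₂
  have hm := Q.standard.qa2_tu
  simp only [standard] at h₁ h₂ hm
  let F : A ⊗[k] Aᵐᵒᵖ →ₐ[k] A ⊗[k] Aᵐᵒᵖ :=
      Algebra.TensorProduct.map (Q.tu.trans Q.td).toAlgHom (AlgHom.id k Aᵐᵒᵖ)
  have hF : ∀ x, F (secondOp k A x) =
      secondOp k A (TensorProduct.map (Q.tu.trans Q.td).toLinearMap LinearMap.id x) := by
    intro x
    induction x using TensorProduct.induction_on with
    | zero => simp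
    | add x₁ x₂ h₁ h₂ => simp only [map_add, h₁, h₂]
    | tmul a b => simp [F, secondOp]
  have e' : ∀ x : A ⊗[k] A, TensorProduct.map (Q.tu.trans Q.td).toLinearMap LinearMap.id
      (TensorProduct.map LinearMap.id (Q.tu.trans Q.td).toLinearMap x) =
      TensorProduct.map (Q.tu.trans Q.td).toLinearMap (Q.tu.trans Q.td).toLinearMap x := by
    intro x
    rw [← LinearMap.comp_apply, ← TensorProduct.map_comp]
    rfl
  have h₃ := congrArg F h₁
  have h₄ := congrArg F h₂
  simp only [map_mul, map_one, hF, e', hm] at h₃ h₄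
  exact ⟨Q.rho.mul_inv, Q.rho.inv_mul, hm, h₄, h₃, h₁, h₂, Q.qa3⟩

end Tensor

/-! ### The braid relation for all orientations of the three lines. -/

open Link OrientedQuantumAlgebra

section Tensor

variable {k A : Type*} [Field k] [Ring A] [Algebra k A]

/-- The decoration of a crossing, with the line `/` first, in terms of a standard pair. -/
noncomputable def pairDecoration (r ri : A ⊗[k] A) (θ : A ≃ₐ[k] A) : Dir → Dir → A ⊗[k] A
  | .up, .up => r
  | .down, .down => r
  | .up, .down => TensorProduct.map θ.toLinearMap .id ri
  | .down, .up => ri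

variable {r ri : A ⊗[k] A} {θ : A ≃ₐ[k] A}

/-- Two crossings between the same lines compose factorwise, each factor in the order in which its
line is traversed. Parallel lines give a product in `A ⊗ A`, antiparallel ones a product in `A ⊗
Aᵐᵒᵖ`, and turning both lines round reverses it. -/
theorem mulAlong_sum {ι κ : Type*} {s : Finset ι} {t : Finset κ} {f : ι → A × A} {f' : κ → A × A}
    {X Y : A ⊗[k] A} (hX : ∑ x ∈ s, (f x).1 ⊗ₜ (f x).2 = X) (hY : ∑ y ∈ t, (f' y).1 ⊗ₜ (f' y).2 = Y) :
    ∑ x ∈ s, ∑ y ∈ t, (mulAlong .up (f x).1 (f' y).1 ⊗ₜ[k] mulAlong .up (f x).2 (f' y).2) = X * Y ∧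
    ∑ x ∈ s, ∑ y ∈ t, (mulAlong .down (f x).1 (f' y).1 ⊗ₜ[k] mulAlong .down (f x).2 (f' y).2) =
      Y * X ∧
    secondOp k A
      (∑ x ∈ s, ∑ y ∈ t, (mulAlong .up (f x).1 (f' y).1 ⊗ₜ[k] mulAlong .down (f x).2 (f' y).2)) =
        secondOp k A X * secondOp k A Y ∧
    secondOp k A
      (∑ x ∈ s, ∑ y ∈ t, (mulAlong .down (f x).1 (f' y).1 ⊗ₜ[k] mulAlong .up (f x).2 (f' y).2)) =
        secondOp k A Y * secondOp k A X := by
  subst hX hY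
  refine ⟨?_, ?_, ?_, ?_⟩
  · simp [Finset.sum_mul, Finset.mul_sum, mulAlong]
    rw [Finset.sum_comm]
  · simp [Finset.sum_mul, Finset.mul_sum, mulAlong]
  · simp [Finset.sum_mul, Finset.mul_sum, mulAlong, secondOp]
    rw [Finset.sum_comm]
  · simp [Finset.sum_mul, Finset.mul_sum, mulAlong, secondOp]

section Middle

variable {B : Type*} [Ring B] [Algebra k B] (e : A ≃ₗ[k] B)

/-- The map `A ⊗ A ⊗ A → A ⊗ B ⊗ A` induced by a map `A → B`. -/
noncomputable def mapMiddle : (A ⊗[k] A) ⊗[k] A →ₗ[k] (A ⊗[k] B) ⊗[k] A :=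
  TensorProduct.map (TensorProduct.map .id e.toLinearMap) .id

theorem mapMiddle_injective : Function.Injective (mapMiddle e) :=
  (TensorProduct.congr (TensorProduct.congr (LinearEquiv.refl k A) e)
    (LinearEquiv.refl k A)).injective

variable {e}

/-- The legs `12` and `23` meet only in the middle factor, where `e` reverses products. So they
change places, while each keeps its order relative to the leg `13`. -/
theorem mapMiddle_mul (he : ∀ x y, e (x * y) = e y * e x) (x y z : A ⊗[k] A) :
    (mapMiddle e (leg13 k A y) * mapMiddle e (leg23 k A z) * mapMiddle e (leg12 k A x) =
      mapMiddle e (leg13 k A y * leg12 k A x * leg23 k A z)) ∧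
    mapMiddle e (leg12 k A x) * mapMiddle e (leg23 k A z) * mapMiddle e (leg13 k A y) =
      mapMiddle e (leg23 k A z * leg12 k A x * leg13 k A y) := by
  have he₁ : e 1 = 1 := by
    have := he 1 (e.symm 1)
    simpa using this.symm
  induction x using TensorProduct.induction_on with
  | zero => simp
  | add x y hx hy => simp only [map_add, mul_add, add_mul, hx, hy, and_self]
  | tmul a b =>
  induction y using TensorProduct.induction_on with
  | zero => simp
  | add x y hx hy => simp only [map_add, mul_add, add_mul, hx, hy, and_self]
  | tmul c d =>
  induction z using TensorProduct.induction_on with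
  | zero => simp
  | add x y hx hy => simp only [map_add, mul_add, add_mul, hx, hy, and_self]
  | tmul f g => simp [leg12, leg13, leg23, mapMiddle, he, he₁]

theorem mapMiddle_leg12_mul {x y : A ⊗[k] A} (h : TensorProduct.map .id e.toLinearMap x *
    TensorProduct.map .id e.toLinearMap y = 1) :
    mapMiddle e (leg12 k A x) * mapMiddle e (leg12 k A y) = 1 := by
  have : ∀ x, mapMiddle e (leg12 k A x) = TensorProduct.map .id e.toLinearMap x ⊗ₜ 1 :=
    fun x => rfl
  rw [this, this, Algebra.TensorProduct.tmul_mul_tmul, h, mul_one, ← Algebra.TensorProduct.one_def]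

/-- With the middle factor replaced by `B`, the leg `12` of `s` is inverse to that of `x`, so the
relation `h` is multiplied by it on both sides. -/
theorem mapMiddle_braid (he : ∀ x y, e (x * y) = e y * e x) {s x y z : A ⊗[k] A}
    (h₁ : TensorProduct.map .id e.toLinearMap s * TensorProduct.map .id e.toLinearMap x = 1)
    (h₂ : TensorProduct.map .id e.toLinearMap x * TensorProduct.map .id e.toLinearMap s = 1)
    (h : leg13 k A y * leg12 k A x * leg23 k A z = leg23 k A z * leg12 k A x * leg13 k A y) :
    mapMiddle e (leg12 k A s) * mapMiddle e (leg13 k A y) * mapMiddle e (leg23 k A z) =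
      mapMiddle e (leg23 k A z) * mapMiddle e (leg13 k A y) * mapMiddle e (leg12 k A s) := by
  have h₁ := mapMiddle_leg12_mul h₁
  have h₂ := mapMiddle_leg12_mul h₂
  have h₃ := congrArg (mapMiddle e) h
  rw [← (mapMiddle_mul he _ _ _).1, ← (mapMiddle_mul he _ _ _).2] at h₃
  generalize mapMiddle e (leg12 k A s) = s at *
  generalize mapMiddle e (leg13 k A y) = y at *
  generalize mapMiddle e (leg23 k A z) = z at *
  generalize mapMiddle e (leg12 k A x) = x at *
  calc s * y * z = s * (y * z * x) * s := by simp only [mul_assoc, h₂, mul_one]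
    _ = z * y * s := by rw [h₃, ← mul_assoc, ← mul_assoc, h₁, one_mul]

theorem sum_middle (he : ∀ x y, e (x * y) = e y * e x) {ι κ μ : Type*} {s : Finset ι}
    {t : Finset κ} {u : Finset μ} {f : ι → A × A} {f' : κ → A × A} {f'' : μ → A × A}
    {X Y Z : A ⊗[k] A} (hX : ∑ x ∈ s, (f x).1 ⊗ₜ (f x).2 = X)
    (hY : ∑ y ∈ t, (f' y).1 ⊗ₜ (f' y).2 = Y) (hZ : ∑ z ∈ u, (f'' z).1 ⊗ₜ (f'' z).2 = Z) :
    mapMiddle e (∑ x ∈ s, ∑ y ∈ t, ∑ z ∈ u, (((f x).1 * (f' y).1) ⊗ₜ[k] ((f'' z).1 * (f x).2)) ⊗ₜ[k]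
      ((f' y).2 * (f'' z).2)) =
      mapMiddle e (leg12 k A X) * mapMiddle e (leg13 k A Y) * mapMiddle e (leg23 k A Z) ∧
    mapMiddle e (∑ x ∈ s, ∑ y ∈ t, ∑ z ∈ u, (((f' y).1 * (f x).1) ⊗ₜ[k] ((f x).2 * (f'' z).1)) ⊗ₜ[k]
      ((f'' z).2 * (f' y).2)) =
      mapMiddle e (leg23 k A Z) * mapMiddle e (leg13 k A Y) * mapMiddle e (leg12 k A X) := by
  have he₁ : e 1 = 1 := by
    have := he 1 (e.symm 1)
    simpa using this.symm
  have h₁ : ∀ x y z : A × A, mapMiddle e (((x.1 * y.1) ⊗ₜ[k] (z.1 * x.2)) ⊗ₜ[k] (y.2 * z.2)) =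
    mapMiddle e (leg12 k A (x.1 ⊗ₜ x.2)) * mapMiddle e (leg13 k A (y.1 ⊗ₜ y.2)) *
      mapMiddle e (leg23 k A (z.1 ⊗ₜ z.2)) := by
    intro x y z
    simp [leg12, leg13, leg23, mapMiddle, he, he₁]
  have h₂ : ∀ x y z : A × A, mapMiddle e (((y.1 * x.1) ⊗ₜ[k] (x.2 * z.1)) ⊗ₜ[k] (z.2 * y.2)) =
    mapMiddle e (leg23 k A (z.1 ⊗ₜ z.2)) * mapMiddle e (leg13 k A (y.1 ⊗ₜ y.2)) *
      mapMiddle e (leg12 k A (x.1 ⊗ₜ x.2)) := by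
    intro x y z
    simp [leg12, leg13, leg23, mapMiddle, he, he₁]
  simp only [map_sum, h₁, h₂, ← Finset.mul_sum, ← Finset.sum_mul]
  simp only [← map_sum, hX, hY, hZ, and_self]

end Middle

theorem StandardPair.sum_middle (h : StandardPair r ri θ) {ι κ μ : Type*} {s : Finset ι}
    {t : Finset κ} {u : Finset μ} {f : ι → A × A} {f' : κ → A × A} {f'' : μ → A × A}
    (hX : ∑ x ∈ s, (f x).1 ⊗ₜ (f x).2 = TensorProduct.map θ.toLinearMap .id ri)
    (hY : ∑ y ∈ t, (f' y).1 ⊗ₜ (f' y).2 = r) (hZ : ∑ z ∈ u, (f'' z).1 ⊗ₜ (f'' z).2 = ri) :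
    ∑ x ∈ s, ∑ y ∈ t, ∑ z ∈ u, (((f x).1 * (f' y).1) ⊗ₜ[k] ((f'' z).1 * (f x).2)) ⊗ₜ[k]
      ((f' y).2 * (f'' z).2) =
    ∑ x ∈ s, ∑ y ∈ t, ∑ z ∈ u, (((f' y).1 * (f x).1) ⊗ₜ[k] ((f x).2 * (f'' z).1)) ⊗ₜ[k]
      ((f'' z).2 * (f' y).2) := by
  have he : ∀ x y : A, MulOpposite.opLinearEquiv k (x * y) =
    MulOpposite.opLinearEquiv k y * MulOpposite.opLinearEquiv k x := fun _ _ => rfl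
  apply mapMiddle_injective (MulOpposite.opLinearEquiv k)
  rw [(OQ.sum_middle he hX hY hZ).1, (OQ.sum_middle he hX hY hZ).2]
  exact mapMiddle_braid he h.left_mul h.mul_left h.inv_braid.2.2.2

/-- The list in `hT` names the orders of the three legs that are allowed; each is linear in every
argument, so the sums over representatives collapse. -/
theorem sum_legs {ι κ μ : Type*} {s : Finset ι}
    {t : Finset κ} {u : Finset μ} {f : ι → A × A} {f' : κ → A × A} {f'' : μ → A × A}
    {X Y Z : A ⊗[k] A} (hX : ∑ x ∈ s, (f x).1 ⊗ₜ (f x).2 = X)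
    (hY : ∑ y ∈ t, (f' y).1 ⊗ₜ (f' y).2 = Y) (hZ : ∑ z ∈ u, (f'' z).1 ⊗ₜ (f'' z).2 = Z)
    (T : A ⊗[k] A → A ⊗[k] A → A ⊗[k] A → (A ⊗[k] A) ⊗[k] A)
    (hT : T = (fun x y z => leg12 k A x * leg13 k A y * leg23 k A z) ∨
      T = (fun x y z => leg23 k A z * leg13 k A y * leg12 k A x) ∨
      T = (fun x y z => leg13 k A y * leg12 k A x * leg23 k A z) ∨
      T = (fun x y z => leg23 k A z * leg12 k A x * leg13 k A y) ∨
      T = (fun x y z => leg12 k A x * leg23 k A z * leg13 k A y) ∨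
      T = (fun x y z => leg13 k A y * leg23 k A z * leg12 k A x)) :
    ∑ x ∈ s, ∑ y ∈ t, ∑ z ∈ u, T ((f x).1 ⊗ₜ (f x).2) ((f' y).1 ⊗ₜ (f' y).2)
      ((f'' z).1 ⊗ₜ (f'' z).2) = T X Y Z := by
  subst hX hY hZ
  obtain rfl | rfl | rfl | rfl | rfl | rfl := hT <;>
    simp only [map_sum, ← Finset.mul_sum, ← Finset.sum_mul]

/-- Tensors which satisfy the third Reidemeister move for the directions `a`, `b`, `c`. -/
def Braid (a b c : Dir) (X Y Z : A ⊗[k] A) : Prop :=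
  ∀ (s t u : Finset (A × A)) (f f' f'' : A × A → A × A), ∑ x ∈ s, (f x).1 ⊗ₜ (f x).2 = X →
    ∑ y ∈ t, (f' y).1 ⊗ₜ (f' y).2 = Y → ∑ z ∈ u, (f'' z).1 ⊗ₜ (f'' z).2 = Z →
    ∑ x ∈ s, ∑ y ∈ t, ∑ z ∈ u, (mulAlong a (f x).1 (f' y).1 ⊗ₜ[k] mulAlong b (f x).2 (f'' z).1) ⊗ₜ[k]
      mulAlong c (f' y).2 (f'' z).2 =
    ∑ x ∈ s, ∑ y ∈ t, ∑ z ∈ u, (mulAlong a (f' y).1 (f x).1 ⊗ₜ[k] mulAlong b (f'' z).1 (f x).2) ⊗ₜ[k]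
      mulAlong c (f'' z).2 (f' y).2

/-- Turning round all three lines reverses all products, which exchanges the two sides. -/
theorem Braid.flip {a b c : Dir} {X Y Z : A ⊗[k] A} (h : Braid a b c X Y Z) :
    Braid a.flip b.flip c.flip X Y Z := by
  intro s t u f f' f'' hX hY hZ
  have := h s t u f f' f'' hX hY hZ
  cases a <;> cases b <;> cases c <;> exact this.symm

/-- One automorphism acts along each of the three lines. This is how a relation is carried over to
decorations that differ by powers of `θ`. -/
theorem Braid.map {a b c : Dir} {X Y Z : A ⊗[k] A} (h : Braid a b c X Y Z) (f g i : A ≃ₐ[k] A) :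
    Braid a b c (TensorProduct.map f.toLinearMap g.toLinearMap X)
      (TensorProduct.map f.toLinearMap i.toLinearMap Y)
      (TensorProduct.map g.toLinearMap i.toLinearMap Z) := by
  have hm : ∀ (f : A ≃ₐ[k] A) (d : Dir) (x y : A), mulAlong d (f x) (f y) = f (mulAlong d x y) := by
    intro f d x y
    cases d <;> simp [mulAlong]
  have hs : ∀ (s : Finset (A × A)) (p : A × A → A × A) (W : A ⊗[k] A) (f g : A ≃ₐ[k] A),
      ∑ x ∈ s, (p x).1 ⊗ₜ (p x).2 = TensorProduct.map f.toLinearMap g.toLinearMap W →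
      ∑ x ∈ s, (f.symm (p x).1) ⊗ₜ (g.symm (p x).2) = W := by
    intro s p W f g h
    have := congrArg (TensorProduct.map f.symm.toLinearMap g.symm.toLinearMap) h
    rw [← LinearMap.comp_apply, ← TensorProduct.map_comp] at this
    have e : ∀ f : A ≃ₐ[k] A, f.symm.toLinearMap ∘ₗ f.toLinearMap = LinearMap.id := by
      intro f; ext; simp
    simpa [e] using this
  intro s t u p p' p'' hX hY hZ
  have := h s t u (fun x => (f.symm (p x).1, g.symm (p x).2))
    (fun x => (f.symm (p' x).1, i.symm (p' x).2)) (fun x => (g.symm (p'' x).1, i.symm (p'' x).2))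
    (hs _ _ _ _ _ hX) (hs _ _ _ _ _ hY) (hs _ _ _ _ _ hZ)
  have := congrArg (TensorProduct.map (TensorProduct.map f.toLinearMap g.toLinearMap)
    i.toLinearMap) this
  simpa [hm] using this

/-- In the first three cases some order of the legs in `A ⊗ A ⊗ A` realises the directions of all
three lines. If only the middle line is down, the conditions are cyclic: leg `12` before `13`, `13`
before `23`, and `23` before `12`. The relation then lives in `A ⊗ Aᵐᵒᵖ ⊗ A`. -/
theorem StandardPair.braid_up (h : StandardPair r ri θ) :
    Braid .up .up .up r r r ∧ Braid .down .up .up ri ri r ∧ Braid .down .down .up r ri ri ∧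
      Braid .up .down .up (TensorProduct.map θ.toLinearMap .id ri) r ri := by
  refine ⟨?_, ?_, ?_, ?_⟩ <;> intro s t u f f' f'' hX hY hZ
  · convert h.braid using 1
    · rw [← sum_legs hX hY hZ _ (.inl rfl)]
      simp [leg12, leg13, leg23, mulAlong]
    · rw [← sum_legs hX hY hZ _ (.inr (.inl rfl))]
      simp [leg12, leg13, leg23, mulAlong]
  · convert h.inv_braid.2.1 using 1
    · rw [← sum_legs hX hY hZ _ (.inr (.inr (.inl rfl)))]
      simp [leg12, leg13, leg23, mulAlong]
    · rw [← sum_legs hX hY hZ _ (.inr (.inr (.inr (.inl rfl))))]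
      simp [leg12, leg13, leg23, mulAlong]
  · convert h.inv_braid.2.2.1.symm using 1
    · rw [← sum_legs hX hY hZ _ (.inr (.inr (.inr (.inr (.inr rfl)))))]
      simp [leg12, leg13, leg23, mulAlong]
    · rw [← sum_legs hX hY hZ _ (.inr (.inr (.inr (.inr (.inl rfl)))))]
      simp [leg12, leg13, leg23, mulAlong]
  · exact h.sum_middle hX hY hZ

/-- The four cases with the third line down arise from those of `braid_up` by turning round all
lines and, in three of them, correcting by `θ` along one line. -/
theorem StandardPair.braid_all (h : StandardPair r ri θ) (a b c : Dir) :
    Braid a b c (pairDecoration r ri θ a b) (pairDecoration r ri θ a c)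
      (pairDecoration r ri θ b c) := by
  obtain ⟨h₁, h₂, h₃, h₄⟩ := h.braid_up
  have e : (AlgEquiv.refl : A ≃ₐ[k] A).toLinearMap = LinearMap.id := by ext; simp
  have e₁ : ∀ x : A ⊗[k] A, TensorProduct.map (.id : A →ₗ[k] A) (.id : A →ₗ[k] A) x = x := by simp
  have e₂ : TensorProduct.map .id θ.symm.toLinearMap ri =
      TensorProduct.map θ.toLinearMap .id ri := by
    conv_lhs => rw [← h.map_map_inv]
    rw [← LinearMap.comp_apply, ← TensorProduct.map_comp]
    congr 2
    ext; simp
  have e₃ : TensorProduct.map .id θ.toLinearMap (TensorProduct.map θ.toLinearMap .id ri) = ri := by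
    conv_rhs => rw [← h.map_map_inv]
    rw [← LinearMap.comp_apply, ← TensorProduct.map_comp]
    rfl
  cases a <;> cases b <;> cases c
  · exact h₁
  · simpa [e, e₂, pairDecoration, Dir.flip] using h₃.flip.map .refl .refl θ.symm
  · exact h₄
  · simpa [e, pairDecoration, Dir.flip] using h₂.flip.map θ .refl .refl
  · exact h₂
  · simpa [e, e₃, pairDecoration, Dir.flip] using h₄.flip.map .refl θ .refl
  · exact h₃
  · exact h₁.flip

end Tensor

/-! ### The decorations of the standard algebra satisfy the relations. -/

open Link OrientedQuantumAlgebra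

section Tensor

variable {k A : Type*} [Field k] [Ring A] [Algebra k A]

theorem sum_slash (dec : Bool → Dir → Dir → A ⊗[k] A) (o : Bool) (a b : Dir) :
    ∑ x ∈ terms (dec o a b), slash o x ⊗ₜ[k] backslash o x =
      if o then dec o a b else TensorProduct.comm k A A (dec o a b) := by
  have := sum_terms (dec o a b)
  cases o
  · simp only [slash, backslash, Bool.false_eq_true, if_false]
    conv_rhs => rw [this]
    simp
  · simp only [slash, backslash, if_true]
    exact this.symm

theorem sum_backslash (dec : Bool → Dir → Dir → A ⊗[k] A) (o : Bool) (a b : Dir) :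
    ∑ x ∈ terms (dec o a b), backslash o x ⊗ₜ[k] slash o x =
      if o then TensorProduct.comm k A A (dec o a b) else dec o a b := by
  have := sum_terms (dec o a b)
  cases o
  · simp only [slash, backslash, Bool.false_eq_true, if_false]
    exact this.symm
  · simp only [slash, backslash, if_true]
    conv_rhs => rw [this]
    simp

/-- The pair is `ρ`, `ρ⁻¹` if the line `/` is over, and its mirror image if it is under. With the
line `/` written first, decorations have the same form for both values of `o`, and the crossings of
the other kind belong to the mirror pair. -/
theorem exists_standardPair (Q : OrientedQuantumAlgebra k A) (o : Bool) :
    ∃ r ri, StandardPair (r : A ⊗[k] A) ri (Q.tu.trans Q.td) ∧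
    (∀ a b, ∑ x ∈ terms (Q.standard.decoration o a b), slash o x ⊗ₜ[k] backslash o x =
      pairDecoration r ri (Q.tu.trans Q.td) a b) ∧
    (∀ a b, ∑ x ∈ terms (Q.standard.decoration o a b), backslash o x ⊗ₜ[k] slash o x =
      TensorProduct.comm k A A (pairDecoration r ri (Q.tu.trans Q.td) a b)) ∧
    (∀ a b, ∑ x ∈ terms (Q.standard.decoration (!o) a b), slash (!o) x ⊗ₜ[k] backslash (!o) x =
      pairDecoration (TensorProduct.comm k A A ri) (TensorProduct.comm k A A r)
        (Q.tu.trans Q.td) a b) ∧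
    (∀ a b, ∑ x ∈ terms (Q.standard.decoration (!o) a b), backslash (!o) x ⊗ₜ[k] slash (!o) x =
      TensorProduct.comm k A A (pairDecoration (TensorProduct.comm k A A ri)
        (TensorProduct.comm k A A r) (Q.tu.trans Q.td) a b)) := by
  have e : (AlgEquiv.refl : A ≃ₐ[k] A).toLinearMap = LinearMap.id := by ext; simp
  have hc : ∀ x : A ⊗[k] A, TensorProduct.comm k A A (TensorProduct.comm k A A x) = x :=
    fun x => by
      induction x using TensorProduct.induction_on with
      | zero => simp
      | add x y hx hy => simp only [map_add, hx, hy]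
      | tmul a b => simp
  have h₁ : ∀ a b, Q.standard.decoration true a b =
      pairDecoration (Q.rho : A ⊗[k] A) (↑Q.rho⁻¹ : A ⊗[k] A) (Q.tu.trans Q.td) a b := by
    intro a b
    cases a <;> cases b <;> simp [decoration, standard, pairDecoration, e]
  have h₂ : ∀ a b, TensorProduct.comm k A A (Q.standard.decoration false a b) =
      pairDecoration (TensorProduct.comm k A A (↑Q.rho⁻¹ : A ⊗[k] A))
        (TensorProduct.comm k A A (Q.rho : A ⊗[k] A)) (Q.tu.trans Q.td) a b := by
    intro a b
    cases a <;> cases b <;> simp [decoration, standard, pairDecoration, e, map_comm']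
  cases o
  · refine ⟨_, _, Q.standardPair.mirror, ?_, ?_, ?_, ?_⟩
    · intro a b
      simp [sum_slash, h₂]
    · intro a b
      simp [sum_backslash, ← h₂, hc]
    · intro a b
      rw [sum_slash, hc, hc]
      simpa using h₁ a b
    · intro a b
      rw [sum_backslash, hc, hc]
      simp [h₁]
  · refine ⟨_, _, Q.standardPair, ?_, ?_, ?_, ?_⟩
    · intro a b
      rw [sum_slash, if_pos rfl, h₁]
    · intro a b
      rw [sum_backslash, if_pos rfl, h₁]
    · intro a b
      simp [sum_slash, h₂]
    · intro a b
      simp [sum_backslash, ← h₂, hc]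

/-- The second move is invertibility in `A ⊗ A` for parallel lines and in `A ⊗ Aᵐᵒᵖ` for
antiparallel ones. At an extremum labelled `G` or `G⁻¹`, moving a label past it costs `θ`; the
decorations before and after the slide differ by just this, in view of `(θ ⊗ θ)(ρ) = ρ`. At extrema
labelled `1` they agree. -/
theorem relations_standard (Q : OrientedQuantumAlgebra k A) (G : Aˣ)
    (hG : ∀ x : A, Q.td (Q.tu x) = (G : A) * x * (↑G⁻¹ : A)) :
    Relations Q.standard.decoration G := by
  have hc : ∀ x : A ⊗[k] A, TensorProduct.comm k A A (TensorProduct.comm k A A x) = x :=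
    fun x => by
      induction x using TensorProduct.induction_on with
      | zero => simp
      | add x y hx hy => simp only [map_add, hx, hy]
      | tmul a b => simp
  constructor
  · intro o a b
    obtain ⟨r, ri, h, h₁, h₂, h₃, h₄⟩ := exists_standardPair Q o
    have hm := mulAlong_sum (f := fun x => (slash o x, backslash o x))
      (f' := fun x => (backslash (!o) x, slash (!o) x)) (h₁ a b) (h₄ b a)
    rw [← Algebra.TensorProduct.one_def]
    have hs : secondOp k A 1 = 1 := by simp [secondOp, Algebra.TensorProduct.one_def]
    cases a <;> cases b <;> simp only [pairDecoration, hc, map_comm'] at hm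
    · exact hm.1.trans h.mul_inv
    · exact secondOp_injective ((hm.2.2.1.trans h.left_mul).trans hs.symm)
    · exact secondOp_injective ((hm.2.2.2.trans h.right_mul).trans hs.symm)
    · exact hm.2.1.trans h.inv_mul
  · intro o a b c
    obtain ⟨r, ri, h, h₁, h₂, h₃, h₄⟩ := exists_standardPair Q o
    exact h.braid_all a b c _ _ _ (fun x => (slash o x, backslash o x))
      (fun x => (slash o x, backslash o x)) (fun x => (slash o x, backslash o x))
      (h₁ a b) (h₁ a c) (h₁ b c)
  · intro o a c
    obtain ⟨r, ri, h, h₁, h₂, h₃, h₄⟩ := exists_standardPair Q o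
    obtain ⟨φ, hφ⟩ := mulAlong_linear (k := k) a (extremumLabel G (capType a))
    obtain ⟨ψ, hψ⟩ := exists_mulAlong (k := k) a (extremumLabel G (capType a))
    have k₁ := congrArg (TensorProduct.map φ .id) (h₁ a c)
    have k₄ := congrArg (TensorProduct.map ψ .id) (h₄ c a.flip)
    simp only [map_sum, TensorProduct.map_tmul, ← hφ, ← hψ, LinearMap.id_apply] at k₁ k₄
    rw [k₁, k₄]
    cases a
    -- Here `φ` multiplies by `G` on the right and `ψ` on the left, and `θ x * G = G * x`.
    · have e : φ ∘ₗ (Q.tu.trans Q.td).toLinearMap = ψ := by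
        ext x
        simp [← hφ, ← hψ, mulAlong, capType, extremumLabel, hG]
      cases c <;> simp only [pairDecoration, Dir.flip, hc, map_comm']
      · conv_lhs => rw [← h.map_map]
        simp only [← LinearMap.comp_apply, ← TensorProduct.map_comp, e, LinearMap.id_comp,
          LinearMap.comp_id]
      · simp only [← LinearMap.comp_apply, ← TensorProduct.map_comp, e, LinearMap.id_comp]
    · have e : φ = ψ := by
        ext x
        simp [← hφ, ← hψ, mulAlong, capType, extremumLabel]
      cases c <;> simp only [pairDecoration, Dir.flip, hc, e]
  · intro o a c
    obtain ⟨r, ri, h, h₁, h₂, h₃, h₄⟩ := exists_standardPair Q o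
    obtain ⟨φ, hφ⟩ := mulAlong_linear (k := k) a (extremumLabel G (cupType a))
    obtain ⟨ψ, hψ⟩ := exists_mulAlong (k := k) a (extremumLabel G (cupType a))
    have k₂ := congrArg (TensorProduct.map ψ .id) (h₂ c a)
    have k₃ := congrArg (TensorProduct.map φ .id) (h₃ a.flip c)
    simp only [map_sum, TensorProduct.map_tmul, ← hφ, ← hψ, LinearMap.id_apply] at k₂ k₃
    rw [k₂, k₃]
    cases a
    · have e : φ = ψ := by
        ext x
        simp [← hφ, ← hψ, mulAlong, cupType, extremumLabel]
      cases c <;> simp only [pairDecoration, Dir.flip, e]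
    · have e : φ ∘ₗ (Q.tu.trans Q.td).toLinearMap = ψ := by
        ext x
        simp [← hφ, ← hψ, mulAlong, cupType, extremumLabel, hG, mul_assoc]
      cases c <;> simp only [pairDecoration, Dir.flip]
      · conv_rhs => rw [← h.mirror.map_map]
        rw [← map_comm']
        simp only [← LinearMap.comp_apply, ← TensorProduct.map_comp, e, LinearMap.id_comp,
          LinearMap.comp_id]
      · simp only [← LinearMap.comp_apply, ← TensorProduct.map_comp, e, LinearMap.id_comp]

end Tensor

/-! ### Trails, and the traversal of a knot diagram. -/

namespace Diagram

/-- `w` lists the points on the way from one point to another, each with what is met just after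
it. -/
inductive Trail (D : Diagram) :
    ℕ × ℕ → List ((ℕ × ℕ) × Option (Encounter D.slices.length)) → ℕ × ℕ → Prop
  | nil (p : ℕ × ℕ) : Trail D p [] p
  | cons {p q r : ℕ × ℕ} {e : Option (Encounter D.slices.length)}
      {w : List ((ℕ × ℕ) × Option (Encounter D.slices.length))}
      (h : D.visit p = some (e, q)) (hw : Trail D q w r) : Trail D p ((p, e) :: w) r

variable {D : Diagram} {p q r : ℕ × ℕ}
  {w v : List ((ℕ × ℕ) × Option (Encounter D.slices.length))}

theorem Trail.append (h : D.Trail p w q) (h' : D.Trail q v r) : D.Trail p (w ++ v) r := by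
  induction h with
  | nil => exact h'
  | cons h _ ih => exact .cons h (ih h')

theorem Trail.single {e : Option (Encounter D.slices.length)} (h : D.visit p = some (e, q)) :
    D.Trail p [(p, e)] q := .cons h (.nil q)

theorem Trail.walk_add (h : D.Trail p w q) (m : ℕ) :
    D.walk (w.length + m) p = w ++ D.walk m q := by
  induction h with
  | nil => simp
  | cons h _ ih =>
    rw [List.length_cons, Nat.add_right_comm, Diagram.walk, h]
    simp [ih]

theorem Trail.walk_length (h : D.Trail p w q) : D.walk w.length p = w := by
  simpa [Diagram.walk] using h.walk_add 0

theorem exists_trail_of_mem_walk {m : ℕ} (h : q ∈ (D.walk m p).map Prod.fst) :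
    ∃ w m', D.Trail p w q ∧ m = w.length + (m' + 1) := by
  induction m generalizing p with
  | zero => simp [walk] at h
  | succ m ih =>
    rw [walk] at h
    split at h
    · simp only [List.map_cons, List.map_nil, List.mem_singleton] at h
      exact ⟨[], m, h ▸ .nil _, by simp⟩
    · rename_i e q' hv
      simp only [List.map_cons, List.mem_cons] at h
      obtain rfl | h := h
      · exact ⟨[], m, .nil _, by simp⟩
      · obtain ⟨w, m', hw, rfl⟩ := ih h
        exact ⟨_, m', .cons hv hw, by simp; omega⟩

theorem Trail.of_mem (h : D.Trail p w r) (hq : q ∈ w.map Prod.fst) :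
    ∃ u v, w = u ++ v ∧ v ≠ [] ∧ D.Trail p u q ∧ D.Trail q v r := by
  induction h with
  | nil => simp at hq
  | @cons p q' r e w h hw ih =>
    simp only [List.map_cons, List.mem_cons] at hq
    obtain rfl | hq := hq
    · exact ⟨[], _, rfl, by simp, .nil _, .cons h hw⟩
    · obtain ⟨u, v, rfl, h₁, h₂, h₃⟩ := ih hq
      exact ⟨(p, e) :: u, v, rfl, h₁, .cons h h₂, h₃⟩

theorem Trail.mem_of_ne_nil (h : D.Trail p w r) (hw : w ≠ []) : p ∈ w.map Prod.fst := by
  cases h with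
  | nil => simp at hw
  | cons => simp

/-- A closed trail meets all points which can be reached from it. -/
theorem Trail.mem_of_closed (h : D.Trail p w p) (hw : w ≠ []) (hq : q ∈ w.map Prod.fst)
    (hv : D.Trail q v r) : r ∈ w.map Prod.fst := by
  induction hv with
  | nil => exact hq
  | cons h₁ _ ih =>
    apply ih
    obtain ⟨u, v, rfl, hv, -, h₂⟩ := h.of_mem hq
    cases h₂ with
    | nil => simp at hv
    | @cons _ q' _ e w h₂ h₃ =>
      obtain ⟨-, rfl⟩ := Prod.mk.inj (Option.some.inj (h₁.symm.trans h₂))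
      by_cases hw : w = []
      · subst hw
        cases h₃
        exact h.mem_of_ne_nil (by simp)
      · have := h₃.mem_of_ne_nil hw
        simp only [List.map_append, List.map_cons, List.mem_append, List.mem_cons]
        exact .inr (.inr this)

theorem Covers.mem_of_closed (hD : D.Covers p) (h : D.Trail p w p) (hw : w ≠ []) (hq : D.HasPoint q) :
    q ∈ w.map Prod.fst := by
  obtain ⟨v, -, hv, -⟩ := exists_trail_of_mem_walk (hD q hq)
  exact h.mem_of_closed hw (h.mem_of_ne_nil hw) hv

theorem hasPoint_of_visit {x : Option (Encounter D.slices.length) × (ℕ × ℕ)}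
    (h : D.visit p = some x) : D.HasPoint p := by
  rw [HasPoint]
  cases hd : D.dirAt p with
  | none => simp [visit, hd] at h
  | some => rfl

theorem Trail.hasPoint (h : D.Trail p w r) (hq : q ∈ w.map Prod.fst) : D.HasPoint q := by
  obtain ⟨u, v, -, hv, -, h⟩ := h.of_mem hq
  cases h with
  | nil => simp at hv
  | cons h => exact hasPoint_of_visit h

/-- The points of a diagram. -/
def points (D : Diagram) : Finset (ℕ × ℕ) :=
  ((Finset.range D.levels.length).sigma fun i => Finset.range (D.levels.getD i []).length).map
    (Equiv.sigmaEquivProd ℕ ℕ).toEmbedding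

theorem mem_points : p ∈ D.points ↔ D.HasPoint p := by
  obtain ⟨i, j⟩ := p
  simp only [points, HasPoint, dirAt, Finset.mem_map, Finset.mem_sigma, Finset.mem_range]
  constructor
  · rintro ⟨⟨i', j'⟩, ⟨h₁, h₂⟩, h₃⟩
    obtain ⟨rfl, rfl⟩ := Prod.mk.inj h₃
    simpa using h₂
  · intro h
    have h₂ : j < (D.levels.getD i []).length := by simpa using h
    refine ⟨⟨i, j⟩, ⟨?_, h₂⟩, rfl⟩
    by_contra h₁
    rw [List.getD_eq_default _ _ (by simpa using h₁)] at h₂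
    simp at h₂

theorem card_points : D.points.card = D.numPoints := by
  rw [points, Finset.card_map, Finset.card_sigma, numPoints]
  generalize D.levels = l
  induction l with
  | nil => simp
  | cons a l ih =>
    rw [List.length_cons, Finset.sum_range_succ']
    simp only [Finset.card_range, List.getD_cons_succ, List.getD_cons_zero, List.map_cons,
      List.sum_cons] at ih ⊢
    rw [ih, add_comm]

/-- A closed trail in a knot diagram runs through all points. Together with `Trail.length_le` this
pins down the length of one full traversal as `numPoints`. -/
theorem IsKnot.numPoints_le (hD : D.IsKnot) (h : D.Trail p w p) (hw : w ≠ []) :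
    D.numPoints ≤ w.length := by
  have hp := h.hasPoint (h.mem_of_ne_nil hw)
  rw [← card_points, ← List.length_map (f := Prod.fst)]
  refine le_trans (Finset.card_le_card fun q hq => ?_) (List.toFinset_card_le _)
  rw [List.mem_toFinset]
  exact (hD.2.2.2 p hp).mem_of_closed h hw (mem_points.1 hq)

/-- The next point is determined by the present one, so a trail that repeats a point runs around a
cycle and can reach no point outside it. -/
theorem Trail.nodup_of_notMem (h : D.Trail p w r) (hr : r ∉ w.map Prod.fst) :
    (w.map Prod.fst).Nodup := by
  induction h with
  | nil => simp
  | @cons p q r e w h hw ih =>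
    rw [List.map_cons, List.nodup_cons]
    refine ⟨fun hp => ?_, ih fun h => hr (by simp [h])⟩
    obtain ⟨u, v, rfl, -, h₁, h₂⟩ := hw.of_mem hp
    have := (Trail.cons h h₁).mem_of_closed (by simp) (by simp) h₂
    refine hr ?_
    simp only [List.map_cons, List.map_append, List.mem_cons, List.mem_append] at this ⊢
    tauto

theorem Trail.nodup (h : D.Trail p w p) (hp : p ∉ w.tail.map Prod.fst) :
    (w.map Prod.fst).Nodup := by
  cases h with
  | nil => simp
  | cons h hw =>
    rw [List.map_cons, List.nodup_cons]
    exact ⟨hp, hw.nodup_of_notMem hp⟩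

theorem Trail.length_le (h : D.Trail p w p) (hp : p ∉ w.tail.map Prod.fst) :
    w.length ≤ D.numPoints := by
  rw [← card_points, ← List.length_map (f := Prod.fst), ← List.toFinset_card_of_nodup (h.nodup hp)]
  exact Finset.card_le_card fun q hq => mem_points.2 (h.hasPoint (List.mem_toFinset.1 hq))

/-- The traversal of a knot diagram from a point, followed by that from the beginning to that
point. -/
theorem IsKnot.walk_rotate (hD : D.IsKnot) (h : D.Trail p w p) (hw : w ≠ [])
    (hp : w.length ≤ D.numPoints) (hq : D.HasPoint q) : ∃ u v, w = u ++ v ∧ D.Trail p u q ∧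
      D.Trail q v p ∧ D.walk D.numPoints p = u ++ v ∧ D.walk D.numPoints q = v ++ u := by
  have hl := le_antisymm hp (hD.numPoints_le h hw)
  obtain ⟨u, v, rfl, -, h₁, h₂⟩ := h.of_mem
    ((hD.2.2.2 p (h.hasPoint (h.mem_of_ne_nil hw))).mem_of_closed h hw hq)
  refine ⟨u, v, rfl, h₁, h₂, ?_, ?_⟩
  · rw [← hl, h.walk_length]
  · rw [← hl, List.length_append, add_comm, ← List.length_append, (h₂.append h₁).walk_length]

end Diagram


/-! ### Links describe the arcs of a diagram below a level. -/

open Link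

namespace Diagram

variable {D : Diagram} {i j l : ℕ} {s : Slice} {M : Type*} [Monoid M]

theorem levels_of_composes {c : List Dir} (hD : Composes D.bottom D.slices c)
    (hs : D.slices[i]? = some s) :
    D.levels.getD i [] = s.dom ∧ D.levels.getD (i + 1) [] = s.cod := by
  obtain ⟨b, Y⟩ := D
  simp only [levels] at *
  induction Y generalizing b i with
  | nil => simp at hs
  | cons t Y ih =>
    obtain ⟨rfl, hY⟩ := hD
    cases i with
    | zero =>
      obtain rfl : t = s := by simpa using hs
      simp
    | succ i => exact ih _ hY (by simpa using hs)

theorem dirAt_dom {c : List Dir} (hD : Composes D.bottom D.slices c)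
    (hs : D.slices[i]? = some s) (j : ℕ) : D.dirAt (i, j) = s.dom[j]? := by
  rw [dirAt, (levels_of_composes hD hs).1]

theorem dirAt_cod {c : List Dir} (hD : Composes D.bottom D.slices c)
    (hs : D.slices[i]? = some s) (j : ℕ) : D.dirAt (i + 1, j) = s.cod[j]? := by
  rw [dirAt, (levels_of_composes hD hs).2]

/-- The value of what is met just after a point, if the over line and the under line of the crossing
in the slice `c` have the values given by `F c` and the extrema have the values given by `g`. -/
def bead {n : ℕ} (g : Extremum → M) (F : ℕ → M × M) : Option (Encounter n) → M
  | none => 1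
  | some (.over c) => (F c).1
  | some (.under c) => (F c).2
  | some (.extremum x) => g x

variable {g : Extremum → M} {F : ℕ → M × M} {L R : List Dir} {a b : Dir} {o : Bool} {c : List Dir}

theorem visit_up (hD : Composes D.bottom D.slices c) (hs : D.slices[i]? = some s)
    (hd : s.dom[j]? = some .up) : ∃ h : i < D.slices.length, D.visit (i, j) =
      some ((s.pass ⟨i, h⟩ .up j).2.2,
        (if (s.pass ⟨i, h⟩ .up j).1 = .up then i + 1 else i, (s.pass ⟨i, h⟩ .up j).2.1)) := by
  have hd' := dirAt_dom hD hs j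
  rw [hd] at hd'
  obtain ⟨h, rfl⟩ := List.getElem?_eq_some_iff.1 hs
  refine ⟨h, ?_⟩
  simp [visit, hd', h]

theorem visit_down (hD : Composes D.bottom D.slices c) (hs : D.slices[i]? = some s)
    (hd : s.cod[j]? = some .down) : ∃ h : i < D.slices.length, D.visit (i + 1, j) =
      some ((s.pass ⟨i, h⟩ .down j).2.2,
        (if (s.pass ⟨i, h⟩ .down j).1 = .up then i + 1 else i, (s.pass ⟨i, h⟩ .down j).2.1)) := by
  have hd' := dirAt_cod hD hs j
  rw [hd] at hd'
  obtain ⟨h, rfl⟩ := List.getElem?_eq_some_iff.1 hs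
  refine ⟨h, ?_⟩
  simp [visit, hd', h]

theorem visit_cross_up (hD : Composes D.bottom D.slices c)
    (hs : D.slices[i]? = some ⟨L, .cross o a b, R⟩) (hd : (L ++ [a, b] ++ R)[j]? = some .up) :
    ∃ e, D.visit (i, j) = some (e, (i + 1, swapAt L.length j)) ∧
      ∀ F : ℕ → M × M, bead g F e =
        crossLabel L.length (slash o (F i)) (backslash o (F i)) j := by
  obtain ⟨h, e⟩ := visit_up hD hs (j := j) hd
  refine ⟨_, e.trans (congrArg some (Prod.ext rfl ?_)), fun F => ?_⟩ <;>
    simp only [Slice.pass, crossLabel, swapAt] <;> split_ifs <;>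
    cases o <;> simp_all [bead, slash, backslash, Encounter.line]

theorem visit_cross_down (hD : Composes D.bottom D.slices c)
    (hs : D.slices[i]? = some ⟨L, .cross o a b, R⟩) (hd : (L ++ [a, b] ++ R)[j]? = some .down) :
    ∃ e, D.visit (i + 1, swapAt L.length j) = some (e, (i, j)) ∧
      ∀ F : ℕ → M × M, bead g F e =
        crossLabel L.length (slash o (F i)) (backslash o (F i)) j := by
  rw [← getElem?_swapAt] at hd
  obtain ⟨h, e⟩ := visit_down hD hs hd
  have hp : (⟨L, .cross o a b, R⟩ : Slice).pass ⟨i, h⟩ .down (swapAt L.length j) =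
      (.down, j, if j = L.length then some (.line ⟨i, h⟩ o)
        else if j = L.length + 1 then some (.line ⟨i, h⟩ !o) else none) := by
    simp only [Slice.pass, swapAt]
    split_ifs <;> first | omega | simp_all
  rw [hp] at e
  refine ⟨_, e, fun F => ?_⟩
  simp only [crossLabel]
  split_ifs <;> cases o <;> simp [bead, slash, backslash, Encounter.line]

theorem visit_cup_up (hD : Composes D.bottom D.slices c)
    (hs : D.slices[i]? = some ⟨L, .cup a, R⟩) (hd : (L ++ R)[j]? = some .up) :
    D.visit (i, j) = some (none, (i + 1, insAt L.length j)) := by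
  obtain ⟨h, e⟩ := visit_up hD hs (j := j) (by simpa [Slice.dom, Piece.dom] using hd)
  rw [e]
  simp only [Slice.pass, insAt]
  split_ifs <;> simp_all

theorem visit_cup_down (hD : Composes D.bottom D.slices c)
    (hs : D.slices[i]? = some ⟨L, .cup a, R⟩) (hd : (L ++ R)[j]? = some .down) :
    D.visit (i + 1, insAt L.length j) = some (none, (i, j)) := by
  obtain ⟨h, e⟩ := visit_down hD hs (j := insAt L.length j) (by
    simp only [Slice.cod, Piece.cod, getElem?_insAt]
    simpa using hd)
  rw [e]
  simp only [Slice.pass, insAt]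
  split_ifs <;> first | omega | (simp; done) | simp_all

theorem visit_cup_leg (hD : Composes D.bottom D.slices c)
    (hs : D.slices[i]? = some ⟨L, .cup a, R⟩) :
    D.visit (i + 1, downLeg L.length a) =
      some (some (.extremum (cupType a)), (i + 1, upLeg L.length a)) := by
  obtain ⟨h, e⟩ := visit_down hD hs (j := downLeg L.length a) (getElem?_downLeg a)
  rw [e]
  cases a <;> simp [Slice.pass, upLeg, downLeg, cupType]

theorem visit_cap_up (hD : Composes D.bottom D.slices c)
    (hs : D.slices[i]? = some ⟨L, .cap a, R⟩) (hd : (L ++ R)[j]? = some .up) :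
    D.visit (i, insAt L.length j) = some (none, (i + 1, j)) := by
  obtain ⟨h, e⟩ := visit_up hD hs (j := insAt L.length j) (by
    simp only [Slice.dom, Piece.dom, getElem?_insAt]
    simpa using hd)
  rw [e]
  simp only [Slice.pass, insAt]
  split_ifs <;> first | omega | (simp; done) | simp_all

theorem visit_cap_down (hD : Composes D.bottom D.slices c)
    (hs : D.slices[i]? = some ⟨L, .cap a, R⟩) (hd : (L ++ R)[j]? = some .down) :
    D.visit (i + 1, j) = some (none, (i, insAt L.length j)) := by
  obtain ⟨h, e⟩ := visit_down hD hs (j := j) (by simpa [Slice.cod, Piece.cod] using hd)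
  rw [e]
  simp only [Slice.pass, insAt]
  split_ifs <;> simp_all

theorem visit_cap_leg (hD : Composes D.bottom D.slices c)
    (hs : D.slices[i]? = some ⟨L, .cap a, R⟩) :
    D.visit (i, upLeg L.length a) =
      some (some (.extremum (capType a)), (i, downLeg L.length a)) := by
  obtain ⟨h, e⟩ := visit_up hD hs (j := upLeg L.length a) (getElem?_upLeg a)
  rw [e]
  cases a <;> simp [Slice.pass, upLeg, downLeg, capType]

/-- The product of the values along a trail. -/
def beads {n : ℕ} (g : Extremum → M) (F : ℕ → M × M)
    (w : List ((ℕ × ℕ) × Option (Encounter n))) : M := (w.map fun x => bead g F x.2).prod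

theorem beads_cons {n : ℕ} (g : Extremum → M) (F : ℕ → M × M) (x : (ℕ × ℕ) × Option (Encounter n))
    (w : List ((ℕ × ℕ) × Option (Encounter n))) :
    beads g F (x :: w) = bead g F x.2 * beads g F w := by
  simp [beads]

theorem beads_append {n : ℕ} (g : Extremum → M) (F : ℕ → M × M)
    (w v : List ((ℕ × ℕ) × Option (Encounter n))) :
    beads g F (w ++ v) = beads g F w * beads g F v := by
  simp [beads]

/-- The link describes the part of the diagram below level `i`. -/
structure Describes (D : Diagram) (g : Extremum → M) (F : ℕ → M × M) (i : ℕ) (lv : List Dir)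
    (σ : Link M) : Prop where
  valid : σ.Valid lv
  trail : ∀ j, lv[j]? = some .down → ∃ w, D.Trail (i, j) w (i, σ.mate j) ∧
    beads g F w = σ.word j ∧ ∀ x ∈ w.tail, x.1.1 < i

theorem Trail.lt_of_tail {q : ℕ × ℕ} {w : List ((ℕ × ℕ) × Option (Encounter D.slices.length))}
    (hw : D.Trail (i, j) w q) (hl : ∀ x ∈ w.tail, x.1.1 < i) : ∀ x ∈ w, x.1.1 < i + 1 := by
  intro x hx
  cases hw with
  | nil => simp at hx
  | cons h hw =>
    obtain rfl | hx := List.mem_cons.1 hx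
    · simp
    · have := hl x (by simpa using hx)
      omega

/-- Extend a trail by a point before its beginning and by one after its end. -/
theorem Trail.extend {p p' q' : ℕ × ℕ} {e e' : Option (Encounter D.slices.length)}
    {w : List ((ℕ × ℕ) × Option (Encounter D.slices.length))} (hw : D.Trail p w (i, j))
    (h : D.visit p' = some (e, p)) (h' : D.visit (i, j) = some (e', q'))
    (hl : ∀ x ∈ w, x.1.1 < i + 1) :
    D.Trail p' ((p', e) :: (w ++ [((i, j), e')])) q' ∧
      (beads g F ((p', e) :: (w ++ [((i, j), e')])) = bead g F e * beads g F w * bead g F e') ∧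
      ∀ x ∈ ((p', e) :: (w ++ [((i, j), e')])).tail, x.1.1 < i + 1 := by
  refine ⟨.cons h (hw.append (.single h')), ?_, fun x hx => ?_⟩
  · simp [beads, mul_assoc]
  · simp only [List.tail_cons, List.mem_append, List.mem_singleton] at hx
    obtain hx | rfl := hx
    · exact hl x hx
    · simp

/-- An arc below the upper level is an arc below the lower one prolonged at both ends, or two such
arcs joined over the maximum, or the new minimum alone. -/
theorem Describes.act (hD : Composes D.bottom D.slices c) (hs : D.slices[i]? = some s)
    {σ : Link M} (h : D.Describes g F i s.dom σ)
    (hc : ∀ a, s.piece = .cap a →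
      σ.mate (downLeg s.left.length a) ≠ upLeg s.left.length a) :
    D.Describes g F (i + 1) s.cod (σ.act g s.piece s.left.length (F i)) := by
  refine ⟨h.valid.act _ _ _, ?_⟩
  obtain ⟨L, p, R⟩ := s
  have hv : σ.Valid (L ++ p.dom ++ R) := h.valid
  rcases p with ⟨o, a, b⟩ | a | a
  · intro j hj
    obtain ⟨j, rfl⟩ : ∃ j', swapAt L.length j' = j := ⟨_, swapAt_swapAt _ j⟩
    simp only [Slice.cod, Piece.cod] at hj
    rw [getElem?_swapAt] at hj
    have hm := hv.mate_dir _ _ hj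
    obtain ⟨e, he, hb⟩ := visit_cross_down (g := g) hD hs hj
    obtain ⟨e', he', hb'⟩ := visit_cross_up (g := g) hD hs hm
    obtain ⟨w, hw, hwb, hl⟩ := h.trail j hj
    obtain ⟨k₁, k₂, k₃⟩ := hw.extend (g := g) (F := F) he he' (hw.lt_of_tail hl)
    have hmt : (σ.act g (.cross o a b) L.length (F i)).mate (swapAt L.length j) =
      swapAt L.length (σ.mate j) := cross_mate_swapAt _ _ _ _
    dsimp only
    rw [hmt]
    refine ⟨_, k₁, ?_, k₃⟩
    rw [k₂, hb, hb', hwb]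
    exact (cross_word hv hj).symm
  · intro j hj
    have hj₀ : (L ++ R)[j]? = some .down := by simpa [Slice.cod, Piece.cod] using hj
    have hj' := (getElem?_insAt a a.flip j).trans hj
    have hm := hv.mate_dir _ _ hj'
    have hmt := cap_mate_insAt_ne hv (g (capType a)) j hj
    have hwd := cap_word hv (g (capType a)) j hj
    have hd := getElem?_downLeg (L := L) (R := R) a
    have hmd := hv.mate_dir _ _ hd
    have hup : ∀ x y, insAt L.length x = y → (L ++ [a, a.flip] ++ R)[y]? = some .up →
        D.visit (i, y) = some (none, (i + 1, x)) := by
      rintro x _ rfl hy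
      rw [getElem?_insAt] at hy
      exact visit_cap_up hD hs (by simpa using hy)
    obtain ⟨w, hw, hwb, hl⟩ := h.trail _ hj'
    have hw' := hw.lt_of_tail hl
    simp only [Link.act]
    rw [hwd]
    split_ifs at hmt ⊢ with hu
    · obtain ⟨v, hv, hvb, hvl⟩ := h.trail _ hd
      have hv' := hv.lt_of_tail hvl
      rw [hu] at hw
      obtain ⟨k₁, k₂, k₃⟩ := (hw.append (.cons (visit_cap_leg hD hs) hv)).extend (g := g) (F := F)
        (visit_cap_down hD hs hj₀) (hup _ _ hmt hmd) (by
          intro x hx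
          simp only [List.mem_append, List.mem_cons] at hx
          obtain hx | rfl | hx := hx
          · exact hw' x hx
          · simp
          · exact hv' x hx)
      refine ⟨_, k₁, ?_, k₃⟩
      rw [k₂, beads_append, beads_cons, hwb, hvb]
      simp [bead, mul_assoc]
    · obtain ⟨k₁, k₂, k₃⟩ := hw.extend (g := g) (F := F)
        (visit_cap_down hD hs hj₀) (hup _ _ hmt hm) hw'
      refine ⟨_, k₁, ?_, k₃⟩
      rw [k₂, hwb]
      simp [bead]
  · intro j hj
    simp only [Slice.cod, Piece.cod] at hj
    simp only [Link.act]
    have key : j = downLeg L.length a ∨ ∃ i, j = insAt L.length i := by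
      cases a
      · obtain rfl | h | h := eq_or_insAt L.length j
        · rw [getElem?_left] at hj
          simp at hj
        · exact .inl h
        · exact .inr h
      · obtain h | rfl | h := eq_or_insAt L.length j
        · exact .inl h
        · rw [getElem?_right] at hj
          simp [Dir.flip] at hj
        · exact .inr h
    obtain rfl | ⟨j, rfl⟩ := key
    · have hm : (σ.cup L.length a (g (cupType a))).mate (downLeg L.length a) =
          upLeg L.length a := by
        cases a <;> simp [cup, upLeg, downLeg]
      rw [hm, cup_word_downLeg]
      exact ⟨_, .single (visit_cup_leg hD hs), by simp [beads, bead], by simp⟩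
    · rw [getElem?_insAt] at hj
      have hj₀ : (L ++ R)[j]? = some .down := by simpa using hj
      have hj₁ : (⟨L, .cup a, R⟩ : Slice).dom[j]? = some .down := by
        simpa [Slice.dom, Piece.dom] using hj
      obtain ⟨w, hw, hwb, hl⟩ := h.trail _ hj₁
      have hm : (L ++ R)[σ.mate j]? = some .up := by
        simpa [Piece.dom, Dir.flip] using hv.mate_dir _ _ hj₁
      obtain ⟨k₁, k₂, k₃⟩ := hw.extend (g := g) (F := F)
        (visit_cup_down hD hs hj₀) (visit_cup_up hD hs hm) (hw.lt_of_tail hl)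
      rw [cup_mate_insAt, cup_word_insAt]
      refine ⟨_, k₁, ?_, k₃⟩
      rw [k₂, hwb]
      simp [bead]

end Diagram


/-! ### The only loop of a knot diagram is closed in the last slice. -/

open Link

namespace Diagram

variable {D K : Diagram} {i j l : ℕ} {s : Slice} {M : Type*} [Monoid M] {g : Extremum → M}
  {F : ℕ → M × M} {c : List Dir}

theorem hasPoint_dom (hD : Composes D.bottom D.slices c) (hs : D.slices[i]? = some s) :
    D.HasPoint (i, j) ↔ j < s.dom.length := by
  rw [HasPoint, dirAt_dom hD hs]
  simp

theorem hasPoint_cod (hD : Composes D.bottom D.slices c) (hs : D.slices[i]? = some s) :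
    D.HasPoint (i + 1, j) ↔ j < s.cod.length := by
  rw [HasPoint, dirAt_cod hD hs]
  simp

/-- The closed trail which arises at a maximum whose legs belong to the same arc below it. -/
theorem Describes.closed_trail (hD : Composes D.bottom D.slices c) {L R : List Dir} {a : Dir}
    (hs : D.slices[i]? = some ⟨L, .cap a, R⟩) {σ : Link M}
    (h : D.Describes g F i (L ++ [a, a.flip] ++ R) σ)
    (hm : σ.mate (downLeg L.length a) = upLeg L.length a) :
    ∃ w, D.Trail (i, downLeg L.length a) w (i, downLeg L.length a) ∧ w ≠ [] ∧
      (i, downLeg L.length a) ∉ w.tail.map Prod.fst ∧ (∀ x ∈ w, x.1.1 < i + 1) ∧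
      beads g F w = σ.word (downLeg L.length a) * g (capType a) := by
  obtain ⟨w, hw, hb, hl⟩ := h.trail _ (getElem?_downLeg a)
  rw [hm] at hw
  have hl' := hw.lt_of_tail hl
  have hv := visit_cap_leg hD hs
  refine ⟨_, hw.append (.single hv), by simp, ?_, ?_, ?_⟩
  · have hn : w ≠ [] := by
      rintro rfl
      generalize hu : upLeg L.length a = u at hw
      generalize hd : downLeg L.length a = d at hw
      cases hw
      exact upLeg_ne_downLeg _ _ (hu.trans hd.symm)
    rw [List.tail_append_of_ne_nil hn]
    simp only [List.map_append, List.map_cons, List.map_nil, List.mem_append, List.mem_singleton,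
      Prod.mk.injEq, true_and, not_or]
    refine ⟨fun hx => ?_, (upLeg_ne_downLeg _ _).symm⟩
    obtain ⟨x, hx, e⟩ := List.mem_map.1 hx
    have := hl x hx
    rw [e] at this
    exact lt_irrefl _ this
  · intro x hx
    obtain hx | hx := List.mem_append.1 hx
    · exact hl' x hx
    · obtain rfl := List.mem_singleton.1 hx
      simp
  · rw [beads_append, hb]
    simp [beads, bead]

/-- A loop of a knot diagram which is closed by a maximum is closed in the last slice. -/
theorem IsKnot.eq_nil_of_closed_trail (hK : K.IsKnot) {X Y : List Slice}
    (hs : K.slices = X ++ s :: Y) {p : ℕ × ℕ}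
    {w : List ((ℕ × ℕ) × Option (Encounter K.slices.length))} (h : K.Trail p w p) (hw : w ≠ [])
    (hl : ∀ x ∈ w, x.1.1 < X.length + 1) : Y = [] := by
  have hp := h.hasPoint (h.mem_of_ne_nil hw)
  have key : ∀ q, K.HasPoint q → q.1 < X.length + 1 := fun q hq => by
    obtain ⟨x, hx, rfl⟩ := List.mem_map.1 ((hK.2.2.2 p hp).mem_of_closed h hw hq)
    exact hl x hx
  cases Y with
  | nil => rfl
  | cons t Y =>
    exfalso
    have hD : Composes K.bottom K.slices [] := by
      rw [hK.1]
      exact hK.2.1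
    have ht : K.slices[X.length + 1]? = some t := by simp [hs]
    have h₁ := fun h => key (X.length + 1, 0) ((hasPoint_dom hD ht).2 h)
    have h₂ := fun h => key (X.length + 1 + 1, 0) ((hasPoint_cod hD ht).2 h)
    obtain ⟨L, p, R⟩ := t
    rcases p with ⟨o, a, b⟩ | a | a
    · exact absurd (h₁ (by simp [Slice.dom, Piece.dom])) (by simp)
    · exact absurd (h₁ (by simp [Slice.dom, Piece.dom])) (by simp)
    · exact absurd (h₂ (by simp [Slice.cod, Piece.cod])) (by simp)

/-- An induction principle for knot diagrams: no loop is closed before the last slice, and the loop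
closed there is the full traversal of the diagram. -/
theorem IsKnot.exists_closed (hK : K.IsKnot) (g : Extremum → M) (F : ℕ → M × M)
    (P : ℕ → List Slice → Link M → Prop) (h₀ : P 0 K.slices (empty M))
    (hP : ∀ i s Y σ, σ.Valid s.dom → P i (s :: Y) σ →
      (∀ a, s.piece = .cap a → σ.mate (downLeg s.left.length a) ≠ upLeg s.left.length a) →
      P (i + 1) Y (σ.act g s.piece s.left.length (F i))) :
    ∃ a i σ w, P i [⟨[], .cap a, []⟩] σ ∧ σ.mate (downLeg 0 a) = upLeg 0 a ∧
      K.Trail (i, downLeg 0 a) w (i, downLeg 0 a) ∧ w ≠ [] ∧ w.length ≤ K.numPoints ∧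
      beads g F w = σ.word (downLeg 0 a) * g (capType a) := by
  have hD : Composes K.bottom K.slices [] := by
    rw [hK.1]
    exact hK.2.1
  -- Induction on the slices `Y` still to come; `X` is the part already built, and `σ` describes it.
  suffices H : ∀ (Y X : List Slice) (lv : List Dir) (σ : Link M), K.slices = X ++ Y → Y ≠ [] →
      Composes lv Y [] → K.Describes g F X.length lv σ → P X.length Y σ → _ from
    H K.slices [] [] (empty M) rfl hK.2.2.1 hK.2.1 ⟨empty_valid M, by simp⟩ h₀
  intro Y
  induction Y with
  | nil => simp
  | cons s Y ih =>
    rintro X _ σ hX - ⟨rfl, hY⟩ h hp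
    have hs : K.slices[X.length]? = some s := by simp [hX]
    by_cases hc : ∀ a, s.piece = .cap a →
        σ.mate (downLeg s.left.length a) ≠ upLeg s.left.length a
    · by_cases hY' : Y = []
      · subst hY'
        obtain ⟨L, p, R⟩ := s
        have hY : L ++ p.cod ++ R = [] := hY
        obtain ⟨rfl, hp', rfl⟩ : L = [] ∧ p.cod = [] ∧ R = [] := by simpa using hY
        rcases p with ⟨o, a, b⟩ | a | a
        · cases hp'
        -- The last slice is a maximum with no lines beside it, and the mate of its down leg, being
        -- directed up, can only be its up leg.
        · refine absurd ?_ (hc a rfl)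
          have := h.valid.mate_dir _ _ (getElem?_downLeg (L := []) (R := []) a)
          revert this
          have h2 : ∀ j, ([] ++ [a, a.flip] ++ [] : List Dir)[j]? = some .up → j = upLeg 0 a := by
            rintro (_ | _ | j) <;> cases a <;> simp [upLeg, Dir.flip]
          exact h2 _
        · cases hp'
      · exact ih (X ++ [s]) _ _ (by simp [hX]) hY' hY
          (by simpa using h.act hD hs hc) (by simpa using hP _ _ _ _ h.valid hp hc)
    · push Not at hc
      obtain ⟨a, ha, hm⟩ := hc
      obtain ⟨L, p, R⟩ := s
      obtain rfl : p = .cap a := ha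
      obtain ⟨w, hw, hn, ht, hl, hb⟩ := h.closed_trail hD hs hm
      obtain rfl := hK.eq_nil_of_closed_trail hX hw hn hl
      have hY : L ++ [] ++ R = [] := hY
      obtain ⟨rfl, rfl⟩ : L = [] ∧ R = [] := by simpa using hY
      exact ⟨a, X.length, σ, w, hp, hm, hw, hn, hw.length_le ht, hb⟩

end Diagram

/-! ### The state sum of a knot for fixed labels is a trace. -/

section Value

variable {k A : Type*} [Field k] [Ring A] [Algebra k A]

/-- The product of the traces of the loops which arise when slices with the given labels are put on
top of a link. -/
noncomputable def value (tr : A →ₗ[k] k) (g : Extremum → A) :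
    List Slice → (ℕ → A × A) → Link A → k
  | [], _, _ => 1
  | s :: Y, F, σ => closing tr g s.piece s.left.length σ *
      value tr g Y (fun i => F (i + 1)) (σ.act g s.piece s.left.length (F 0))

theorem closing_eq_one (tr : A →ₗ[k] k) (g : Extremum → A) {p : Piece} {l : ℕ} {σ : Link A}
    (h : ∀ a, p = .cap a → σ.mate (downLeg l a) ≠ upLeg l a) : closing tr g p l σ = 1 := by
  rcases p with ⟨o, a, b⟩ | a | a
  · rfl
  · exact if_neg (h a rfl)
  · rfl

/-- The value of a knot diagram is the trace of the product of the labels met on its traversal. -/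
theorem Diagram.IsKnot.value_eq {K : Diagram} (hK : K.IsKnot) {tr : A →ₗ[k] k} (htr : Tracelike tr)
    (g : Extremum → A) (F : ℕ → A × A) {p : ℕ × ℕ} (hp : K.HasPoint p) :
    value tr g K.slices F (empty A) = tr (beads g F (K.walk K.numPoints p)) := by
  obtain ⟨a, i, σ, w, h, hm, hw, hn, hl, hb⟩ := hK.exists_closed g F
    (fun i Y σ => value tr g K.slices F (empty A) = value tr g Y (fun c => F (i + c)) σ)
    (by simp) (by
      intro i s Y σ _ h hc
      rw [h, value, closing_eq_one tr g hc, one_mul]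
      simp only [add_zero]
      congr 1
      ext c <;> simp only [Nat.add_right_comm, Nat.add_assoc])
  -- The loop is known from the down leg of the last maximum; the traversal from `p` is a cyclic
  -- rotation of it, and the trace does not distinguish them.
  obtain ⟨u, v, rfl, -, -, -, h₂⟩ := hK.walk_rotate hw hn hl hp
  rw [h₂, h, beads_append, htr, ← beads_append, hb]
  simp [value, closing, hm, Link.word]

end Value

/-! ### The Whitney degree in terms of the extrema met on the traversal. -/

section Turns

variable {M : Type*} [CommMonoid M]

theorem prod_range_insAt (f : ℕ → M) (l m : ℕ) :
    ∏ j ∈ Finset.range (l + 2 + m), f j =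
      f l * f (l + 1) * ∏ j ∈ Finset.range (l + m), f (insAt l j) := by
  have h₁ : ∏ j ∈ Finset.range l, f (insAt l j) = ∏ j ∈ Finset.range l, f j :=
    Finset.prod_congr rfl fun j hj => by rw [insAt_of_lt (Finset.mem_range.1 hj)]
  have h₂ : ∏ j ∈ Finset.range m, f (insAt l (l + j)) = ∏ j ∈ Finset.range m, f (l + 2 + j) :=
    Finset.prod_congr rfl fun j _ => by
      rw [insAt_of_le (Nat.le_add_right l j), Nat.add_right_comm]
  rw [Finset.prod_range_add, Finset.prod_range_add, Finset.prod_range_succ (n := 1),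
    Finset.prod_range_one, Finset.prod_range_add, h₁, h₂]
  ac_rfl

/-- The contribution of an extremum to twice the Whitney degree. -/
def extremumTurn : Extremum → Multiplicative ℤ
  | .uMinus => .ofAdd 1
  | .uPlus => .ofAdd (-1)
  | .dPlus => .ofAdd (-1)
  | .dMinus => .ofAdd 1

/-- In a commutative monoid the product of the labels of all lines counts every extremum so far. A
maximum that closes no loop merely moves the labels of its legs, with its own contribution, to one
other line, the one at `j₀`. -/
theorem prod_label_act {σ : Link (Multiplicative ℤ)} {p : Piece} {L R : List Dir}
    (hv : σ.Valid (L ++ p.dom ++ R))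
    (hc : ∀ a, p = .cap a → σ.mate (downLeg L.length a) ≠ upLeg L.length a) :
    ∏ j ∈ Finset.range (L ++ p.cod ++ R).length, (σ.act extremumTurn p L.length 1).label j =
      (∏ j ∈ Finset.range (L ++ p.dom ++ R).length, σ.label j) * .ofAdd p.turn := by
  rcases p with ⟨o, a, b⟩ | a | a
  · simp only [Piece.dom, Piece.cod, List.length_append, List.length_cons, List.length_nil, zero_add,
      Nat.reduceAdd, Piece.turn, ofAdd_zero, mul_one]
    rw [prod_range_insAt, prod_range_insAt]
    have h : ∀ (x y : Multiplicative ℤ) (d : Dir), mulAlong d x y = x * y := by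
      rintro x y (_ | _)
      · rfl
      · exact mul_comm _ _
    simp [act, Link.cross, h, insAt_ne, mul_comm (σ.label L.length)]
  · simp only [Piece.dom, Piece.cod, List.length_append, List.length_cons, List.length_nil, zero_add,
      Nat.reduceAdd, add_zero]
    rw [prod_range_insAt]
    have hu := getElem?_upLeg (L := L) (R := R) a
    obtain ⟨j₀, hj₀⟩ : ∃ j₀, σ.mate (upLeg L.length a) = insAt L.length j₀ := by
      have h₁ : σ.mate (upLeg L.length a) ≠ upLeg L.length a := hv.mate_ne hu hu
      have h₂ : σ.mate (upLeg L.length a) ≠ downLeg L.length a := fun h =>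
        hc a rfl (by rw [← h, hv.mate_mate])
      obtain h | h | h := eq_or_insAt L.length (σ.mate (upLeg L.length a))
      · cases a <;> simp_all [upLeg, downLeg]
      · cases a <;> simp_all [upLeg, downLeg]
      · exact h
    have hlt : j₀ ∈ Finset.range (L.length + R.length) := by
      have := hv.mate_dir _ _ hu
      rw [hj₀] at this
      simp only [Piece.dom] at this
      rw [getElem?_insAt] at this
      obtain ⟨h, -⟩ := List.getElem?_eq_some_iff.1 this
      simpa using h
    have he : ∀ j, (σ.act extremumTurn (.cap a) L.length 1).label j = σ.label (insAt L.length j) *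
        if j = j₀ then σ.label (upLeg L.length a) * extremumTurn (capType a) *
          σ.label (downLeg L.length a) else 1 := by
      intro j
      have : σ.mate (insAt L.length j) = upLeg L.length a ↔ j = j₀ := by
        rw [← insAt_injective (l := L.length) (j := j), ← hj₀]
        constructor
        · intro h
          rw [← h, hv.mate_mate]
        · intro h
          rw [h, hv.mate_mate]
      simp only [act, Link.cap, this]
      split_ifs <;> simp
    rw [Finset.prod_congr rfl fun j _ => he j, Finset.prod_mul_distrib, Finset.prod_ite_eq',
      if_pos hlt]
    cases a
    · simp only [upLeg, downLeg, capType, extremumTurn, Piece.turn]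
      ac_rfl
    · simp only [upLeg, downLeg, capType, extremumTurn, Piece.turn]
      ac_rfl
  · simp only [Piece.dom, Piece.cod, List.length_append, List.length_cons, List.length_nil, zero_add,
      Nat.reduceAdd, add_zero]
    rw [prod_range_insAt]
    simp only [act, cup_label_insAt]
    rw [mul_comm]
    congr 1
    cases a <;> simp [Link.cup, downLeg, upLeg, cupType, extremumTurn, Piece.turn]

/-- The sum of the contributions of the extrema met on the traversal of a knot diagram. -/
theorem Diagram.IsKnot.beads_turn {K : Diagram} (hK : K.IsKnot) {p : ℕ × ℕ} (hp : K.HasPoint p) :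
    beads extremumTurn 1 (K.walk K.numPoints p) =
      .ofAdd (K.slices.map fun s => s.piece.turn).sum := by
  obtain ⟨a, i, σ, w, h, hm, hw, hn, hl, hb⟩ := hK.exists_closed extremumTurn 1
    (fun _ Y σ => ∃ lv, Composes lv Y [] ∧ (∏ j ∈ Finset.range lv.length, σ.label j) *
      .ofAdd (Y.map fun s => s.piece.turn).sum = .ofAdd (K.slices.map fun s => s.piece.turn).sum)
    ⟨[], hK.2.1, by simp⟩ (by
      rintro i s Y σ hv ⟨_, ⟨rfl, hY⟩, h⟩ hc
      refine ⟨_, hY, ?_⟩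
      rw [← h, List.map_cons, List.sum_cons, ofAdd_add, ← mul_assoc]
      congr 1
      exact prod_label_act hv hc)
  obtain ⟨u, v, rfl, -, -, -, h₂⟩ := hK.walk_rotate hw hn hl hp
  obtain ⟨_, ⟨rfl, -⟩, h⟩ := h
  rw [h₂, beads_append, mul_comm, ← beads_append, hb, ← h]
  cases a
  · simp only [upLeg, downLeg] at hm
    simp [Link.word, hm, Slice.dom, Piece.dom, Finset.prod_range_succ, downLeg, extremumTurn,
      capType, Piece.turn, mul_comm]
  · simp only [upLeg, downLeg] at hm
    simp [Link.word, hm, Slice.dom, Piece.dom, Finset.prod_range_succ, downLeg, extremumTurn,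
      capType, Piece.turn]

end Turns


/-! ### Single passages, and the direction of the line along them. -/

open Link

namespace Diagram

/-- What is met by a line which enters a crossing at position `l` in the `j`-th place from below, or
leaves it there. -/
def crossEncounter {n : ℕ} (c : Fin n) (l : ℕ) (o : Bool) (j : ℕ) : Option (Encounter n) :=
  if j = l then some (.line c o) else if j = l + 1 then some (.line c !o) else none

/-- The passages through the slices of a diagram. -/
inductive Step (D : Diagram) : ℕ × ℕ → Option (Encounter D.slices.length) → ℕ × ℕ → Prop
  | crossUp {i j : ℕ} {L R : List Dir} {o : Bool} {a b : Dir} (hi : i < D.slices.length)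
      (hs : D.slices[i]? = some ⟨L, .cross o a b, R⟩) (hd : (L ++ [a, b] ++ R)[j]? = some .up) :
      Step D (i, j) (crossEncounter ⟨i, hi⟩ L.length o j) (i + 1, swapAt L.length j)
  | crossDown {i j : ℕ} {L R : List Dir} {o : Bool} {a b : Dir} (hi : i < D.slices.length)
      (hs : D.slices[i]? = some ⟨L, .cross o a b, R⟩) (hd : (L ++ [a, b] ++ R)[j]? = some .down) :
      Step D (i + 1, swapAt L.length j) (crossEncounter ⟨i, hi⟩ L.length o j) (i, j)
  | cupUp {i j : ℕ} {L R : List Dir} {a : Dir} (hs : D.slices[i]? = some ⟨L, .cup a, R⟩)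
      (hd : (L ++ R)[j]? = some .up) : Step D (i, j) none (i + 1, insAt L.length j)
  | cupDown {i j : ℕ} {L R : List Dir} {a : Dir} (hs : D.slices[i]? = some ⟨L, .cup a, R⟩)
      (hd : (L ++ R)[j]? = some .down) : Step D (i + 1, insAt L.length j) none (i, j)
  | cupLeg {i : ℕ} {L R : List Dir} {a : Dir} (hs : D.slices[i]? = some ⟨L, .cup a, R⟩) :
      Step D (i + 1, downLeg L.length a) (some (.extremum (cupType a))) (i + 1, upLeg L.length a)
  | capUp {i j : ℕ} {L R : List Dir} {a : Dir} (hs : D.slices[i]? = some ⟨L, .cap a, R⟩)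
      (hd : (L ++ R)[j]? = some .up) : Step D (i, insAt L.length j) none (i + 1, j)
  | capDown {i j : ℕ} {L R : List Dir} {a : Dir} (hs : D.slices[i]? = some ⟨L, .cap a, R⟩)
      (hd : (L ++ R)[j]? = some .down) : Step D (i + 1, j) none (i, insAt L.length j)
  | capLeg {i : ℕ} {L R : List Dir} {a : Dir} (hs : D.slices[i]? = some ⟨L, .cap a, R⟩) :
      Step D (i, upLeg L.length a) (some (.extremum (capType a))) (i, downLeg L.length a)

variable {D : Diagram} {p q : ℕ × ℕ} {e : Option (Encounter D.slices.length)} {c : List Dir}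

theorem Step.visit (hD : Composes D.bottom D.slices c) (h : D.Step p e q) :
    D.visit p = some (e, q) := by
  cases h with
  | @crossUp i j L R o a b hi hs hd =>
    obtain ⟨h, e⟩ := visit_up hD hs (j := j) hd
    rw [e]
    simp only [Slice.pass, crossEncounter, swapAt]
    split_ifs <;> simp_all
  | @crossDown i j L R o a b hi hs hd =>
    rw [← getElem?_swapAt] at hd
    obtain ⟨h, e⟩ := visit_down hD hs hd
    have hp : (⟨L, .cross o a b, R⟩ : Slice).pass ⟨i, h⟩ .down (swapAt L.length j) =
        (.down, j, crossEncounter ⟨i, hi⟩ L.length o j) := by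
      simp only [Slice.pass, swapAt, crossEncounter]
      split_ifs <;> first | omega | simp_all
    rw [e, hp]
    simp
  | cupUp hs hd => exact visit_cup_up hD hs hd
  | cupDown hs hd => exact visit_cup_down hD hs hd
  | cupLeg hs => exact visit_cup_leg hD hs
  | capUp hs hd => exact visit_cap_up hD hs hd
  | capDown hs hd => exact visit_cap_down hD hs hd
  | capLeg hs => exact visit_cap_leg hD hs

theorem exists_step_up {i j : ℕ} {s : Slice} (hs : D.slices[i]? = some s)
    (hd : s.dom[j]? = some .up) : ∃ e q, D.Step (i, j) e q := by
  obtain ⟨L, p, R⟩ := s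
  rcases p with ⟨o, a, b⟩ | a | a
  · exact ⟨_, _, .crossUp (List.getElem?_eq_some_iff.1 hs).1 hs hd⟩
  · simp only [Slice.dom, Piece.dom] at hd
    obtain rfl | rfl | ⟨j, rfl⟩ := eq_or_insAt L.length j
    · rw [getElem?_left] at hd
      obtain rfl := Option.some.inj hd
      exact ⟨_, _, .capLeg hs⟩
    · rw [getElem?_right] at hd
      cases a
      · simp [Dir.flip] at hd
      · exact ⟨_, _, .capLeg hs⟩
    · rw [getElem?_insAt] at hd
      exact ⟨_, _, .capUp hs (by simpa using hd)⟩
  · exact ⟨_, _, .cupUp hs (by simpa [Slice.dom, Piece.dom] using hd)⟩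

theorem exists_step_down {i j : ℕ} {s : Slice} (hs : D.slices[i]? = some s)
    (hd : s.cod[j]? = some .down) : ∃ e q, D.Step (i + 1, j) e q := by
  obtain ⟨L, p, R⟩ := s
  rcases p with ⟨o, a, b⟩ | a | a
  · obtain ⟨j, rfl⟩ : ∃ j', swapAt L.length j' = j := ⟨_, swapAt_swapAt _ j⟩
    simp only [Slice.cod, Piece.cod] at hd
    rw [getElem?_swapAt] at hd
    exact ⟨_, _, .crossDown (List.getElem?_eq_some_iff.1 hs).1 hs hd⟩
  · exact ⟨_, _, .capDown hs (by simpa [Slice.cod, Piece.cod] using hd)⟩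
  · simp only [Slice.cod, Piece.cod] at hd
    obtain rfl | rfl | ⟨j, rfl⟩ := eq_or_insAt L.length j
    · rw [getElem?_left] at hd
      obtain rfl := Option.some.inj hd
      exact ⟨_, _, .cupLeg hs⟩
    · rw [getElem?_right] at hd
      cases a
      · exact ⟨_, _, .cupLeg hs⟩
      · simp [Dir.flip] at hd
    · rw [getElem?_insAt] at hd
      exact ⟨_, _, .cupDown hs (by simpa using hd)⟩

theorem step_of_visit (hD : Composes D.bottom D.slices c) (h : D.visit p = some (e, q)) :
    D.Step p e q := by
  suffices H : ∃ e q, D.Step p e q by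
    obtain ⟨e', q', h'⟩ := H
    obtain ⟨rfl, rfl⟩ := Prod.mk.inj (Option.some.inj (h.symm.trans (h'.visit hD)))
    exact h'
  obtain ⟨i, j⟩ := p
  cases hd : D.dirAt (i, j) with
  | none => simp [Diagram.visit, hd] at h
  | some d =>
    cases d with
    | up =>
      have hi : i < D.slices.length := by
        by_contra hi
        simp [Diagram.visit, hd, hi] at h
      have hs := List.getElem?_eq_getElem hi
      exact exists_step_up hs (by rw [← dirAt_dom hD hs, hd])
    | down =>
      cases i with
      | zero => simp [Diagram.visit, hd] at h
      | succ i =>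
        have hi : i < D.slices.length := by
          by_contra hi
          simp [Diagram.visit, hd, hi] at h
        have hs := List.getElem?_eq_getElem hi
        exact exists_step_down hs (by rw [← dirAt_cod hD hs, hd])

/-- The direction of the over line of a crossing. -/
def _root_.OQ.Piece.overDir : Piece → Dir
  | .cross o a b => if o then a else b
  | .cap a => a
  | .cup a => a

/-- The direction of the under line of a crossing. -/
def _root_.OQ.Piece.underDir : Piece → Dir
  | .cross o a b => if o then b else a
  | .cap a => a
  | .cup a => a

/-- What may be met on the way from a point at which the line has direction `d` to one at which it
has direction `d'`. -/
def Turns (D : Diagram) (d d' : Dir) : Option (Encounter D.slices.length) → Prop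
  | none => d = d'
  | some (.over c) => d = d' ∧ d = D.slices[c].piece.overDir
  | some (.under c) => d = d' ∧ d = D.slices[c].piece.underDir
  | some (.extremum .uMinus) => d = .up ∧ d' = .down
  | some (.extremum .dPlus) => d = .up ∧ d' = .down
  | some (.extremum .uPlus) => d = .down ∧ d' = .up
  | some (.extremum .dMinus) => d = .down ∧ d' = .up

theorem turns_crossEncounter {i j : ℕ} {L R : List Dir} {o : Bool} {a b d : Dir}
    (hi : i < D.slices.length) (hs : D.slices[i]? = some ⟨L, .cross o a b, R⟩)
    (hd : (L ++ [a, b] ++ R)[j]? = some d) :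
    D.Turns d d (crossEncounter ⟨i, hi⟩ L.length o j) := by
  have hs' : D.slices[i] = ⟨L, .cross o a b, R⟩ := by
    rw [List.getElem?_eq_getElem hi] at hs
    exact Option.some.inj hs
  rw [crossEncounter]
  split_ifs with h₁ h₂
  · subst h₁
    rw [getElem?_left] at hd
    obtain rfl := Option.some.inj hd
    cases o <;> simp [Encounter.line, Turns, hs', Piece.overDir, Piece.underDir]
  · subst h₂
    rw [getElem?_right] at hd
    obtain rfl := Option.some.inj hd
    cases o <;> simp [Encounter.line, Turns, hs', Piece.overDir, Piece.underDir]
  · rfl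

theorem Step.turns (hD : Composes D.bottom D.slices c) (h : D.Step p e q) :
    ∃ d d', D.dirAt p = some d ∧ D.dirAt q = some d' ∧ D.Turns d d' e := by
  cases h with
  | @crossUp i j L R o a b hi hs hd =>
    refine ⟨_, _, ?_, ?_, turns_crossEncounter hi hs hd⟩
    · rw [dirAt_dom hD hs]
      exact hd
    · rw [dirAt_cod hD hs]
      exact (getElem?_swapAt (L := L) (R := R) b a j).trans hd
  | @crossDown i j L R o a b hi hs hd =>
    refine ⟨_, _, ?_, ?_, turns_crossEncounter hi hs hd⟩
    · rw [dirAt_cod hD hs]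
      exact (getElem?_swapAt (L := L) (R := R) b a j).trans hd
    · rw [dirAt_dom hD hs]
      exact hd
  | @cupUp i j L R a hs hd =>
    refine ⟨.up, .up, ?_, ?_, rfl⟩
    · rw [dirAt_dom hD hs, ← hd]
      simp [Slice.dom, Piece.dom]
    · rw [dirAt_cod hD hs, ← hd]
      exact (getElem?_insAt a a.flip j).trans (by simp)
  | @cupDown i j L R a hs hd =>
    refine ⟨.down, .down, ?_, ?_, rfl⟩
    · rw [dirAt_cod hD hs, ← hd]
      exact (getElem?_insAt a a.flip j).trans (by simp)
    · rw [dirAt_dom hD hs, ← hd]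
      simp [Slice.dom, Piece.dom]
  | @cupLeg i L R a hs =>
    refine ⟨.down, .up, ?_, ?_, ?_⟩
    · rw [dirAt_cod hD hs]
      exact getElem?_downLeg a
    · rw [dirAt_cod hD hs]
      exact getElem?_upLeg a
    · cases a <;> exact ⟨rfl, rfl⟩
  | @capUp i j L R a hs hd =>
    refine ⟨.up, .up, ?_, ?_, rfl⟩
    · rw [dirAt_dom hD hs, ← hd]
      exact (getElem?_insAt a a.flip j).trans (by simp)
    · rw [dirAt_cod hD hs, ← hd]
      simp [Slice.cod, Piece.cod]
  | @capDown i j L R a hs hd =>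
    refine ⟨.down, .down, ?_, ?_, rfl⟩
    · rw [dirAt_cod hD hs, ← hd]
      simp [Slice.cod, Piece.cod]
    · rw [dirAt_dom hD hs, ← hd]
      exact (getElem?_insAt a a.flip j).trans (by simp)
  | @capLeg i L R a hs =>
    refine ⟨.up, .down, ?_, ?_, ?_⟩
    · rw [dirAt_dom hD hs]
      exact getElem?_upLeg a
    · rw [dirAt_dom hD hs]
      exact getElem?_downLeg a
    · cases a <;> exact ⟨rfl, rfl⟩

end Diagram


/-! ### From powers of the automorphisms to powers of `G` at the extrema. -/

open Link OrientedQuantumAlgebra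

/-- `1` for up, `0` for down. -/
def Dir.height : Dir → ℤ
  | up => 1
  | down => 0

section Word

variable {k A : Type*} [Field k] [Ring A] [Algebra k A]

/-- The pair of labels of a crossing, transported to the end of a traversal which ends in direction
`d`, up to conjugation. -/
noncomputable def transport (t : A ≃ₐ[k] A) (d : Dir) (p : Piece) (x : A × A) : A × A :=
  ((t ^ (p.overDir.height - d.height)) x.1, (t ^ (p.underDir.height - d.height)) x.2)

/-- Labels for all slices from labels for those of a list. -/
def extendLabels (φ : Piece → A × A → A × A) (Y : List Slice) (f : Fin Y.length → A × A) (i : ℕ) :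
    A × A :=
  if h : i < Y.length then φ Y[i].piece (f ⟨i, h⟩) else 1

variable {Q : OrientedQuantumAlgebra k A} {G : Aˣ}

/-- As the automorphisms commute, `t_d^m t_u^n = (t_d t_u)^n t_d^(m-n)`, and the first factor is
conjugation by `G^n`. -/
theorem td_zpow_tu_zpow (hG : ∀ x : A, Q.td (Q.tu x) = (G : A) * x * (↑G⁻¹ : A)) (m n : ℤ) (x : A) :
    (Q.td ^ m) ((Q.tu ^ n) x) * (↑(G ^ n) : A) = ↑(G ^ n) * (Q.td ^ (m - n)) x := by
  have hc : Commute Q.td Q.tu := AlgEquiv.ext Q.td_tu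
  have hθ : ∀ y, ((Q.td * Q.tu) ^ n) y = ↑(G ^ n) * y * (↑(G ^ n)⁻¹ : A) := by
    intro y
    have h : ∀ n : ℕ, ∀ y, ((Q.td * Q.tu) ^ n) y = ↑(G ^ n) * y * (↑(G ^ n)⁻¹ : A) := by
      intro n
      induction n with
      | zero => simp
      | succ n ih =>
        intro y
        rw [pow_succ', AlgEquiv.mul_apply, ih, AlgEquiv.mul_apply, hG]
        simp [pow_succ', mul_assoc]
    cases n with
    | ofNat n => simpa using h n y
    | negSucc n =>
      rw [zpow_negSucc, zpow_negSucc, inv_inv]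
      apply ((Q.td * Q.tu) ^ (n + 1)).injective
      rw [← AlgEquiv.mul_apply, mul_inv_cancel, h]
      generalize G ^ (n + 1) = u
      simp [mul_assoc]
  have : Q.td ^ m * Q.tu ^ n = (Q.td * Q.tu) ^ n * Q.td ^ (m - n) := by
    rw [hc.mul_zpow, mul_assoc, (hc.symm.zpow_zpow n (m - n)).eq, ← mul_assoc, ← zpow_add,
      add_sub_cancel]
  rw [← AlgEquiv.mul_apply, this, AlgEquiv.mul_apply, hθ]
  simp [mul_assoc]

/-- Each maximum adds one to `ud - uu` and turns up into down, each minimum subtracts one and turns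
down into up, so the difference telescopes to that of the heights. -/
theorem Diagram.Trail.dirAt_eq {D : Diagram} {p r : ℕ × ℕ} {c : List Dir}
    {w : List ((ℕ × ℕ) × Option (Encounter D.slices.length))}
    (hD : Composes D.bottom D.slices c) (h : D.Trail p w r) {d d' : Dir}
    (hp : D.dirAt p = some d) (hr : D.dirAt r = some d') :
    Encounter.ud (w.filterMap Prod.snd) - Encounter.uu (w.filterMap Prod.snd) =
      d.height - d'.height := by
  induction h generalizing d with
  | nil => 
    rw [hp] at hr
    obtain rfl := Option.some.inj hr
    simp [Encounter.ud, Encounter.uu]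
  | @cons p q r e w h hw ih =>
    obtain ⟨d₁, d₂, h₁, h₂, ht⟩ := (step_of_visit hD h).turns hD
    obtain rfl := Option.some.inj (hp.symm.trans h₁)
    have := ih h₂ hr
    rcases e with _ | c | c | (_ | _ | _ | _)
    · obtain rfl : d = d₂ := ht
      simpa using this
    · obtain ⟨rfl, -⟩ := ht
      simpa [Encounter.ud, Encounter.uu] using this
    · obtain ⟨rfl, -⟩ := ht
      simpa [Encounter.ud, Encounter.uu] using this
    all_goals
      obtain ⟨rfl, rfl⟩ := ht
      simp only [List.filterMap_cons, Encounter.ud, Encounter.uu, Dir.height] at this ⊢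
      omega

/-- The word of a trail, in terms of the product of transported labels in which the extrema are
labelled by powers of `G`. -/
theorem Diagram.Trail.word_eq (hG : ∀ x : A, Q.td (Q.tu x) = (G : A) * x * (↑G⁻¹ : A))
    {D : Diagram} {p r : ℕ × ℕ} {c : List Dir}
    {w : List ((ℕ × ℕ) × Option (Encounter D.slices.length))}
    (hD : Composes D.bottom D.slices c) (h : D.Trail p w r) {d : Dir}
    (hr : D.dirAt r = some d) (f : Fin D.slices.length → A × A) :
    Q.word f (w.filterMap Prod.snd) =
      (↑(G ^ Encounter.uu (w.filterMap Prod.snd)) : A) *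
        beads (extremumLabel G) (extendLabels (transport Q.td d) D.slices f) w := by
  induction h with
  | nil => simp [OrientedQuantumAlgebra.word, Encounter.uu, beads]
  | @cons p q r e w h hw ih =>
    obtain ⟨d₁, d₂, h₁, h₂, ht⟩ := (step_of_visit hD h).turns hD
    have h' := hw.dirAt_eq hD h₂ hr
    have ih := ih hr
    rw [beads_cons]
    rcases e with _ | c | c | (_ | _ | _ | _)
    · simpa [bead] using ih
    · obtain ⟨rfl, ht⟩ := ht
      simp only [List.filterMap_cons, OrientedQuantumAlgebra.word, Encounter.uu, ih, bead]
      -- After `G` to the power `uu` has been moved to the left, `t_d` remains with exponent `ud -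
      -- uu`; by `h'` this is the difference of heights used in `transport`.
      rw [← mul_assoc, td_zpow_tu_zpow hG, h', ht, mul_assoc]
      simp [extendLabels, transport]
    · obtain ⟨rfl, ht⟩ := ht
      simp only [List.filterMap_cons, OrientedQuantumAlgebra.word, Encounter.uu, ih, bead]
      rw [← mul_assoc, td_zpow_tu_zpow hG, h', ht, mul_assoc]
      simp [extendLabels, transport]
    all_goals
      simp only [List.filterMap_cons, OrientedQuantumAlgebra.word, Encounter.uu, ih, bead, extremumLabel, one_mul]
      try simp only [← mul_assoc, zpow_add, zpow_sub, Units.val_mul, zpow_one,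
        Units.mul_inv_cancel_right, Units.inv_mul_cancel_right]

theorem map_mul_equiv (s s' t t' : A ≃ₐ[k] A) (x : A ⊗[k] A) :
    TensorProduct.map (s * t).toLinearMap (s' * t').toLinearMap x =
      TensorProduct.map s.toLinearMap s'.toLinearMap
        (TensorProduct.map t.toLinearMap t'.toLinearMap x) := by
  induction x using TensorProduct.induction_on with
  | zero => simp
  | add x y hx hy => simp only [map_add, hx, hy]
  | tmul a b => simp

theorem map_one_equiv (x : A ⊗[k] A) :
    TensorProduct.map (1 : A ≃ₐ[k] A).toLinearMap (1 : A ≃ₐ[k] A).toLinearMap x = x := by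
  induction x using TensorProduct.induction_on with
  | zero => simp
  | add x y hx hy => simp only [map_add, hx, hy]
  | tmul a b => simp

theorem map_td_inv (Q : OrientedQuantumAlgebra k A) :
    TensorProduct.map Q.td.toLinearMap Q.td.toLinearMap (↑Q.rho⁻¹ : A ⊗[k] A) = ↑Q.rho⁻¹ := by
  let T : A ⊗[k] A →ₐ[k] A ⊗[k] A := Algebra.TensorProduct.map Q.td.toAlgHom Q.td.toAlgHom
  have hT : T (Q.rho : A ⊗[k] A) = Q.rho := Q.qa2_td
  refine Units.eq_inv_of_mul_eq_one_left (u := Q.rho) (a := T ↑Q.rho⁻¹) ?_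
  conv_lhs => rw [← hT]
  rw [← map_mul, Units.mul_inv, map_one]

/-- The decorations of `A` and `A_s` differ by `t_d` on the lines directed up. The direction `d` at
the end contributes the same power of `t_d` to both factors, under which the standard decorations
are invariant. -/
theorem map_transport (Q : OrientedQuantumAlgebra k A) (d : Dir) (o : Bool) (a b : Dir) :
    TensorProduct.map
      (Q.td ^ ((Piece.cross o a b).overDir.height - d.height) : A ≃ₐ[k] A).toLinearMap
      (Q.td ^ ((Piece.cross o a b).underDir.height - d.height) : A ≃ₐ[k] A).toLinearMap
      (Q.decoration o a b) = Q.standard.decoration o a b := by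
  have hc : Q.td * Q.tu = Q.tu * Q.td := AlgEquiv.ext Q.td_tu
  have hc' : Q.td * (Q.td * Q.tu) = Q.td * Q.tu * Q.td := by rw [mul_assoc, ← hc]
  have e : (LinearMap.id : A →ₗ[k] A) = (1 : A ≃ₐ[k] A).toLinearMap := rfl
  have e' : (AlgEquiv.refl : A ≃ₐ[k] A) = 1 := rfl
  have e'' : Q.tu.trans Q.td = Q.td * Q.tu := rfl
  have h : TensorProduct.map
      (Q.td ^ (Piece.cross o a b).overDir.height : A ≃ₐ[k] A).toLinearMap
      (Q.td ^ (Piece.cross o a b).underDir.height : A ≃ₐ[k] A).toLinearMap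
      (Q.decoration o a b) = Q.standard.decoration o a b := by
    cases o <;> cases a <;> cases b <;>
      simp only [Piece.overDir, Piece.underDir, Dir.height, decoration, standard, zpow_one,
        zpow_zero, e, e', e'', ← map_mul_equiv, mul_one, one_mul, map_one_equiv, Q.qa2_td,
        map_td_inv, if_true, Bool.false_eq_true, if_false]
  have h' : TensorProduct.map Q.td.toLinearMap Q.td.toLinearMap (Q.standard.decoration o a b) =
      Q.standard.decoration o a b := by
    have h₁ : ∀ x : A ⊗[k] A, TensorProduct.map Q.td.toLinearMap Q.td.toLinearMap
        (TensorProduct.map (Q.td * Q.tu).toLinearMap (1 : A ≃ₐ[k] A).toLinearMap x) =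
        TensorProduct.map (Q.td * Q.tu).toLinearMap (1 : A ≃ₐ[k] A).toLinearMap
          (TensorProduct.map Q.td.toLinearMap Q.td.toLinearMap x) := fun x => by
      simp only [← map_mul_equiv, mul_one, one_mul, hc']
    have h₂ : ∀ x : A ⊗[k] A, TensorProduct.map Q.td.toLinearMap Q.td.toLinearMap
        (TensorProduct.map (1 : A ≃ₐ[k] A).toLinearMap (Q.td * Q.tu).toLinearMap x) =
        TensorProduct.map (1 : A ≃ₐ[k] A).toLinearMap (Q.td * Q.tu).toLinearMap
          (TensorProduct.map Q.td.toLinearMap Q.td.toLinearMap x) := fun x => by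
      simp only [← map_mul_equiv, mul_one, one_mul, hc']
    cases o <;> cases a <;> cases b <;>
      simp only [decoration, standard, e, e', e'', h₁, h₂, map_one_equiv, Q.qa2_td, map_td_inv]
  have h'' : TensorProduct.map (Q.td ^ (-d.height) : A ≃ₐ[k] A).toLinearMap
      (Q.td ^ (-d.height) : A ≃ₐ[k] A).toLinearMap (Q.standard.decoration o a b) =
      Q.standard.decoration o a b := by
    cases d
    · conv_lhs => rw [← h', ← map_mul_equiv]
      simp [Dir.height]
    · simp [Dir.height]
  rw [sub_eq_neg_add, sub_eq_neg_add, zpow_add, zpow_add, map_mul_equiv, h, h'']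

theorem sum_transport (Q : OrientedQuantumAlgebra k A) (d : Dir) (o : Bool) (a b : Dir) :
    ∑ x ∈ terms (Q.decoration o a b), (transport Q.td d (.cross o a b) x).1 ⊗ₜ[k]
      (transport Q.td d (.cross o a b) x).2 = Q.standard.decoration o a b := by
  rw [← map_transport Q d]
  conv_rhs => rw [sum_terms (Q.decoration o a b), map_sum]
  rfl

end Word

/-! ### The invariant as a state sum. -/

section Sums

variable {k A : Type*} [Field k] [Ring A] [Algebra k A] {tr : A →ₗ[k] k} {g : Extremum → A}
  {dec dec' : Bool → Dir → Dir → A ⊗[k] A}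

/-- The slices above see the labels of a crossing only through a functional on `A ⊗ A`, so any
finite family that represents the decoration gives the same sum. At extrema the labels are not used
and only their number counts. -/
theorem sum_stateSum_act {ι : Type*} {S : Finset ι} {u : ι → A × A} {p : Piece} {L R : List Dir}
    {Y : List Slice} {σ : Link A} (hY : Composes (L ++ p.cod ++ R) Y [])
    (hv : σ.Valid (L ++ p.dom ++ R))
    (h : ∀ o a b, p = .cross o a b → ∑ i ∈ S, (u i).1 ⊗ₜ[k] (u i).2 = dec o a b)
    (h' : (∀ o a b, p ≠ .cross o a b) → S.card = 1) :
    ∑ i ∈ S, stateSum dec' tr g Y (σ.act g p L.length (u i)) =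
      ∑ x ∈ pieceLabels dec p, stateSum dec' tr g Y (σ.act g p L.length x) := by
  rcases p with ⟨o, a, b⟩ | a | a
  · obtain ⟨F, hF⟩ := exists_lift_cross (dec := dec') (tr := tr) (g := g) hY hv
    obtain ⟨F', hF'⟩ : ∃ F' : A ⊗[k] A →ₗ[k] k, ∀ x : A × A,
        stateSum dec' tr g Y (σ.act g (.cross o a b) L.length x) = F' (x.1 ⊗ₜ x.2) := by
      cases o
      · exact ⟨F ∘ₗ (TensorProduct.comm k A A).toLinearMap, fun x => hF _ _⟩
      · exact ⟨F, fun x => hF _ _⟩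
    simp only [hF', ← map_sum, h _ _ _ rfl, pieceLabels, ← sum_terms]
  all_goals
    obtain ⟨i, rfl⟩ := Finset.card_eq_one.1 (h' (by simp))
    simp [pieceLabels, act]

theorem sum_piFinset_succ {ι M : Type*} [AddCommMonoid M] {n : ℕ} (S : Fin (n + 1) → Finset ι)
    (f : (Fin (n + 1) → ι) → M) : ∑ x ∈ Fintype.piFinset S, f x =
      ∑ x ∈ S 0, ∑ y ∈ Fintype.piFinset fun i => S i.succ, f (Fin.cons x y) := by
  rw [← Finset.sum_product']
  refine Finset.sum_nbij' (fun x => (x 0, Fin.tail x)) (fun x => Fin.cons x.1 x.2) ?_ ?_ ?_ ?_ ?_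
  · intro x hx
    simp only [Fintype.mem_piFinset, Finset.mem_product] at hx ⊢
    exact ⟨hx 0, fun i => hx i.succ⟩
  · rintro ⟨x, y⟩ hx
    simp only [Fintype.mem_piFinset, Finset.mem_product] at hx ⊢
    exact fun i => Fin.cases hx.1 hx.2 i
  · intro x _
    simp
  · rintro ⟨x, y⟩ _
    simp
  · intro x _
    simp

/-- One sum over labellings of all slices becomes the iterated sum of the state sum. The change of
labels `φ` is admissible because it turns the tensor `dec` into `dec'`. -/
theorem sum_value {φ : Piece → A × A → A × A}
    (hφ : ∀ o a b, ∑ x ∈ terms (dec o a b), (φ (.cross o a b) x).1 ⊗ₜ[k] (φ (.cross o a b) x).2 =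
      dec' o a b) {Y : List Slice} {lv : List Dir} {σ : Link A} (hY : Composes lv Y [])
    (hv : σ.Valid lv) :
    ∑ f ∈ Fintype.piFinset fun c : Fin Y.length => pieceLabels dec Y[c].piece,
      value tr g Y (extendLabels φ Y f) σ = stateSum dec' tr g Y σ := by
  induction Y generalizing lv σ with
  | nil => simp [value, stateSum]
  | cons s Y ih =>
    obtain ⟨rfl, hY⟩ := hY
    refine (sum_piFinset_succ (n := Y.length) _ _).trans ?_
    rw [stateSum, ← Finset.mul_sum]
    rw [← sum_stateSum_act (S := pieceLabels dec s.piece) (u := φ s.piece) hY hv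
      (by rintro o a b h; rw [h]; exact hφ o a b) (by
        intro h
        obtain ⟨L, p, R⟩ := s
        rcases p with ⟨o, a, b⟩ | a | a
        · exact absurd rfl (h o a b)
        · rfl
        · rfl)]
    rw [Finset.mul_sum]
    refine Finset.sum_congr rfl fun x _ => ?_
    have := ih hY (hv.act g s.piece (φ s.piece x))
    rw [← this, Finset.mul_sum]
    refine Finset.sum_congr rfl fun f _ => ?_
    rw [value]
    congr 2
    funext i
    simp [extendLabels]
    rfl

theorem labels_eq (Q : OrientedQuantumAlgebra k A) (p : Piece) :
    Q.labels p = pieceLabels Q.decoration p := by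
  cases p <;> rfl

theorem Diagram.beads_extremumTurn {n : ℕ} (w : List ((ℕ × ℕ) × Option (Encounter n))) :
    beads extremumTurn 1 w = .ofAdd (-Encounter.ud (w.filterMap Prod.snd) -
      Encounter.uu (w.filterMap Prod.snd)) := by
  induction w with
  | nil => simp [beads, Encounter.ud, Encounter.uu]
  | cons x w ih =>
    obtain ⟨x, e⟩ := x
    rw [beads_cons, ih]
    rcases e with _ | c | c | (_ | _ | _ | _)
    · simp [bead]
    · simp [bead, Encounter.ud, Encounter.uu]
    · simp [bead, Encounter.ud, Encounter.uu]
    all_goals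
      simp only [bead, extremumTurn, List.filterMap_cons, Encounter.ud, Encounter.uu, ← ofAdd_add]
      congr 1
      omega

namespace Diagram.IsKnot

variable {K : Diagram} {p : ℕ × ℕ}

theorem composes (hK : K.IsKnot) : Composes K.bottom K.slices [] := by
  rw [hK.1]
  exact hK.2.1

theorem trail_walk (hK : K.IsKnot) (hp : K.HasPoint p) :
    K.Trail p (K.walk K.numPoints p) p := by
  -- Only the existence of a closed trail is wanted, so labels and motive are trivial.
  obtain ⟨a, i, σ, w, -, -, hw, hn, hl, -⟩ := hK.exists_closed (M := ℤ) 1 1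
    (fun _ _ _ => True) trivial fun _ _ _ _ _ _ _ => trivial
  obtain ⟨u, v, rfl, h₁, h₂, -, h⟩ := hK.walk_rotate hw hn hl hp
  rw [h]
  exact h₂.append h₁

/-- The traversal ends in the direction in which it began, so `ud = uu`; the sum of the turns, `-ud
- uu`, is therefore `-2 uu`. -/
theorem whitney_eq (hK : K.IsKnot) (hp : K.HasPoint p) :
    K.whitney = -Encounter.uu (K.encounters p) := by
  obtain ⟨d, hd⟩ := Option.isSome_iff_exists.1 hp
  have h₁ := (hK.trail_walk hp).dirAt_eq hK.composes hd hd
  have h₂ := hK.beads_turn hp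
  rw [beads_extremumTurn] at h₂
  have h₃ := Multiplicative.ofAdd.injective h₂
  rw [whitney, ← h₃, encounters]
  omega

end Diagram.IsKnot

/-- The power `G ^ d` cancels the leading power of `G` in `Trail.word_eq` and leaves the trace of
the product of the labels. The right-hand side involves neither the starting point nor more of `Q`
than its standard algebra. -/
theorem inv_eq_stateSum {Q : OrientedQuantumAlgebra k A} {G : Aˣ}
    (hG : ∀ x : A, Q.td (Q.tu x) = (G : A) * x * (↑G⁻¹ : A)) (htr : Tracelike tr)
    {K : Diagram} (hK : K.IsKnot) {p : ℕ × ℕ} (hp : K.HasPoint p) : Q.inv G tr K p =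
      stateSum Q.standard.decoration tr (extremumLabel G) K.slices (Link.empty A) := by
  obtain ⟨d, hd⟩ := Option.isSome_iff_exists.1 hp
  rw [← sum_value (sum_transport Q d) hK.2.1 (empty_valid A), inv, w, Finset.mul_sum, map_sum]
  simp only [labels_eq]
  refine Finset.sum_congr rfl fun f _ => ?_
  rw [hK.value_eq htr _ _ hp, Diagram.encounters,
    (hK.trail_walk hp).word_eq hG hK.composes hd f, hK.whitney_eq hp, ← mul_assoc,
    ← Units.val_mul, ← zpow_add, Diagram.encounters, neg_add_cancel, zpow_zero, Units.val_one,
    one_mul]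

end Sums


/-! ### Regular isotopy, and the standard algebra. -/

open Link OrientedQuantumAlgebra

section Isotopy

variable {k A : Type*} [Field k] [Ring A] [Algebra k A] {tr : A →ₗ[k] k} {G : Aˣ}
  {dec : Bool → Dir → Dir → A ⊗[k] A} {K K' : Diagram}

theorem stateSum_regularlyIsotopic (htr : Tracelike tr) (hdec : Relations dec G)
    (h : K.RegularlyIsotopic K') :
    stateSum dec tr (extremumLabel G) K.slices (empty A) =
      stateSum dec tr (extremumLabel G) K'.slices (empty A) := by
  induction h with
  | rel K K' h => exact stateSum_move htr hdec h.1.2.1 h.2.2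
  | refl => rfl
  | symm _ _ _ ih => exact ih.symm
  | trans _ _ _ _ _ ih₁ ih₂ => exact ih₁.trans ih₂

theorem Diagram.RegularlyIsotopic.isKnot_iff (h : K.RegularlyIsotopic K') :
    K.IsKnot ↔ K'.IsKnot := by
  induction h with
  | rel K K' h => exact iff_of_true h.1 h.2.1
  | refl => rfl
  | symm _ _ _ ih => exact ih.symm
  | trans _ _ _ _ _ ih₁ ih₂ => exact ih₁.trans ih₂

theorem LocalMove.sum_turn {X Y : List Slice} (h : LocalMove X Y) :
    (X.map fun s => s.piece.turn).sum = (Y.map fun s => s.piece.turn).sum := by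
  cases h with
  | interchange p q m => simp [add_comm]
  | maxMin a => cases a <;> simp [Piece.turn, Dir.flip]
  | minMax a => cases a <;> simp [Piece.turn, Dir.flip]
  | cancel o a b => simp [Piece.turn]
  | triangle o a b c => simp [Piece.turn]
  | slideMax o a c => simp [Piece.turn]
  | slideMin o a c => simp [Piece.turn]

theorem Diagram.RegularlyIsotopic.whitney_eq (h : K.RegularlyIsotopic K') :
    K.whitney = K'.whitney := by
  induction h with
  | rel K K' h =>
    obtain ⟨b, l, r, X, Y, L, R, hL⟩ := h.2.2
    have := hL.sum_turn
    simp only [Diagram.whitney, List.map_append, List.sum_append, List.map_map,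
      Function.comp_def, Slice.whisker, this]
  | refl => rfl
  | symm _ _ _ ih => exact ih.symm
  | trans _ _ _ _ _ ih₁ ih₂ => exact ih₁.trans ih₂

/-- Passing to the standard algebra a second time does not change the decorations, so both scalars
have the same state sum. -/
theorem inv_standard {Q : OrientedQuantumAlgebra k A}
    (hG : ∀ x : A, Q.td (Q.tu x) = (G : A) * x * (↑G⁻¹ : A)) (htr : Tracelike tr)
    (hK : K.IsKnot) {p p' : ℕ × ℕ} (hp : K.HasPoint p) (hp' : K.HasPoint p') :
    Q.standard.inv G tr K p = Q.inv G tr K p' := by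
  rw [inv_eq_stateSum hG htr hK hp', inv_eq_stateSum (Q := Q.standard) hG htr hK hp]
  rfl

end Isotopy

/-! ### Reversal of the orientation and the opposite algebra. -/

section Reverse

theorem downLeg_flip (l : ℕ) (a : Dir) : downLeg l a.flip = upLeg l a := by cases a <;> rfl

theorem upLeg_flip (l : ℕ) (a : Dir) : upLeg l a.flip = downLeg l a := by cases a <;> rfl

theorem Slice.reverse_dom (s : Slice) : s.reverse.dom = s.dom.map Dir.flip := by
  obtain ⟨L, p, R⟩ := s
  rcases p with ⟨o, a, b⟩ | a | a <;> simp [reverse, Slice.dom, Piece.dom, Piece.reverse]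

theorem Slice.reverse_cod (s : Slice) : s.reverse.cod = s.cod.map Dir.flip := by
  obtain ⟨L, p, R⟩ := s
  rcases p with ⟨o, a, b⟩ | a | a <;> simp [reverse, Slice.cod, Piece.cod, Piece.reverse]

theorem composes_reverse {a b : List Dir} {Y : List Slice} (h : Composes a Y b) :
    Composes (a.map Dir.flip) (Y.map Slice.reverse) (b.map Dir.flip) := by
  induction Y generalizing a with
  | nil =>
    obtain rfl : a = b := h
    rfl
  | cons s Y ih =>
    obtain ⟨rfl, h⟩ := h
    refine ⟨s.reverse_dom.symm, ?_⟩
    rw [s.reverse_cod]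
    exact ih h

namespace Diagram

variable {D : Diagram} {c : List Dir} {p q : ℕ × ℕ}

theorem levels_reverse (D : Diagram) : D.reverse.levels = D.levels.map (List.map Dir.flip) := by
  simp [levels, reverse, Function.comp_def, Slice.reverse_cod]

theorem dirAt_reverse (D : Diagram) (p : ℕ × ℕ) : D.reverse.dirAt p = (D.dirAt p).map Dir.flip := by
  rw [dirAt, dirAt, levels_reverse, ← List.getElem?_map]
  congr 1
  simp [List.getD_eq_getElem?_getD]
  cases D.levels[p.1]? <;> rfl

theorem hasPoint_reverse : D.reverse.HasPoint p ↔ D.HasPoint p := by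
  rw [HasPoint, HasPoint, dirAt_reverse, Option.isSome_map]

theorem numPoints_reverse (D : Diagram) : D.reverse.numPoints = D.numPoints := by
  simp [numPoints, levels_reverse, Function.comp_def]

theorem Step.reverse {e : Option (Encounter D.slices.length)} (h : D.Step p e q) :
    ∃ e', D.reverse.Step q e' p := by
  have hlen : D.reverse.slices.length = D.slices.length := by simp [Diagram.reverse]
  have hr : ∀ {i : ℕ} {s : Slice}, D.slices[i]? = some s → D.reverse.slices[i]? = some s.reverse :=
    fun h => by simp [Diagram.reverse, h]
  have hd' : ∀ {l : List Dir} {j : ℕ} {d : Dir}, l[j]? = some d → (l.map Dir.flip)[j]? = some d.flip :=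
    fun h => by simp [h]
  cases h with
  | @crossUp i j L R o a b hi hs hd =>
    have := Step.crossDown (hlen ▸ hi) (hr hs) (j := j) (by simpa [Dir.flip] using hd' hd)
    rw [List.length_map] at this
    exact ⟨_, this⟩
  | @crossDown i j L R o a b hi hs hd =>
    have := Step.crossUp (hlen ▸ hi) (hr hs) (j := j) (by simpa [Dir.flip] using hd' hd)
    rw [List.length_map] at this
    exact ⟨_, this⟩
  | @cupUp i j L R a hs hd =>
    have := Step.cupDown (hr hs) (j := j) (by simpa [Dir.flip] using hd' hd)
    rw [List.length_map] at this
    exact ⟨_, this⟩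
  | @cupDown i j L R a hs hd =>
    have := Step.cupUp (hr hs) (j := j) (by simpa [Dir.flip] using hd' hd)
    rw [List.length_map] at this
    exact ⟨_, this⟩
  | @cupLeg i L R a hs =>
    have := Step.cupLeg (hr hs)
    rw [List.length_map, downLeg_flip, upLeg_flip] at this
    exact ⟨_, this⟩
  | @capUp i j L R a hs hd =>
    have := Step.capDown (hr hs) (j := j) (by simpa [Dir.flip] using hd' hd)
    rw [List.length_map] at this
    exact ⟨_, this⟩
  | @capDown i j L R a hs hd =>
    have := Step.capUp (hr hs) (j := j) (by simpa [Dir.flip] using hd' hd)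
    rw [List.length_map] at this
    exact ⟨_, this⟩
  | @capLeg i L R a hs =>
    have := Step.capLeg (hr hs)
    rw [List.length_map, downLeg_flip, upLeg_flip] at this
    exact ⟨_, this⟩

theorem Trail.reverse {w : List ((ℕ × ℕ) × Option (Encounter D.slices.length))}
    (hD : Composes D.bottom D.slices c) (h : D.Trail p w q) :
    ∃ w', D.reverse.Trail q w' p ∧ w'.map Prod.fst ++ [p] = (w.map Prod.fst ++ [q]).reverse := by
  induction h with
  | nil => exact ⟨[], .nil _, rfl⟩
  | @cons p q r e w h hw ih =>
    obtain ⟨w', h₁, h₂⟩ := ih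
    obtain ⟨e', h₃⟩ := (step_of_visit hD h).reverse
    refine ⟨_, h₁.append (.single (h₃.visit (composes_reverse hD))), ?_⟩
    simp [← h₂]

theorem length_walk_le (m : ℕ) (p : ℕ × ℕ) : (D.walk m p).length ≤ m := by
  induction m generalizing p with
  | zero => simp [walk]
  | succ m ih =>
    rw [walk]
    split
    · simp
    · simpa using ih _

theorem walk_ne_nil (hp : D.HasPoint p) : D.walk D.numPoints p ≠ [] := by
  have : 0 < D.numPoints := by
    rw [← card_points, Finset.card_pos]
    exact ⟨p, mem_points.2 hp⟩
  obtain ⟨m, hm⟩ := Nat.exists_eq_add_of_lt this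
  rw [hm, walk]
  split <;> simp

/-- A full traversal read backwards is a closed trail of the reversed diagram with `numPoints`
points, hence the full traversal there. -/
theorem IsKnot.reverse (hD : D.IsKnot) : D.reverse.IsKnot := by
  refine ⟨by simp [Diagram.reverse, hD.1], composes_reverse hD.2.1,
    by simpa [Diagram.reverse] using hD.2.2.1, fun p hp q hq => ?_⟩
  rw [hasPoint_reverse] at hp hq
  have hw := hD.trail_walk hp
  have hn := walk_ne_nil hp
  obtain ⟨w', h₁, h₂⟩ := hw.reverse hD.composes
  have hl : w'.length = D.reverse.numPoints := by
    rw [numPoints_reverse]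
    have := congrArg List.length h₂
    simp only [List.length_append, List.length_map, List.length_reverse] at this
    have h₃ := length_walk_le (D := D) D.numPoints p
    have h₄ := hD.numPoints_le hw hn
    omega
  rw [← hl, h₁.walk_length]
  have hq' : q ∈ w'.map Prod.fst ++ [p] := by
    rw [h₂, List.mem_reverse]
    exact List.mem_append_left _ ((hD.2.2.2 p hp).mem_of_closed hw hn hq)
  obtain h | h := List.mem_append.1 hq'
  · exact h
  · obtain rfl := List.mem_singleton.1 h
    refine h₁.mem_of_ne_nil fun h => hn ?_
    rw [h] at hl
    rw [numPoints_reverse] at hl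
    rw [← hl]
    rfl

end Diagram

section Opposite

open MulOpposite

variable {k A : Type*} [Field k] [Ring A] [Algebra k A] {G : Aˣ}

/-- The reversal of the orientations of all arcs of a link. -/
structure Link.Reversed (G : Aˣ) (σ : Link Aᵐᵒᵖ) (σ' : Link A) (lv : List Dir) : Prop where
  mate : σ'.mate = σ.mate
  word : ∀ j, lv[j]? = some .down → σ'.word (σ.mate j) = unop (σ.word j) * ↑G⁻¹

/-- Conjugation by `G` if the direction is down. -/
def conjDown (G : Aˣ) : Dir → A → A
  | .up, x => x
  | .down, x => G * x * ↑G⁻¹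

/-- The labels of a crossing after reversal of the orientations. -/
def reverseLabels (G : Aˣ) (p : Piece) (x : Aᵐᵒᵖ × Aᵐᵒᵖ) : A × A :=
  (conjDown G p.overDir (unop x.1), conjDown G p.underDir (unop x.2))

/-- Under reversal the label of a maximum gains `G` on the left and that of a minimum gains `G⁻¹` on
the right. An arc below a level has one minimum more than it has maxima, which accounts for the
factor `G⁻¹` in `Reversed`; on a closed loop the factors cancel. -/
theorem extremumLabel_cap (G : Aˣ) (a : Dir) : (↑G⁻¹ : A) * extremumLabel G (capType a.flip) =
    unop (extremumLabel (invOp G) (capType a)) := by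
  cases a
  · exact mul_one _
  · exact Units.inv_mul G

theorem extremumLabel_cup (G : Aˣ) (a : Dir) : extremumLabel G (cupType a.flip) =
    unop (extremumLabel (invOp G) (cupType a)) * ↑G⁻¹ := by
  cases a
  · exact (one_mul _).symm
  · exact (Units.mul_inv G).symm

theorem slash_reverseLabels (o : Bool) (a b : Dir) (x : Aᵐᵒᵖ × Aᵐᵒᵖ) :
    slash o (reverseLabels G (.cross o a b) x) = conjDown G a (unop (slash o x)) := by
  cases o <;> rfl

theorem backslash_reverseLabels (o : Bool) (a b : Dir) (x : Aᵐᵒᵖ × Aᵐᵒᵖ) :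
    backslash o (reverseLabels G (.cross o a b) x) = conjDown G b (unop (backslash o x)) := by
  cases o <;> rfl

theorem crossLabel_conjDown {L R : List Dir} {a b d : Dir} {j : ℕ} (x y : Aᵐᵒᵖ)
    (h : (L ++ [a, b] ++ R)[j]? = some d) :
    crossLabel L.length (conjDown G a (unop x)) (conjDown G b (unop y)) j =
      conjDown G d (unop (crossLabel L.length x y j)) := by
  simp only [crossLabel]
  split_ifs with h₁ h₂
  · rw [h₁, getElem?_left] at h
    rw [Option.some.inj h]
  · rw [h₂, getElem?_right] at h
    rw [Option.some.inj h]
  · cases d <;> simp [conjDown]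

theorem Link.Valid.reverse {M M' : Type*} {σ : Link M} {σ' : Link M'} {lv : List Dir}
    (hv : σ.Valid lv) (h : σ'.mate = σ.mate) : σ'.Valid (lv.map Dir.flip) := by
  refine ⟨h ▸ hv.mate_mate, fun j d hj => ?_⟩
  rw [List.getElem?_map, Option.map_eq_some_iff] at hj
  obtain ⟨d, hj, rfl⟩ := hj
  rw [h, List.getElem?_map, hv.mate_dir _ _ hj]
  rfl

/-- The label that a reversed arc meets last comes after the factor `G⁻¹`, which has to stay at the
end. This label lies on a line formerly directed down, and conjugating it by `G` restores the order;
hence `conjDown`. -/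
theorem Link.Reversed.act {σ : Link Aᵐᵒᵖ} {σ' : Link A} {L R : List Dir} {p : Piece}
    (x : Aᵐᵒᵖ × Aᵐᵒᵖ) (hv : σ.Valid (L ++ p.dom ++ R)) (h : σ.Reversed G σ' (L ++ p.dom ++ R)) :
    (σ.act (extremumLabel (invOp G)) p L.length x).Reversed G
      (σ'.act (extremumLabel G) p.reverse L.length (reverseLabels G p x)) (L ++ p.cod ++ R) := by
  have hv' := hv.reverse h.mate
  rcases p with ⟨o, a, b⟩ | a | a
  · have e : σ'.act (extremumLabel G) (Piece.cross o a b).reverse L.length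
        (reverseLabels G (.cross o a b) x) = σ'.cross L.length a.flip b.flip
          (conjDown G a (unop (slash o x))) (conjDown G b (unop (backslash o x))) := by
      rw [← slash_reverseLabels o a b, ← backslash_reverseLabels o a b]
      rfl
    have e' : σ.act (extremumLabel (invOp G)) (.cross o a b) L.length x =
      σ.cross L.length a b (slash o x) (backslash o x) := rfl
    rw [e, e']
    refine ⟨by simp only [cross, h.mate], fun j hj => ?_⟩
    obtain ⟨j, rfl⟩ : ∃ j', swapAt L.length j' = j := ⟨_, swapAt_swapAt _ j⟩
    simp only [Piece.cod] at hj
    rw [getElem?_swapAt] at hj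
    have hm := hv.mate_dir _ _ hj
    simp only [Piece.dom] at hm
    have hv₁ : σ'.Valid (L.map Dir.flip ++ [a.flip, b.flip] ++ R.map Dir.flip) := by
      simpa [Piece.dom] using hv'
    have hm' : (L.map Dir.flip ++ [a.flip, b.flip] ++ R.map Dir.flip)[σ.mate j]? =
        some .down := by
      have : (L ++ [a, b] ++ R).map Dir.flip =
        L.map Dir.flip ++ [a.flip, b.flip] ++ R.map Dir.flip := by simp
      rw [← this, List.getElem?_map, hm]
      rfl
    have hw := cross_word hv₁ (x := conjDown G a (unop (slash o x)))
      (y := conjDown G b (unop (backslash o x))) hm'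
    rw [List.length_map] at hw
    rw [cross_mate_swapAt, hw, cross_word hv hj, crossLabel_conjDown _ _ hm, h.mate, hv.mate_mate,
      crossLabel_conjDown _ _ hj, h.word _ hj]
    simp [conjDown, mul_assoc, Dir.flip]
  · have hv₁ : σ'.Valid (L.map Dir.flip ++ [a.flip, a.flip.flip] ++ R.map Dir.flip) := by
      simpa [Piece.dom] using hv'
    refine ⟨by simp only [Link.act, Piece.reverse, cap, h.mate], fun j hj => ?_⟩
    simp only [Link.act, Piece.reverse]
    have hj' := hj
    have hmate := cap_mate_insAt_ne hv (extremumLabel (invOp G) (capType a)) j hj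
    have hw := cap_word hv (extremumLabel (invOp G) (capType a)) j hj
    have hc := (hv.act (extremumLabel (invOp G)) (.cap a) x).mate_dir _ _ hj
    generalize hm : (σ.cap L.length a (extremumLabel (invOp G) (capType a))).mate j = m at *
    have hm₁ : (L.map Dir.flip ++ [] ++ R.map Dir.flip)[m]? = some .down := by
      have : (L ++ [] ++ R).map Dir.flip = L.map Dir.flip ++ [] ++ R.map Dir.flip := by simp
      rw [← this, List.getElem?_map]
      simp only [Link.act, hm] at hc
      have hc : (L ++ [] ++ R)[m]? = some .up := hc
      rw [hc]
      rfl
    have hw' := cap_word hv₁ (extremumLabel G (capType a.flip)) m hm₁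
    rw [List.length_map] at hw'
    rw [hw, hw', hmate]
    simp only [Piece.cod] at hj
    rw [← getElem?_insAt a a.flip] at hj
    rw [h.mate, upLeg_flip, downLeg_flip]
    split_ifs with h₁ h₂ h₂
    · rw [h.word _ (getElem?_downLeg a), ← h₁, h.word _ hj, mul_assoc (unop _),
        extremumLabel_cap]
      simp [mul_assoc]
    · exact absurd (hv.mate_mate _) h₂
    · rw [hv.mate_mate] at h₂
      obtain ⟨h₃, h₄⟩ := insAt_ne L.length j
      cases a <;> simp_all [downLeg]
    · exact h.word _ hj
  · refine ⟨by simp only [Link.act, Piece.reverse, cup, h.mate], fun j hj => ?_⟩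
    simp only [Link.act, Piece.cod, Piece.reverse] at hj ⊢
    obtain rfl | ⟨i, rfl⟩ : j = downLeg L.length a ∨ ∃ i, j = insAt L.length i := by
      cases a
      · obtain rfl | h | h := eq_or_insAt L.length j
        · rw [getElem?_left] at hj
          simp at hj
        · exact .inl h
        · exact .inr h
      · obtain h | rfl | h := eq_or_insAt L.length j
        · exact .inl h
        · rw [getElem?_right] at hj
          simp [Dir.flip] at hj
        · exact .inr h
    · have hm : (σ.cup L.length a (extremumLabel (invOp G) (cupType a))).mate
          (downLeg L.length a) = downLeg L.length a.flip := by
        cases a <;> simp [cup, downLeg, Dir.flip]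
      rw [hm, cup_word_downLeg, cup_word_downLeg, extremumLabel_cup]
    · rw [getElem?_insAt] at hj
      rw [cup_mate_insAt, cup_word_insAt, cup_word_insAt, h.word]
      simpa [Piece.dom] using hj

theorem Link.Reversed.closing_eq {tr : A →ₗ[k] k} (htr : Tracelike tr) {σ : Link Aᵐᵒᵖ} {σ' : Link A}
    {L R : List Dir} {p : Piece} (hv : σ.Valid (L ++ p.dom ++ R))
    (h : σ.Reversed G σ' (L ++ p.dom ++ R)) :
    closing tr (extremumLabel G) p.reverse L.length σ' =
      closing (trOp tr) (extremumLabel (invOp G)) p L.length σ := by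
  rcases p with ⟨o, a, b⟩ | a | a
  · rfl
  · have hi : σ.mate (upLeg L.length a) = downLeg L.length a ↔
        σ.mate (downLeg L.length a) = upLeg L.length a :=
      ⟨fun e => by rw [← e, hv.mate_mate], fun e => by rw [← e, hv.mate_mate]⟩
    simp only [closing, Piece.reverse, downLeg_flip, upLeg_flip, h.mate, hi]
    split_ifs with hm
    · have hw := h.word _ (getElem?_downLeg a)
      rw [hm, Link.word, Link.word, h.mate, hi.2 hm, hm] at hw
      rw [hw, mul_assoc, extremumLabel_cap, htr]
      rfl
    · rfl
  · rfl

variable (Q : OrientedQuantumAlgebra k A)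

theorem decoration_op_standard (o : Bool) (a b : Dir) :
    Q.op.standard.decoration o a b = opOp k A A (Q.standard.decoration o a b) := by
  have e : (LinearMap.id : A →ₗ[k] A) = (AlgEquiv.refl : A ≃ₐ[k] A).toLinearMap := rfl
  have e' : (LinearMap.id : Aᵐᵒᵖ →ₗ[k] Aᵐᵒᵖ) =
    (AlgEquiv.op (AlgEquiv.refl : A ≃ₐ[k] A)).toLinearMap := rfl
  have e'' : (AlgEquiv.refl : Aᵐᵒᵖ ≃ₐ[k] Aᵐᵒᵖ) = AlgEquiv.op (AlgEquiv.refl : A ≃ₐ[k] A) := rfl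
  have e₃ : (AlgEquiv.op Q.tu).trans (AlgEquiv.op Q.td) = AlgEquiv.op (Q.tu.trans Q.td) := rfl
  have hr : (Q.op.rho : Aᵐᵒᵖ ⊗[k] Aᵐᵒᵖ) = opOp k A A Q.rho := rfl
  have hi : (↑Q.op.rho⁻¹ : Aᵐᵒᵖ ⊗[k] Aᵐᵒᵖ) = opOp k A A (↑Q.rho⁻¹ : A ⊗[k] A) := rfl
  have hd : Q.op.td = AlgEquiv.op Q.td := rfl
  have hu : Q.op.tu = AlgEquiv.op Q.tu := rfl
  cases o <;> cases a <;> cases b <;>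
    simp only [decoration, standard, e, e', e'', e₃, hr, hi, hd, hu, map_opOp]

/-- Conjugation by `G` is `θ`, and applying `θ` on the lines directed down turns each standard
decoration into that of the reversed directions, by `(θ ⊗ θ)(ρ) = ρ`. -/
theorem sum_reverseLabels (hG : ∀ x : A, Q.td (Q.tu x) = (G : A) * x * (↑G⁻¹ : A))
    (o : Bool) (a b : Dir) : ∑ x ∈ terms (Q.op.standard.decoration o a b),
      (reverseLabels G (.cross o a b) x).1 ⊗ₜ[k] (reverseLabels G (.cross o a b) x).2 =
        Q.standard.decoration o a.flip b.flip := by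
  let t : Dir → A ≃ₐ[k] A
    | .up => 1
    | .down => Q.td * Q.tu
  have ht : ∀ d x, conjDown G d x = t d x := by
    rintro (_ | _) x
    · rfl
    · exact (hG x).symm
  have hU : ∀ x : A ⊗[k] A, TensorProduct.map (opLinearEquiv k).symm.toLinearMap
      (opLinearEquiv k).symm.toLinearMap (opOp k A A x) = x := by
    intro x
    induction x using TensorProduct.induction_on with
    | zero => simp
    | add x y hx hy => simp only [map_add, hx, hy]
    | tmul a b => simp [opOp]
  have h₁ := Q.standardPair.map_map
  have h₂ := Q.standardPair.map_map_inv
  have e : Q.tu.trans Q.td = Q.td * Q.tu := rfl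
  have e' : (AlgEquiv.refl : A ≃ₐ[k] A) = 1 := rfl
  have e'' : (LinearMap.id : A →ₗ[k] A) = (1 : A ≃ₐ[k] A).toLinearMap := rfl
  rw [e] at h₁ h₂
  have h : TensorProduct.map (t (Piece.cross o a b).overDir).toLinearMap
      (t (Piece.cross o a b).underDir).toLinearMap (Q.standard.decoration o a b) =
      Q.standard.decoration o a.flip b.flip := by
    cases o <;> cases a <;> cases b <;>
      simp only [Piece.overDir, Piece.underDir, t, Dir.flip, decoration, standard, e, e', e'',
        ← map_mul_equiv, mul_one, one_mul, map_one_equiv, h₁, h₂, if_true, Bool.false_eq_true,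
        if_false]
  rw [← h]
  conv_rhs => rw [← hU (Q.standard.decoration o a b), ← decoration_op_standard,
    sum_terms (Q.op.standard.decoration o a b), map_sum, map_sum]
  refine Finset.sum_congr rfl fun x _ => ?_
  simp [reverseLabels, ht]

theorem stateSum_reverse {tr : A →ₗ[k] k} (htr : Tracelike tr)
    (hG : ∀ x : A, Q.td (Q.tu x) = (G : A) * x * (↑G⁻¹ : A)) {Y : List Slice} {lv : List Dir}
    {σ : Link Aᵐᵒᵖ} {σ' : Link A} (hY : Composes lv Y []) (hv : σ.Valid lv)
    (h : σ.Reversed G σ' lv) :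
    stateSum Q.standard.decoration tr (extremumLabel G) (Y.map Slice.reverse) σ' =
      stateSum Q.op.standard.decoration (trOp tr) (extremumLabel (invOp G)) Y σ := by
  induction Y generalizing lv σ σ' with
  | nil => rfl
  | cons s Y ih =>
    obtain ⟨rfl, hY⟩ := hY
    have hv' := hv.reverse h.mate
    rw [← s.reverse_dom] at hv'
    have hY' := composes_reverse hY
    rw [← s.reverse_cod] at hY'
    have hl : s.reverse.left.length = s.left.length := List.length_map _
    rw [List.map_cons, stateSum, stateSum, ← Finset.mul_sum, ← Finset.mul_sum,
      ← sum_stateSum_act (S := pieceLabels Q.op.standard.decoration s.piece)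
        (u := reverseLabels G s.piece) hY' hv' ?_ ?_, hl]
    · congr 1
      · exact h.closing_eq htr hv
      · exact Finset.sum_congr rfl fun x _ => ih hY (hv.act _ _ _) (h.act x hv)
    · intro o a b e
      obtain ⟨L, p, R⟩ := s
      rcases p with ⟨o', a', b'⟩ | a | a
      · obtain ⟨rfl, rfl, rfl⟩ : o' = o ∧ a'.flip = a ∧ b'.flip = b := by
          simpa [Slice.reverse, Piece.reverse] using e
        exact sum_reverseLabels Q hG _ _ _
      · cases e
      · cases e
    · intro e
      obtain ⟨L, p, R⟩ := s
      rcases p with ⟨o, a, b⟩ | a | a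
      · exact absurd rfl (e o a.flip b.flip)
      · rfl
      · rfl

theorem inv_reverse {tr : A →ₗ[k] k} (htr : Tracelike tr)
    (hG : ∀ x : A, Q.td (Q.tu x) = (G : A) * x * (↑G⁻¹ : A)) {K : Diagram} (hK : K.IsKnot)
    {p p' : ℕ × ℕ} (hp : K.reverse.HasPoint p) (hp' : K.HasPoint p') :
    Q.inv G tr K.reverse p = Q.op.inv (invOp G) (trOp tr) K p' := by
  have htr' : Tracelike (trOp tr) := fun a b => htr _ _
  have hG' : ∀ x : Aᵐᵒᵖ, Q.op.td (Q.op.tu x) =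
      (invOp G : Aᵐᵒᵖ) * x * (↑(invOp G)⁻¹ : Aᵐᵒᵖ) := by
    intro x
    apply unop_injective
    refine (hG (unop x)).trans ?_
    exact mul_assoc _ _ _
  rw [inv_eq_stateSum hG htr hK.reverse hp, inv_eq_stateSum hG' htr' hK hp']
  exact stateSum_reverse Q htr hG hK.2.1 (empty_valid _) ⟨rfl, by simp⟩

end Opposite

end Reverse


/-! ### Closures of tangles. -/

open Link OrientedQuantumAlgebra

/-- Rename the crossings. -/
def Encounter.map {m n : ℕ} (φ : Fin m → Fin n) : Encounter m → Encounter n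
  | .over c => .over (φ c)
  | .under c => .under (φ c)
  | .extremum x => .extremum x

theorem Encounter.ud_map {m n : ℕ} (φ : Fin m → Fin n) (es : List (Encounter m)) :
    ud (es.map (Encounter.map φ)) = ud es := by
  induction es with
  | nil => rfl
  | cons e es ih => rcases e with c | c | (_ | _ | _ | _) <;> simp [Encounter.map, ud, ih]

theorem Encounter.uu_map {m n : ℕ} (φ : Fin m → Fin n) (es : List (Encounter m)) :
    uu (es.map (Encounter.map φ)) = uu es := by
  induction es with
  | nil => rfl
  | cons e es ih => rcases e with c | c | (_ | _ | _ | _) <;> simp [Encounter.map, uu, ih]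

theorem Encounter.ud_append {n : ℕ} (es es' : List (Encounter n)) :
    ud (es ++ es') = ud es + ud es' := by
  induction es with
  | nil => simp [ud]
  | cons e es ih => rcases e with c | c | (_ | _ | _ | _) <;> simp [ud, ih] <;> omega

theorem Encounter.uu_append {n : ℕ} (es es' : List (Encounter n)) :
    uu (es ++ es') = uu es + uu es' := by
  induction es with
  | nil => simp [uu]
  | cons e es ih => rcases e with c | c | (_ | _ | _ | _) <;> simp [uu, ih] <;> omega

section Word

variable {k A : Type*} [Field k] [Ring A] [Algebra k A] (Q : OrientedQuantumAlgebra k A)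

theorem OrientedQuantumAlgebra.word_map {m n : ℕ} (φ : Fin m → Fin n) (f : Fin n → A × A)
    (es : List (Encounter m)) : Q.word f (es.map (Encounter.map φ)) = Q.word (f ∘ φ) es := by
  induction es with
  | nil => rfl
  | cons e es ih =>
    rcases e with c | c | x <;>
      simp only [List.map_cons, Encounter.map, OrientedQuantumAlgebra.word, Encounter.ud_map,
        Encounter.uu_map, ih, Function.comp_apply]

theorem OrientedQuantumAlgebra.word_append {n : ℕ} (f : Fin n → A × A) (es es' : List (Encounter n)) :
    Q.word f (es ++ es') = (Q.td ^ Encounter.ud es') ((Q.tu ^ Encounter.uu es') (Q.word f es)) *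
      Q.word f es' := by
  have hc : Commute Q.td Q.tu := AlgEquiv.ext Q.td_tu
  have h : ∀ (m n m' n' : ℤ) (x : A), (Q.td ^ (m + m')) ((Q.tu ^ (n + n')) x) =
      (Q.td ^ m') ((Q.tu ^ n') ((Q.td ^ m) ((Q.tu ^ n) x))) := by
    intro m n m' n' x
    simp only [← AlgEquiv.mul_apply]
    congr 1
    rw [add_comm, add_comm n, zpow_add, zpow_add]
    simp only [mul_assoc]
    rw [(hc.zpow_zpow m n').left_comm]
  induction es with
  | nil => simp [OrientedQuantumAlgebra.word]
  | cons e es ih =>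
    rcases e with c | c | x <;>
      simp only [List.cons_append, OrientedQuantumAlgebra.word, Encounter.ud_append,
        Encounter.uu_append, ih, h, map_mul, mul_assoc]

/-- For the closure of a tangle, `φ` embeds the slices of the tangle, and `d` is the dummy pair at
the two added extrema. -/
theorem sum_piFinset_comp {ι κ μ M : Type*} [Fintype ι] [DecidableEq ι] [Fintype κ] [DecidableEq κ]
    [AddCommMonoid M] {φ : ι → κ} (hφ : Function.Injective φ) (S : κ → Finset μ) (d : μ)
    (hS : ∀ c, (∀ i, φ i ≠ c) → S c = {d}) (h : (ι → μ) → M) :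
    ∑ f ∈ Fintype.piFinset S, h (f ∘ φ) = ∑ f ∈ Fintype.piFinset fun i => S (φ i), h f := by
  refine Finset.sum_nbij' (fun f => f ∘ φ) (fun f => Function.extend φ f fun _ => d) ?_ ?_ ?_ ?_ ?_
  · intro f hf
    rw [Fintype.mem_piFinset] at hf ⊢
    exact fun i => hf _
  · intro f hf
    rw [Fintype.mem_piFinset] at hf ⊢
    intro c
    by_cases hc : ∃ i, φ i = c
    · obtain ⟨i, rfl⟩ := hc
      rw [hφ.extend_apply]
      exact hf i
    · rw [Function.extend_apply' _ _ _ hc, hS c fun i hi => hc ⟨i, hi⟩]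
      exact Finset.mem_singleton_self d
  · intro f hf
    rw [Fintype.mem_piFinset] at hf
    funext c
    by_cases hc : ∃ i, φ i = c
    · obtain ⟨i, rfl⟩ := hc
      rw [hφ.extend_apply]
      rfl
    · rw [Function.extend_apply' _ _ _ hc]
      have := hf c
      rw [hS c fun i hi => hc ⟨i, hi⟩, Finset.mem_singleton] at this
      exact this.symm
  · intro f _
    exact Function.extend_comp hφ f _
  · intro f _
    rfl

end Word

namespace Diagram

variable {T : Diagram} {a : Dir} {p q : ℕ × ℕ}

theorem length_closure (T : Diagram) (a : Dir) :
    (T.closure a).slices.length = T.slices.length + 2 := by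
  simp [closure]

/-- The index of a slice in the closure of a tangle diagram. -/
def closureIndex (T : Diagram) (a : Dir) (c : Fin T.slices.length) :
    Fin (T.closure a).slices.length :=
  ⟨c + 1, by have := c.2; rw [length_closure]; omega⟩

theorem closure_getElem? {i : ℕ} {s : Slice} (h : T.slices[i]? = some s) :
    (T.closure a).slices[i + 1]? = some (s.whisker [a.flip] []) := by
  obtain ⟨hi, rfl⟩ := List.getElem?_eq_some_iff.1 h
  simp [closure, List.getElem?_append, hi]

theorem swapAt_succ (l j : ℕ) : swapAt (l + 1) (j + 1) = swapAt l j + 1 := by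
  simp only [swapAt]
  split_ifs <;> omega

theorem insAt_succ (l j : ℕ) : insAt (l + 1) (j + 1) = insAt l j + 1 := by
  simp only [insAt]
  split_ifs <;> omega

theorem Step.closure {e : Option (Encounter T.slices.length)} (h : T.Step p e q) :
    (T.closure a).Step (p.1 + 1, p.2 + 1) (e.map (Encounter.map (T.closureIndex a)))
      (q.1 + 1, q.2 + 1) := by
  have hlen := length_closure T a
  have hc : ∀ {i : ℕ} (hi : i < T.slices.length) (l : ℕ) (o : Bool) (j : ℕ)
      (hi' : i + 1 < (T.closure a).slices.length),
      (crossEncounter ⟨i, hi⟩ l o j).map (Encounter.map (T.closureIndex a)) =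
        crossEncounter ⟨i + 1, hi'⟩ (l + 1) o (j + 1) := by
    intro i hi l o j hi'
    simp only [crossEncounter, Nat.add_right_cancel_iff]
    split_ifs <;> cases o <;>
      simp [Encounter.line, Encounter.map, closureIndex]
  cases h with
  | @crossUp i j L R o b c hi hs hd =>
    rw [hc hi _ _ _ (by omega), ← swapAt_succ]
    exact .crossUp (L := [a.flip] ++ L) (R := R ++ []) _ (closure_getElem? hs) (by simpa using hd)
  | @crossDown i j L R o b c hi hs hd =>
    rw [hc hi _ _ _ (by omega), ← swapAt_succ]
    exact .crossDown (L := [a.flip] ++ L) (R := R ++ []) _ (closure_getElem? hs) (by simpa using hd)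
  | @cupUp i j L R b hs hd =>
    rw [← insAt_succ]
    exact .cupUp (L := [a.flip] ++ L) (R := R ++ []) (closure_getElem? hs) (by simpa using hd)
  | @cupDown i j L R b hs hd =>
    rw [← insAt_succ]
    exact .cupDown (L := [a.flip] ++ L) (R := R ++ []) (closure_getElem? hs) (by simpa using hd)
  | @cupLeg i L R b hs =>
    have := Step.cupLeg (D := T.closure a) (L := [a.flip] ++ L) (R := R ++ []) (closure_getElem? hs)
    cases b <;> simpa [downLeg, upLeg, Encounter.map] using this
  | @capUp i j L R b hs hd =>
    rw [← insAt_succ]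
    exact .capUp (L := [a.flip] ++ L) (R := R ++ []) (closure_getElem? hs) (by simpa using hd)
  | @capDown i j L R b hs hd =>
    rw [← insAt_succ]
    exact .capDown (L := [a.flip] ++ L) (R := R ++ []) (closure_getElem? hs) (by simpa using hd)
  | @capLeg i L R b hs =>
    have := Step.capLeg (D := T.closure a) (L := [a.flip] ++ L) (R := R ++ []) (closure_getElem? hs)
    cases b <;> simpa [downLeg, upLeg, Encounter.map] using this

theorem Trail.closure {c c' : List Dir} {w : List ((ℕ × ℕ) × Option (Encounter T.slices.length))}
    (hT : Composes T.bottom T.slices c)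
    (hC : Composes (T.closure a).bottom (T.closure a).slices c') (h : T.Trail p w q) :
    ∃ w', (T.closure a).Trail (p.1 + 1, p.2 + 1) w' (q.1 + 1, q.2 + 1) ∧ w'.length = w.length ∧
      w'.filterMap Prod.snd =
        (w.filterMap Prod.snd).map (Encounter.map (T.closureIndex a)) := by
  induction h with
  | nil => exact ⟨[], .nil _, rfl, rfl⟩
  | @cons p q r e w h hw ih =>
    obtain ⟨w', h₁, h₂, h₃⟩ := ih
    refine ⟨_, .cons ((step_of_visit hT h).closure.visit hC) h₁, by simp [h₂], ?_⟩
    cases e <;> simp [h₃]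

theorem exists_step_left_up {D : Diagram} {L R : List Dir} {P : Piece} {i : ℕ}
    (hs : D.slices[i]? = some ⟨.up :: L, P, R⟩) : D.Step (i, 0) none (i + 1, 0) := by
  rcases P with ⟨o, a, b⟩ | a | a
  · simpa [crossEncounter, swapAt] using
      Step.crossUp (j := 0) (List.getElem?_eq_some_iff.1 hs).1 hs (by simp)
  · simpa [insAt] using Step.capUp (j := 0) hs (by simp)
  · simpa [insAt] using Step.cupUp (j := 0) hs (by simp)

theorem exists_step_left_down {D : Diagram} {L R : List Dir} {P : Piece} {i : ℕ}
    (hs : D.slices[i]? = some ⟨.down :: L, P, R⟩) : D.Step (i + 1, 0) none (i, 0) := by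
  rcases P with ⟨o, a, b⟩ | a | a
  · simpa [crossEncounter, swapAt] using
      Step.crossDown (j := 0) (List.getElem?_eq_some_iff.1 hs).1 hs (by simp)
  · simpa [insAt] using Step.capDown (j := 0) hs (by simp)
  · simpa [insAt] using Step.cupDown (j := 0) hs (by simp)

theorem exists_trail_left_up {c : List Dir} (T : Diagram)
    (hC : Composes (T.closure .down).bottom (T.closure .down).slices c) {m : ℕ}
    (hm : m ≤ T.slices.length) : ∃ w, (T.closure .down).Trail (1, 0) w (m + 1, 0) ∧ w.length = m ∧
      w.filterMap Prod.snd = [] := by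
  induction m with
  | zero => exact ⟨[], .nil _, rfl, rfl⟩
  | succ m ih =>
    obtain ⟨w, h₁, h₂, h₃⟩ := ih (by omega)
    have hs := closure_getElem? (a := .down) (List.getElem?_eq_getElem (show m < T.slices.length by omega))
    exact ⟨_, h₁.append (.single ((exists_step_left_up hs).visit hC)), by simp [h₂], by simp [h₃]⟩

theorem exists_trail_left_down {c : List Dir} (T : Diagram)
    (hC : Composes (T.closure .up).bottom (T.closure .up).slices c) {m : ℕ}
    (hm : m ≤ T.slices.length) : ∃ w, (T.closure .up).Trail (m + 1, 0) w (1, 0) ∧ w.length = m ∧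
      w.filterMap Prod.snd = [] := by
  induction m with
  | zero => exact ⟨[], .nil _, rfl, rfl⟩
  | succ m ih =>
    obtain ⟨w, h₁, h₂, h₃⟩ := ih (by omega)
    have hs := closure_getElem? (a := .up) (List.getElem?_eq_getElem (show m < T.slices.length by omega))
    exact ⟨_, .cons ((exists_step_left_down hs).visit hC) h₁, by simp [h₂], by simp [h₃]⟩

theorem numPoints_closure (hT : T.bottom = [a]) :
    (T.closure a).numPoints = T.numPoints + (T.slices.length + 1) := by
  have : ∀ Y : List Slice, (Y.map fun s => (Slice.whisker [a.flip] [] s).cod.length).sum =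
      (Y.map fun s => s.cod.length).sum + Y.length := by
    intro Y
    induction Y with
    | nil => rfl
    | cons s Y ih =>
      simp only [List.map_cons, List.sum_cons, ih, List.length_cons]
      simp [Slice.whisker, Slice.cod]
      omega
  simp [numPoints, levels, closure, hT, Function.comp_def, this]
  simp [Slice.cod, Piece.cod]
  omega

/-- The traversal of a tangle diagram ends at the end of the arc. -/
theorem IsTangle.walk_eq (hT : T.IsTangle a) : ∃ w, T.Trail (T.start a) w (T.start a.flip) ∧
    w.length + 1 ≤ T.numPoints ∧ T.encounters (T.start a) = w.filterMap Prod.snd := by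
  obtain ⟨hb, hY, hc⟩ := hT
  have hD : Composes T.bottom T.slices [a] := by rwa [hb]
  have hend : T.HasPoint (T.start a.flip) ∧ T.visit (T.start a.flip) = none := by
    have hl : T.levels.getD T.slices.length [] = [a] := by
      obtain ⟨b, Y⟩ := T
      simp only [levels] at hD ⊢
      clear hb hY hc
      induction Y generalizing b with
      | nil =>
        obtain rfl : b = [a] := hD
        rfl
      | cons s Y ih => exact ih _ hD.2
    cases a
    · have hd : T.dirAt (T.slices.length, 0) = some .up := by
        rw [dirAt, hl]
        rfl
      simp [HasPoint, visit, start, Dir.flip, hd]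
    · have hd : T.dirAt (0, 0) = some .down := by
        rw [dirAt, levels, hb]
        rfl
      simp [HasPoint, visit, start, Dir.flip, hd]
  obtain ⟨w, m, hw, hm⟩ := exists_trail_of_mem_walk (hc _ hend.1)
  refine ⟨w, hw, by omega, ?_⟩
  rw [encounters, hm, hw.walk_add, walk, hend.2]
  simp

/-- The traversal of the closure of a tangle diagram from the beginning of the latter. -/
theorem IsTangle.exists_encounters_closure (hT : T.IsTangle a) (hK : (T.closure a).IsKnot) :
    ∃ p es, (T.closure a).HasPoint p ∧ (T.closure a).encounters p =
      (T.encounters (T.start a)).map (Encounter.map (T.closureIndex a)) ++ es ∧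
      Encounter.ud es = Encounter.uu es ∧ ∀ e ∈ es, ∃ x, e = .extremum x := by
  obtain ⟨w, hw, hl, he⟩ := hT.walk_eq
  have hD : Composes T.bottom T.slices [a] := by
    rw [hT.1]
    exact hT.2.1
  have hC := hK.composes
  obtain ⟨w', hw', hl', he'⟩ := hw.closure hD hC
  have hnum := numPoints_closure hT.1
  have h₀ : (T.closure a).slices[0]? = some ⟨[], .cup a.flip, []⟩ := rfl
  have h₁ : (T.closure a).slices[T.slices.length + 1]? = some ⟨[], .cap a.flip, []⟩ := by
    simp [Diagram.closure]
  have key : ∀ {p : ℕ × ℕ} {v : List ((ℕ × ℕ) × Option (Encounter (T.closure a).slices.length))}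
      {es : List (Encounter (T.closure a).slices.length)},
      (T.closure a).Trail p (w' ++ v) p → v.length = T.slices.length + 2 →
      v.filterMap Prod.snd = es → (T.closure a).HasPoint p ∧ (T.closure a).encounters p =
        (T.encounters (T.start a)).map (Encounter.map (T.closureIndex a)) ++ es := by
    rintro p v _ h hv rfl
    have hn : w' ++ v ≠ [] := fun h => by
      have := congrArg List.length h
      simp only [List.length_append, hv, List.length_nil] at this
      omega
    refine ⟨h.hasPoint (h.mem_of_ne_nil hn), ?_⟩
    -- By `hl` the trail through the tangle leaves room for its end point, so the closed trail has
    -- at most `numPoints` entries; as the closure is a knot it has at least that many.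
    have := hK.numPoints_le h hn
    have hlen : (T.closure a).numPoints = (w' ++ v).length := by
      rw [List.length_append] at this ⊢
      omega
    rw [encounters, hlen, h.walk_length, List.filterMap_append, he', he]
  cases a
  · obtain ⟨v, hv, hvl, hve⟩ := exists_trail_left_down T hC le_rfl
    have ht := hw'.append (.cons ((Step.capLeg h₁).visit hC)
      (hv.append (.single ((Step.cupLeg h₀).visit hC))))
    obtain ⟨h₂, h₃⟩ := key ht (by simp [hvl]) rfl
    refine ⟨_, _, h₂, h₃, ?_, ?_⟩ <;>
      simp [hve, capType, cupType, Dir.flip, Encounter.ud, Encounter.uu]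
  · obtain ⟨v, hv, hvl, hve⟩ := exists_trail_left_up T hC le_rfl
    have ht := hw'.append (.cons ((Step.cupLeg h₀).visit hC)
      (hv.append (.single ((Step.capLeg h₁).visit hC))))
    obtain ⟨h₂, h₃⟩ := key ht (by simp [hvl]) rfl
    refine ⟨_, _, h₂, h₃, ?_, ?_⟩ <;>
      simp [hve, capType, cupType, Dir.flip, Encounter.ud, Encounter.uu]

end Diagram

section Closure

variable {k A : Type*} [Field k] [Ring A] [Algebra k A] {Q : OrientedQuantumAlgebra k A} {G : Aˣ}
  {tr : A →ₗ[k] k} {T : Diagram} {a : Dir}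

theorem word_eq_one {n : ℕ} (f : Fin n → A × A) (es : List (Encounter n))
    (h : ∀ e ∈ es, ∃ x, e = .extremum x) : Q.word f es = 1 := by
  induction es with
  | nil => rfl
  | cons e es ih =>
    obtain ⟨x, rfl⟩ := h e (by simp)
    exact ih fun e he => h e (by simp [he])

theorem sum_closure {M : Type*} [AddCommMonoid M] (S : (Fin T.slices.length → A × A) → M) :
    ∑ f ∈ Fintype.piFinset fun c : Fin (T.closure a).slices.length =>
        Q.labels (T.closure a).slices[c].piece, S (f ∘ T.closureIndex a) =
      ∑ f ∈ Fintype.piFinset fun c : Fin T.slices.length => Q.labels T.slices[c].piece, S f := by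
  rw [sum_piFinset_comp _ _ (1, 1)]
  · refine Finset.sum_congr ?_ fun _ _ => rfl
    congr 1
    funext c
    have := Diagram.closure_getElem? (a := a) (List.getElem?_eq_getElem c.2)
    obtain ⟨h, e⟩ := List.getElem?_eq_some_iff.1 this
    have e' := congrArg Slice.piece e
    exact congrArg Q.labels e'
  · intro c hc
    obtain ⟨c, h⟩ := c
    have h' := h
    rw [T.length_closure] at h'
    obtain rfl | ⟨i, rfl⟩ : c = 0 ∨ ∃ i, c = i + 1 := by
      cases c
      · exact .inl rfl
      · exact .inr ⟨_, rfl⟩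
    · rfl
    · obtain rfl : i = T.slices.length := by
        by_contra hi
        exact hc ⟨i, by omega⟩ rfl
      have h₁ : (T.closure a).slices[T.slices.length + 1]? = some ⟨[], .cap a.flip, []⟩ := by
        simp [Diagram.closure]
      obtain ⟨h, e⟩ := List.getElem?_eq_some_iff.1 h₁
      exact congrArg (fun s : Slice => Q.labels s.piece) e
  · intro c c' h
    have := congrArg Fin.val h
    exact Fin.ext (Nat.succ_injective this)

/-- The added extrema contribute the same number `n` to `ud` and `uu`, so they apply `(t_d t_u)^n`,
which is conjugation by `G^n`, to the word of the tangle. This commutes with `G ^ d` and disappears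
under the trace. -/
theorem inv_closure (hG : ∀ x : A, Q.td (Q.tu x) = (G : A) * x * (↑G⁻¹ : A)) (htr : Tracelike tr)
    (hT : T.IsTangle a) (hK : (T.closure a).IsKnot) : ∃ p, (T.closure a).HasPoint p ∧
      Q.inv G tr (T.closure a) p = tr ((G ^ (T.closure a).whitney : Aˣ) * Q.wTangle T a) := by
  obtain ⟨p, es, hp, he, hu, hs⟩ := hT.exists_encounters_closure hK
  refine ⟨p, hp, ?_⟩
  have hs' := sum_closure (Q := Q) (a := a) fun f => Q.word f (T.encounters (T.start a))
  rw [inv, wTangle, w, w, ← hs', Finset.mul_sum, Finset.mul_sum, map_sum, map_sum]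
  refine Finset.sum_congr rfl fun f _ => ?_
  rw [he, word_append, word_eq_one f es hs, mul_one, word_map, hu]
  have h := td_zpow_tu_zpow hG (Encounter.uu es) (Encounter.uu es)
    (Q.word (f ∘ T.closureIndex a) (T.encounters (T.start a)))
  generalize Encounter.uu es = n at *
  rw [sub_self, zpow_zero, AlgEquiv.one_apply] at h
  rw [← Units.eq_mul_inv_iff_mul_eq] at h
  rw [h, ← mul_assoc, htr, ← mul_assoc, ← mul_assoc, ← Units.val_mul, ← Units.val_mul,
    mul_assoc, ((Commute.refl G).zpow_zpow _ n).eq, inv_mul_cancel_left]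

theorem inv_eq_tangle (hG : ∀ x : A, Q.td (Q.tu x) = (G : A) * x * (↑G⁻¹ : A))
    (htr : Tracelike tr) {K : Diagram} (hK : K.IsKnot) (hT : T.IsTangle a)
    (h : K.RegularlyIsotopic (T.closure a)) {p : ℕ × ℕ} (hp : K.HasPoint p) :
    Q.inv G tr K p = tr ((G ^ K.whitney : Aˣ) * Q.wTangle T a) := by
  have hC := h.isKnot_iff.1 hK
  obtain ⟨q, hq, e⟩ := inv_closure hG htr hT hC
  rw [h.whitney_eq, ← e, inv_eq_stateSum hG htr hK hp, inv_eq_stateSum hG htr hC hq,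
    stateSum_regularlyIsotopic htr (relations_standard Q G hG) h]

end Closure

end OQ

theorem theorem3p2 {k : Type*} {A : Type*} [Field k] [Ring A] [Algebra k A]
    (Q : OQ.OrientedQuantumAlgebra k A) (G : Aˣ)
    (hG : ∀ x : A, Q.td (Q.tu x) = (G : A) * x * (↑G⁻¹ : A))
    (tr : A →ₗ[k] k) (htr : OQ.Tracelike tr) :
    -- independence of the starting point
    (∀ K : OQ.Diagram, K.IsKnot → ∀ p p' : ℕ × ℕ, K.HasPoint p → K.HasPoint p' →
      Q.inv G tr K p = Q.inv G tr K p') ∧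
    -- invariance under regular isotopy
    (∀ K K' : OQ.Diagram, K.IsKnot → K'.IsKnot → K.RegularlyIsotopic K' →
      ∀ p p' : ℕ × ℕ, K.HasPoint p → K'.HasPoint p' →
        Q.inv G tr K p = Q.inv G tr K' p') ∧
    -- computation from tangles
    (∀ (K T : OQ.Diagram) (a : OQ.Dir), K.IsKnot → T.IsTangle a →
      K.RegularlyIsotopic (T.closure a) → ∀ p : ℕ × ℕ, K.HasPoint p →
        Q.inv G tr K p = tr ((G ^ K.whitney : Aˣ) * Q.wTangle T a)) ∧
    -- reversal of orientation
    (∀ K : OQ.Diagram, K.IsKnot → ∀ p p' : ℕ × ℕ, K.reverse.HasPoint p → K.HasPoint p' →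
      Q.inv G tr K.reverse p =
        Q.op.inv (OQ.OrientedQuantumAlgebra.invOp G) (OQ.OrientedQuantumAlgebra.trOp tr) K p') ∧
    -- the associated standard oriented quantum algebra
    (∀ K : OQ.Diagram, K.IsKnot → ∀ p p' : ℕ × ℕ, K.HasPoint p → K.HasPoint p' →
      Q.standard.inv G tr K p = Q.inv G tr K p') := by
  refine ⟨fun K hK p p' hp hp' => ?_, fun K K' hK hK' h p p' hp hp' => ?_,
    fun K T a hK hT h p hp => OQ.inv_eq_tangle hG htr hK hT h hp,
    fun K hK p p' hp hp' => OQ.inv_reverse Q htr hG hK hp hp',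
    fun K hK p p' hp hp' => OQ.inv_standard hG htr hK hp hp'⟩
  · rw [OQ.inv_eq_stateSum hG htr hK hp, OQ.inv_eq_stateSum hG htr hK hp']
  · rw [OQ.inv_eq_stateSum hG htr hK hp, OQ.inv_eq_stateSum hG htr hK' hp',
      OQ.stateSum_regularlyIsotopic htr (OQ.relations_standard Q G hG) h]
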